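/- **Conventions.** A continuous map $f:S\to S$ of a closed surface is a *branched covering* if near every point it is $z\mapsto z^n$, $n\ge 1$, in suitable charts centred at the point and at its image; it has degree $d$ if every point that is not a critical value has exactly $d$ preimages. Its post-critical set $P(f)=\bigcup_{n\ge1}f^n(\mathrm{crit}\,f)$ is the forward orbit of the critical values. For groups $H,G$, an $H$-$G$-*biset* is a set with commuting left $H$- and right $G$-actions. A *congruence* over homomorphisms $\phi,\psi$ is a map $\beta$ with $\beta(hbg)=\phi(h)\beta(b)\psi(g)$. Paths are composed from left to right. If $P(f)\subseteq A$, $f(A)\subseteq A$ and $a,b\in S\setminus A$, then $B(f;a,b)$ denotes the biset of the correspondence $S\setminus A\hookleftarrow S\setminus f^{-1}(A)\xrightarrow{f}S\setminus A$. Its elements are the classes of triples $(\delta,z,\gamma)$ with $z\in S\setminus f^{-1}(A)$, $\delta$ a path class in $S\setminus A$ from $a$ to $z$, and $\gamma$ a path class in $S\setminus A$ from $f(z)$ to $b$, where $(\delta\varepsilon,z',\gamma)\sim(\delta,z,f(\varepsilon)\gamma)$ for every path $\varepsilon$ from $z$ to $z'$ in $S\setminus f^{-1}(A)$. The groups $\pi_1(S\setminus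 A,a)$ and $\pi_1(S\setminus A,b)$ act by pre- and post-composition. A *topological polynomial* of degree $d\ge1$ is a map $p:\mathbb C\to\mathbb C$ whose extension by $\infty\mapsto\infty$ is a branched covering of degree $d$ of the sphere $\mathbb C\cup\{\infty\}$, normalized so that $p(z)/|p(z)|-(z/|z|)^d\to0$ as $z\to\infty$; thus $p$ extends to the circle at infinity by $u\mapsto u^d$. Write $P(p)\subset\mathbb C$ for the finite part of its post-critical set. A real number $R$ is *near infinity* for $p$ if there is $r$ with $0\le r<R$ such that $|z|\le r$ on $P(p)$ and, whenever $|z|\ge R$, $|p(z)|>2r$ and $\bigl|p(z)/|p(z)|-(z/|z|)^d\bigr|\le1$. If $P(p)$ is bounded, for instance finite, then every sufficiently large $R$ is near infinity. Put $G_p=\pi_1(\mathbb C\setminus P(p),R)$ and $B(p)=B(p|_{\mathbb C};R,R)$, with $A=P(p)$. The *formal mating* $p\sqcup q:S^2\to S^2$ of topological polynomials of the same degree $d$, on the unit sphere of $\mathbb C\times\mathbb R$, is $p$ on the open southern hemisphere, parametrized by $z\mapsto(z,-1)/|(z,-1)|$, is $q$ on the open northern hemisphere, parametrized by $z\mapsto(\bar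 z,1)/|(\bar z,1)|$, and is $w\mapsto w^d$ on the equator. Put $B(p\sqcup q;a,b)$ for its biset, with $A=P(p\sqcup q)$. **The graph of bisets.** Fix $R$ near infinity for $p$ and $R'$ near infinity for $q$. Let $\mathfrak X$ be the graph of groups with two vertices, carrying $G_p$ and $G_q=\pi_1(\mathbb C\setminus P(q),R')$, and one edge $e$ (with reverse $\bar e$) from the first to the second. Put $G_e=G_{\bar e}=\mathbb Z$. The maps $G_e\to G_p$ and $G_{\bar e}\to G_q$ send $1$ to the positive loop along the circle of radius $R$, respectively $R'$, and the identification $G_e\to G_{\bar e}$ is $n\mapsto-n$. Let $\mathfrak B$ be the graph of bisets over the same graph, with both structure maps $\lambda,\rho$ to $\mathfrak X$ equal to the identity. The vertices carry $B(p)$ and $B(q)$. The edges $e,\bar e$ carry the regular cyclic biset $\mathbb Z$ of degree $d$, with $m\cdot b\cdot n=dm+b+n$, and the identification $B_e\to B_{\bar e}$ is $b\mapsto-b$. The congruence $B_e\to B(p)$ sends $j$ to the class of (the arc of angle $2\pi j/d$ from $R$ to $z_j$ on the circle of radius $R$; the point $z_j=Re^{2\pi i j/d}$; the straight segment from $p(z_j)$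 to $R$), and $B_{\bar e}\to B(q)$ is defined in the same way. For vertices $u,v$, let $\pi_1(\mathfrak X,u)$ be the fundamental group and $\pi_1(\mathfrak B,u,v)$ the fundamental biset, a $\pi_1(\mathfrak X,u)$-$\pi_1(\mathfrak X,v)$-biset. **Theorem.** Let $p,q$ be topological polynomials of the same degree $d$, and let $R,R'$ be near infinity for $p$ and $q$. Then $P(p\sqcup q)$ is the union of the images of $P(p)$ and $P(q)$ in the two hemispheres. Let $x_p,x_q\in S^2\setminus P(p\sqcup q)$ be the images of the basepoints $R,R'$; put $x_u=x_p$ if $u$ is the first vertex, and $x_u=x_q$ if $u$ is the second. 1. For each vertex $v$, the inclusions of the two hemispheres, together with the meridian path from $x_p$ to $x_q$ across the equator (for the edge $e$), induce an isomorphism $\theta_v:\pi_1(\mathfrak X,v)\to\pi_1(S^2\setminus P(p\sqcup q),x_v)$. 2. For all vertices $u,v$, the inclusions of the two hemispheres induce a well-defined bijection $$\beta_{u,v}:\pi_1(\mathfrak B,u,v)\longrightarrow B(p\sqcup q;x_u,x_v),\qquad \beta_{u,v}(hbg)=\theta_u(h)\,\beta_{u,v}(b)\,\theta_v(g),$$ which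 on a class $[h,b,g]$, with $b$ in a vertex biset and $h,g$ paths of groups from $u$ to that vertex and from that vertex to $v$, is the image of $b$ composed with the paths in the sphere given by $h$ and $g$. In particular, taking $u=v$, the fundamental biset of $\mathfrak B$ is isomorphic to the biset of the formal mating $p\sqcup q$. -/

import Mathlib

open Filter Topology Set

namespace Mating

/-! ### Bisets -/

/-- An `H`-`G`-biset: a set with commuting left `H`- and right `G`-actions;
`act h b g` is `h · b · g`. -/
structure Biset (H G : Type) [Group H] [Group G] where
  carrier : Type
  act : H → carrier → G → carrier
  act_one : ∀ b, act 1 b 1 = b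
  act_mul : ∀ h' h b g g', act h' (act h b g) g' = act (h' * h) b (g * g')

/-- `β` is a `(ψ, φ)`-congruence from `B` to `B'`. -/
def Biset.IsCongruence {H G H' G' : Type} [Group H] [Group G] [Group H'] [Group G']
    (B : Biset H G) (B' : Biset H' G') (ψ : H →* H') (φ : G →* G')
    (β : B.carrier → B'.carrier) : Prop :=
  ∀ h b g, β (B.act h b g) = B'.act (ψ h) (β b) (φ g)

/-- The regular cyclic biset of degree `d`: the set `ℤ` with `m · b · n = d m + b + n`
(`b` stands for `t ^ (b / d)`). -/
def regularCyclic (d : ℕ) : Biset (Multiplicative ℤ) (Multiplicative ℤ) where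
  carrier := ℤ
  act m b n := (d : ℤ) * m.toAdd + b + n.toAdd
  act_one b := by simp
  act_mul h' h b g g' := by simp only [toAdd_mul]; ring

/-! ### Graphs of groups -/

/-- A graph: vertices and edges together, with origin `src x = x⁻` and reversal `rev`. -/
structure Graph where
  Obj : Type
  src : Obj → Obj
  rev : Obj → Obj
  rev_rev : ∀ x, rev (rev x) = x
  src_src : ∀ x, src (src x) = src x
  src_eq_iff : ∀ x, src x = x ↔ rev x = x

namespace Graph

/-- Vertices are the objects that equal their origin. -/
def Vert (Γ : Graph) : Type := {x : Γ.Obj // Γ.src x = x}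

/-- The terminus. -/
def tgt (Γ : Graph) (x : Γ.Obj) : Γ.Obj := Γ.src (Γ.rev x)

def srcV (Γ : Graph) (x : Γ.Obj) : Γ.Vert := ⟨Γ.src x, Γ.src_src x⟩

def tgtV (Γ : Graph) (x : Γ.Obj) : Γ.Vert := ⟨Γ.tgt x, Γ.src_src _⟩

/-- A graph is connected if any two vertices are joined by a chain of objects. -/
def IsConnected (Γ : Graph) : Prop :=
  ∀ u v : Γ.Vert, Relation.ReflTransGen (fun a b => ∃ x, Γ.srcV x = a ∧ Γ.tgtV x = b) u v

end Graph

/-- Graph morphisms; they may send edges to vertices. -/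
structure GraphHom (A B : Graph) where
  toFun : A.Obj → B.Obj
  map_src : ∀ x, toFun (A.src x) = B.src (toFun x)
  map_rev : ∀ x, toFun (A.rev x) = B.rev (toFun x)

namespace GraphHom

variable {A B : Graph}

def vert (f : GraphHom A B) (v : A.Vert) : B.Vert :=
  ⟨f.toFun v.1, by rw [← f.map_src, v.2]⟩

theorem map_tgt (f : GraphHom A B) (x : A.Obj) : f.toFun (A.tgt x) = B.tgt (f.toFun x) := by
  rw [Graph.tgt, f.map_src, f.map_rev, Graph.tgt]

protected def id (A : Graph) : GraphHom A A := ⟨fun x => x, fun _ => rfl, fun _ => rfl⟩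

end GraphHom

/-- A graph of groups; `toSrc : G x → G x⁻` and `bar : G x → G x̄`. -/
structure GraphOfGroups where
  graph : Graph
  connected : graph.IsConnected
  G : graph.Obj → Type
  [grp : ∀ x, Group (G x)]
  toSrc : ∀ x, G x →* G (graph.src x)
  bar : ∀ x, G x →* G (graph.rev x)
  bar_bar : ∀ x g, HEq (bar (graph.rev x) (bar x g)) g
  toSrc_vert : ∀ x, graph.src x = x → ∀ g, HEq (toSrc x g) g
  bar_vert : ∀ x, graph.src x = x → ∀ g, HEq (bar x g) g

attribute [instance] GraphOfGroups.grp

namespace GraphOfGroups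

variable (X : GraphOfGroups)

/-- The identification of the groups attached to equal objects. -/
def castG {x y : X.graph.Obj} (h : x = y) : X.G x →* X.G y := h ▸ MonoidHom.id (X.G x)

/-- Formal expressions for group-decorated paths from `u` to `v`: words in the elements of the
vertex groups and in the objects `x : x⁻ → x⁺` of the graph, and their formal inverses. -/
inductive GPath : X.graph.Vert → X.graph.Vert → Type
  | elt {v : X.graph.Vert} (g : X.G v.1) : GPath v v
  | edge (x : X.graph.Obj) {u v : X.graph.Vert} (hu : X.graph.src x = u.1)
      (hv : X.graph.tgt x = v.1) : GPath u v
  | comp {u v w : X.graph.Vert} (a : GPath u v) (b : GPath v w) : GPath u w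
  | inv {u v : X.graph.Vert} (a : GPath u v) : GPath v u

variable {X}

open GPath in
/-- The relations of the fundamental groupoid: those of a groupoid, those of the groups `G v`,
`v = 1` for vertices `v`, `x x̄ = 1`, and `g⁻ x = x g⁺` for `g ∈ G x`. -/
inductive Rel : ∀ {u v : X.graph.Vert}, GPath X u v → GPath X u v → Prop
  | assoc {u v w t} (a : GPath X u v) (b : GPath X v w) (c : GPath X w t) :
      Rel (comp (comp a b) c) (comp a (comp b c))
  | one_comp {u v} (a : GPath X u v) : Rel (comp (elt 1) a) a
  | comp_one {u v} (a : GPath X u v) : Rel (comp a (elt 1)) a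
  | inv_comp {u v} (a : GPath X u v) : Rel (comp (inv a) a) (elt 1)
  | comp_inv {u v} (a : GPath X u v) : Rel (comp a (inv a)) (elt 1)
  | comp_left {u v w} {a a' : GPath X u v} (b : GPath X v w) (h : Rel a a') :
      Rel (comp a b) (comp a' b)
  | comp_right {u v w} (a : GPath X u v) {b b' : GPath X v w} (h : Rel b b') :
      Rel (comp a b) (comp a b')
  | inv_congr {u v} {a a' : GPath X u v} (h : Rel a a') : Rel (inv a) (inv a')
  | elt_mul {v : X.graph.Vert} (g h : X.G v.1) : Rel (comp (elt g) (elt h)) (elt (g * h))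
  | vert {v : X.graph.Vert} (hs : X.graph.src v.1 = v.1) (ht : X.graph.tgt v.1 = v.1) :
      Rel (edge v.1 hs ht : GPath X v v) (elt 1)
  | edge_rev (x : X.graph.Obj) {u v : X.graph.Vert} (hu : X.graph.src x = u.1)
      (hv : X.graph.tgt x = v.1) (hu' : X.graph.src (X.graph.rev x) = v.1)
      (hv' : X.graph.tgt (X.graph.rev x) = u.1) :
      Rel (comp (edge x hu hv) (edge (X.graph.rev x) hu' hv')) (elt 1)
  | slide (x : X.graph.Obj) (g : X.G x) :
      Rel (comp (elt (v := X.graph.srcV x) (X.toSrc x g))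
            (edge x (v := X.graph.tgtV x) rfl rfl))
          (comp (edge x (u := X.graph.srcV x) rfl rfl)
            (elt (v := X.graph.tgtV x) (X.toSrc (X.graph.rev x) (X.bar x g))))

variable (X) in
/-- Morphisms from `u` to `v` in the fundamental groupoid of a graph of groups. -/
def Hom (u v : X.graph.Vert) : Type := Quot (Rel (X := X) (u := u) (v := v))

namespace Hom

variable {u v w t : X.graph.Vert}

def mk (a : GPath X u v) : X.Hom u v := Quot.mk _ a

def comp : X.Hom u v → X.Hom v w → X.Hom u w :=
  Quot.map₂ GPath.comp (fun a _ _ h => Rel.comp_right a h) (fun _ _ b h => Rel.comp_left b h)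

def inv : X.Hom u v → X.Hom v u := Quot.map GPath.inv fun _ _ h => Rel.inv_congr h

def one (v : X.graph.Vert) : X.Hom v v := mk (GPath.elt 1)

theorem assoc (a : X.Hom u v) (b : X.Hom v w) (c : X.Hom w t) :
    comp (comp a b) c = comp a (comp b c) := by
  induction a using Quot.ind; induction b using Quot.ind; induction c using Quot.ind
  exact Quot.sound (Rel.assoc _ _ _)

theorem one_comp (a : X.Hom u v) : comp (one u) a = a := by
  induction a using Quot.ind
  exact Quot.sound (Rel.one_comp _)

theorem comp_one (a : X.Hom u v) : comp a (one v) = a := by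
  induction a using Quot.ind
  exact Quot.sound (Rel.comp_one _)

theorem inv_comp (a : X.Hom u v) : comp (inv a) a = one v := by
  induction a using Quot.ind
  exact Quot.sound (Rel.inv_comp _)

end Hom

variable (X) in
/-- The fundamental group of a graph of groups at the vertex `v`. -/
def FundGroup (v : X.graph.Vert) : Type := X.Hom v v

instance (v : X.graph.Vert) : Group (X.FundGroup v) where
  mul := Hom.comp
  one := Hom.one v
  inv := Hom.inv
  mul_assoc := Hom.assoc
  one_mul := Hom.one_comp
  mul_one := Hom.comp_one
  inv_mul_cancel := Hom.inv_comp

end GraphOfGroups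

/-! ### Graphs of bisets -/

/-- A graph of bisets between the graphs of groups `Y` and `X`. -/
structure GraphOfBisets (Y X : GraphOfGroups) where
  graph : Graph
  lam : GraphHom graph Y.graph
  rho : GraphHom graph X.graph
  B : ∀ z, Biset (Y.G (lam.toFun z)) (X.G (rho.toFun z))
  toSrc : ∀ z, (B z).carrier → (B (graph.src z)).carrier
  toSrc_congr : ∀ z, (B z).IsCongruence (B (graph.src z))
    ((Y.castG (lam.map_src z).symm).comp (Y.toSrc _))
    ((X.castG (rho.map_src z).symm).comp (X.toSrc _)) (toSrc z)
  bar : ∀ z, (B z).carrier → (B (graph.rev z)).carrier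
  bar_congr : ∀ z, (B z).IsCongruence (B (graph.rev z))
    ((Y.castG (lam.map_rev z).symm).comp (Y.bar _))
    ((X.castG (rho.map_rev z).symm).comp (X.bar _)) (bar z)
  bar_bar : ∀ z b, HEq (bar (graph.rev z) (bar z b)) b
  toSrc_vert : ∀ z, graph.src z = z → ∀ b, HEq (toSrc z b) b
  bar_vert : ∀ z, graph.src z = z → ∀ b, HEq (bar z b) b

namespace GraphOfBisets

open GraphOfGroups

variable {Y X : GraphOfGroups} (𝔅 : GraphOfBisets Y X)

/-- The triples `(q, b, p)` with `q` a path from `s` to `λ(z)`, `b ∈ B z`, and `p` a path from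
`ρ(z)` to `t`, for a vertex `z`. -/
structure Triple (s : Y.graph.Vert) (t : X.graph.Vert) where
  z : 𝔅.graph.Vert
  q : Y.Hom s (𝔅.lam.vert z)
  b : (𝔅.B z.1).carrier
  p : X.Hom (𝔅.rho.vert z) t

/-- The relations `(q h, b, p) = (q, h b, p)`, `(q, b g, p) = (q, b, g p)` of the tensor product,
and `(q, b⁻, p) = (q λ(z), b⁺, ρ(z)⁻¹ p)` for `b ∈ B z`, where `ρ(z)⁻¹` is the reverse of
`ρ(z)`. -/
inductive TripleRel {s : Y.graph.Vert} {t : X.graph.Vert} : 𝔅.Triple s t → 𝔅.Triple s t → Prop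
  | left (z : 𝔅.graph.Vert) (q : Y.Hom s (𝔅.lam.vert z)) (h : Y.G (𝔅.lam.toFun z.1))
      (b : (𝔅.B z.1).carrier) (p : X.Hom (𝔅.rho.vert z) t) :
      TripleRel ⟨z, q.comp (Hom.mk (GPath.elt h)), b, p⟩ ⟨z, q, (𝔅.B z.1).act h b 1, p⟩
  | right (z : 𝔅.graph.Vert) (q : Y.Hom s (𝔅.lam.vert z)) (g : X.G (𝔅.rho.toFun z.1))
      (b : (𝔅.B z.1).carrier) (p : X.Hom (𝔅.rho.vert z) t) :
      TripleRel ⟨z, q, (𝔅.B z.1).act 1 b g, p⟩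
        ⟨z, q, b, (Hom.mk (GPath.elt (v := 𝔅.rho.vert z) g)).comp p⟩
  | edge (z : 𝔅.graph.Obj) (q : Y.Hom s (𝔅.lam.vert (𝔅.graph.srcV z))) (b : (𝔅.B z).carrier)
      (p : X.Hom (𝔅.rho.vert (𝔅.graph.srcV z)) t) :
      TripleRel ⟨𝔅.graph.srcV z, q, 𝔅.toSrc z b, p⟩
        ⟨𝔅.graph.tgtV z,
          q.comp (Hom.mk (GPath.edge (𝔅.lam.toFun z) (𝔅.lam.map_src z).symm
            (𝔅.lam.map_tgt z).symm)),
          𝔅.toSrc (𝔅.graph.rev z) (𝔅.bar z b),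
          (Hom.mk (GPath.edge (X.graph.rev (𝔅.rho.toFun z)) (u := 𝔅.rho.vert (𝔅.graph.tgtV z))
            (v := 𝔅.rho.vert (𝔅.graph.srcV z)) (𝔅.rho.map_tgt z).symm
            (by rw [Graph.tgt, X.graph.rev_rev]; exact (𝔅.rho.map_src z).symm))).comp p⟩

variable {𝔅} in
theorem TripleRel.act {s : Y.graph.Vert} {t : X.graph.Vert} (h : Y.FundGroup s)
    (g : X.FundGroup t) {a b : 𝔅.Triple s t} (r : 𝔅.TripleRel a b) :
    𝔅.TripleRel ⟨a.z, Hom.comp h a.q, a.b, Hom.comp a.p g⟩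
      ⟨b.z, Hom.comp h b.q, b.b, Hom.comp b.p g⟩ := by
  cases r with
  | left z q k b p =>
    exact (congrArg (fun x => 𝔅.TripleRel ⟨z, x, b, Hom.comp p g⟩
      ⟨z, Hom.comp h q, (𝔅.B z.1).act k b 1, Hom.comp p g⟩)
      (Hom.assoc h q _)).mp (TripleRel.left z (Hom.comp h q) k b (Hom.comp p g))
  | right z q k b p =>
    exact (congrArg (fun x => 𝔅.TripleRel ⟨z, Hom.comp h q, (𝔅.B z.1).act 1 b k, Hom.comp p g⟩
      ⟨z, Hom.comp h q, b, x⟩)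
      (Hom.assoc _ p g).symm).mp (TripleRel.right z (Hom.comp h q) k b (Hom.comp p g))
  | edge z q b p =>
    exact (congrArg₂ (fun x y => 𝔅.TripleRel
      ⟨𝔅.graph.srcV z, Hom.comp h q, 𝔅.toSrc z b, Hom.comp p g⟩
      ⟨𝔅.graph.tgtV z, x, 𝔅.toSrc (𝔅.graph.rev z) (𝔅.bar z b), y⟩)
      (Hom.assoc h q _) (Hom.assoc _ p g).symm).mp
      (TripleRel.edge z (Hom.comp h q) b (Hom.comp p g))

/-- The fundamental biset `π₁(𝔅, s, t)`. -/
def fundBiset (s : Y.graph.Vert) (t : X.graph.Vert) :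
    Biset (Y.FundGroup s) (X.FundGroup t) where
  carrier := Quot (𝔅.TripleRel (s := s) (t := t))
  act h b g := Quot.map (fun a => (⟨a.z, Hom.comp h a.q, a.b, Hom.comp a.p g⟩ : 𝔅.Triple s t))
    (fun _ _ r => TripleRel.act h g r) b
  act_one b := by
    induction b using Quot.ind with
    | mk a => exact congrArg (Quot.mk _) (by
        obtain ⟨z, q, b, p⟩ := a
        exact congrArg₂ (fun q p => (⟨z, q, b, p⟩ : 𝔅.Triple s t)) (Hom.one_comp q)
          (Hom.comp_one p))
  act_mul h' h b g g' := by
    induction b using Quot.ind with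
    | mk a => exact congrArg (Quot.mk _) (by
        obtain ⟨z, q, b, p⟩ := a
        exact congrArg₂ (fun q p => (⟨z, q, b, p⟩ : 𝔅.Triple s t)) (Hom.assoc h' h q).symm
          (Hom.assoc p g g'))

variable {𝔅} in
/-- The class of the triple `(q, b, p)` in the fundamental biset. -/
def fundBiset.mk {s : Y.graph.Vert} {t : X.graph.Vert} (z : 𝔅.graph.Vert)
    (q : Y.Hom s (𝔅.lam.vert z)) (b : (𝔅.B z.1).carrier) (p : X.Hom (𝔅.rho.vert z) t) :
    (𝔅.fundBiset s t).carrier :=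
  Quot.mk _ ⟨z, q, b, p⟩

end GraphOfBisets

/-! ### Fundamental groups and bisets of correspondences -/

/-- The fundamental group, with the product given by concatenation of loops in reading order
(the opposite of the order in `FundamentalGroup`). -/
def Pi1 {X : Type} [TopologicalSpace X] (x : X) : Type := Path.Homotopic.Quotient x x

noncomputable instance {X : Type} [TopologicalSpace X] (x : X) : Group (Pi1 x) where
  mul := Path.Homotopic.Quotient.trans
  one := Path.Homotopic.Quotient.refl x
  inv := Path.Homotopic.Quotient.symm
  mul_assoc := Path.Homotopic.Quotient.trans_assoc
  one_mul := Path.Homotopic.Quotient.refl_trans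
  mul_one := Path.Homotopic.Quotient.trans_refl
  inv_mul_cancel := Path.Homotopic.Quotient.symm_trans

/-- Homotopy classes, relative to the endpoints, of paths from `x` to `y`. -/
abbrev PathClass {X : Type} [TopologicalSpace X] (x y : X) : Type := Path.Homotopic.Quotient x y

section Correspondence

open Path.Homotopic.Quotient

variable {Z Y X : Type} [TopologicalSpace Z] [TopologicalSpace Y] [TopologicalSpace X]

/-- Triples `(δ, z, γ)`: a point `z ∈ Z`, a path `δ` in `Y` from `a` to `i z` and a path `γ` in
`X` from `f z` to `b`, the paths up to homotopy. -/
structure CorrTriple (i : C(Z, Y)) (f : C(Z, X)) (a : Y) (b : X) where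
  z : Z
  δ : PathClass a (i z)
  γ : PathClass (f z) b

/-- Moving the point `z` along a path `ε` in `Z` to `z'`, with `δ` and `γ` moving along:
`(δ, z, f(ε) γ) = (δ i(ε), z', γ)`. -/
inductive CorrRel (i : C(Z, Y)) (f : C(Z, X)) (a : Y) (b : X) :
    CorrTriple i f a b → CorrTriple i f a b → Prop
  | move (z z' : Z) (ε : PathClass z z') (δ : PathClass a (i z)) (γ : PathClass (f z') b) :
      CorrRel i f a b ⟨z, δ, (ε.map f).trans γ⟩ ⟨z', δ.trans (ε.map i), γ⟩

/-- The underlying set of the biset `B(f, i)` of the correspondence `Y ← Z → X`, with basepoints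
`a ∈ Y` and `b ∈ X`. Equivalently, it is the disjoint union over the path components of `Z`, with
basepoints `z`, of the products of the contragredient of `B(i, z, a)` with `B(f, z, b)` over
`π₁(Z, z)`. -/
def Corr (i : C(Z, Y)) (f : C(Z, X)) (a : Y) (b : X) : Type := Quot (CorrRel i f a b)

namespace Corr

variable {i : C(Z, Y)} {f : C(Z, X)}

/-- The class of the triple `(δ, z, γ)`. -/
def mk {a : Y} {b : X} (z : Z) (δ : PathClass a (i z)) (γ : PathClass (f z) b) : Corr i f a b :=
  Quot.mk _ ⟨z, δ, γ⟩

/-- `(α, (δ, z, γ), ε) ↦ (α δ, z, γ ε)`, for paths `α` from `a'` to `a` and `ε` from `b`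
to `b'`. -/
noncomputable def translate {a a' : Y} {b b' : X} (α : PathClass a' a) (t : Corr i f a b)
    (ε : PathClass b b') : Corr i f a' b' :=
  Quot.map (fun t => (⟨t.z, α.trans t.δ, t.γ.trans ε⟩ : CorrTriple i f a' b'))
    (by rintro _ _ ⟨z, z', η, δ, γ⟩
        have := CorrRel.move (i := i) (f := f) z z' η (α.trans δ) (γ.trans ε)
        rwa [trans_assoc, ← trans_assoc (η.map f)] at this) t

variable (i f) in
/-- The biset `B(f, i)` of the correspondence `Y ← Z → X`. -/
noncomputable def biset (a : Y) (b : X) : Biset (Pi1 a) (Pi1 b) where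
  carrier := Corr i f a b
  act h t g := translate h t g
  act_one t := by
    induction t using Quot.ind with
    | mk t => exact congrArg₂ (mk t.z) (refl_trans t.δ) (trans_refl t.γ)
  act_mul h' h t g g' := by
    induction t using Quot.ind with
    | mk t => exact congrArg₂ (mk t.z) (trans_assoc h' h t.δ).symm (trans_assoc t.γ g g')

theorem mk_cast {a : Y} {b : X} {z z' : Z} (h : z' = z) (δ : PathClass a (i z))
    (γ : PathClass (f z) b) :
    mk z' (δ.cast rfl (congrArg i h)) (γ.cast (congrArg f h) rfl) = mk z δ γ := by
  subst h; simp

theorem mk_move {a : Y} {b : X} {z z' : Z} (ε : PathClass z z') (δ : PathClass a (i z))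
    (γ : PathClass (f z') b) :
    mk z δ ((ε.map f).trans γ) = mk z' (δ.trans (ε.map i)) γ :=
  Quot.sound (.move z z' ε δ γ)

variable {Z' Y' X' : Type} [TopologicalSpace Z'] [TopologicalSpace Y'] [TopologicalSpace X']
  {i' : C(Z', Y')} {f' : C(Z', X')}

theorem map_trans' {A B : Type} [TopologicalSpace A] [TopologicalSpace B] {x y z : A}
    (p : PathClass x y) (q : PathClass y z) (j : C(A, B)) :
    (p.trans q).map j = (p.map j).trans (q.map j) :=
  (FundamentalGroupoid.map j).map_comp (X := ⟨x⟩) (Y := ⟨y⟩) (Z := ⟨z⟩) p q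

/-- The map `B(f, i) → B(f', i')` induced by a morphism of correspondences. -/
def push (jZ : C(Z, Z')) (jY : C(Y, Y')) (jX : C(X, X')) (hi : ∀ z, i' (jZ z) = jY (i z))
    (hf : ∀ z, f' (jZ z) = jX (f z)) {a : Y} {b : X} (t : Corr i f a b) :
    Corr i' f' (jY a) (jX b) :=
  Quot.map (fun t => (⟨jZ t.z, (t.δ.map jY).cast rfl (hi _), (t.γ.map jX).cast (hf _) rfl⟩ :
      CorrTriple i' f' (jY a) (jX b)))
    (by
      rintro _ _ ⟨z, z', η, δ, γ⟩
      have := CorrRel.move (i := i') (f := f') (jZ z) (jZ z') (η.map jZ)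
        ((δ.map jY).cast rfl (hi _)) ((γ.map jX).cast (hf _) rfl)
      have e1 : ((η.map jZ).map f').trans ((γ.map jX).cast (hf _) rfl) =
          (((η.map f).trans γ).map jX).cast (hf _) rfl := by
        rw [map_trans']
        obtain ⟨η, rfl⟩ := mk_surjective η
        obtain ⟨γ, rfl⟩ := mk_surjective γ
        refine congrArg Path.Homotopic.Quotient.mk (Path.ext (funext fun s => ?_))
        simp only [Path.trans_apply, Path.cast_coe, Path.map_coe, Function.comp]
        split_ifs
        · exact hf _
        · rfl
      have e2 : ((δ.map jY).cast rfl (hi _)).trans ((η.map jZ).map i') =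
          ((δ.trans (η.map i)).map jY).cast rfl (hi _) := by
        rw [map_trans']
        obtain ⟨η, rfl⟩ := mk_surjective η
        obtain ⟨δ, rfl⟩ := mk_surjective δ
        refine congrArg Path.Homotopic.Quotient.mk (Path.ext (funext fun s => ?_))
        simp only [Path.trans_apply, Path.cast_coe, Path.map_coe, Function.comp]
        split_ifs
        · rfl
        · exact hi _
      rwa [e1, e2] at this) t

end Corr

end Correspondence

/-! ### Branched coverings of surfaces -/

section Branched

variable {S T : Type} [TopologicalSpace S] [TopologicalSpace T]

/-- In suitable charts centred at `x` and at `f x`, the map `f` is `z ↦ z ^ n` near `x`. -/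
def IsLocallyPower (f : S → T) (x : S) (n : ℕ) : Prop :=
  ∃ (φ : OpenPartialHomeomorph S ℂ) (ψ : OpenPartialHomeomorph T ℂ),
    x ∈ φ.source ∧ f x ∈ ψ.source ∧ φ x = 0 ∧ ψ (f x) = 0 ∧
      ∀ᶠ y in 𝓝 x, f y ∈ ψ.source ∧ ψ (f y) = φ y ^ n

/-- Branched coverings (of closed surfaces). -/
def IsBranchedCovering (f : S → T) : Prop :=
  Continuous f ∧ ∀ x, ∃ n, 1 ≤ n ∧ IsLocallyPower f x n

/-- The critical points: the local model is `z ↦ z ^ n` with `n ≥ 2`. -/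
def criticalSet (f : S → T) : Set S := {x | ∃ n, 2 ≤ n ∧ IsLocallyPower f x n}

/-- The degree is the number of preimages of a point that is not a critical value. -/
def HasDegree (f : S → T) (d : ℕ) : Prop :=
  ∀ y, y ∉ f '' criticalSet f → (f ⁻¹' {y}).ncard = d

/-- The post-critical set: the forward orbit of the critical values. -/
def postcriticalSet (f : S → S) : Set S := {y | ∃ n, 1 ≤ n ∧ ∃ c ∈ criticalSet f, f^[n] c = y}

theorem mapsTo_postcriticalSet (f : S → S) :
    MapsTo f (postcriticalSet f) (postcriticalSet f) := by
  rintro _ ⟨n, _, c, hc, rfl⟩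
  exact ⟨n + 1, by omega, c, hc, Function.iterate_succ_apply' f n c⟩

/-- For `f(A) ⊆ A`, the inclusion `S \ f⁻¹(A) → S \ A`. -/
def inclusion (f : C(S, S)) {A : Set S} (hA : MapsTo f A A) : C({x // f x ∉ A}, {x // x ∉ A}) where
  toFun x := ⟨x.1, fun h => x.2 (hA h)⟩

/-- The restriction `S \ f⁻¹(A) → S \ A` of `f`. -/
def restriction (f : C(S, S)) (A : Set S) : C({x // f x ∉ A}, {x // x ∉ A}) where
  toFun x := ⟨f x.1, x.2⟩

/-- The biset of the self-correspondence of `S \ A` given by the partial map `f`, defined on the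
complement of `f⁻¹(A)`, for `f(A) ⊆ A`. -/
noncomputable abbrev partialBiset (f : C(S, S)) {A : Set S} (hA : MapsTo f A A)
    (a b : {x // x ∉ A}) : Biset (Pi1 a) (Pi1 b) :=
  Corr.biset (inclusion f hA) (restriction f A) a b

end Branched

/-! ### Topological polynomials -/

/-- Topological polynomials of degree `d`: maps of the plane that extend, by fixing `∞`, to
branched coverings of the sphere of degree `d`, normalized so that they extend to the circle at
infinity by `z ↦ z ^ d`. -/
structure TopologicalPolynomial (d : ℕ) where
  toFun : ℂ → ℂ
  branched : IsBranchedCovering (OnePoint.map toFun)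
  degree_pos : 0 < d
  degree : HasDegree (OnePoint.map toFun) d
  normalized : Tendsto (fun z => toFun z / (‖toFun z‖ : ℂ) - (z / (‖z‖ : ℂ)) ^ d)
    (cocompact ℂ) (𝓝 0)

namespace TopologicalPolynomial

variable {d : ℕ} (p : TopologicalPolynomial d)

theorem continuous : Continuous p.toFun := (OnePoint.continuous_map_iff.mp p.branched.1).1

theorem tendsto : Tendsto p.toFun (cocompact ℂ) (cocompact ℂ) := by
  simpa using (OnePoint.continuous_map_iff.mp p.branched.1).2

def map : C(ℂ, ℂ) := ⟨p.toFun, p.continuous⟩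

/-- The finite part of the post-critical set. -/
def P : Set ℂ := postcriticalSet p.toFun

theorem mapsTo_P : MapsTo p.map p.P p.P := mapsTo_postcriticalSet p.toFun

/-- The positive real number `R` is close to `∞`: there is `r < R` such that the post-critical set
lies in the disk of radius `r`, and for `|z| ≥ R` the point `p z` has modulus more than `2 r` and
its direction differs by at most 60 degrees from that of `z ^ d`. -/
def NearInfinity (R : ℝ) : Prop :=
  ∃ r, 0 ≤ r ∧ r < R ∧ (∀ z ∈ p.P, ‖z‖ ≤ r) ∧
    ∀ z : ℂ, R ≤ ‖z‖ → 2 * r < ‖p.toFun z‖ ∧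
      ‖p.toFun z / (‖p.toFun z‖ : ℂ) - (z / (‖z‖ : ℂ)) ^ d‖ ≤ 1

variable {p} {R : ℝ}

theorem NearInfinity.pos (hR : p.NearInfinity R) : 0 < R := by
  obtain ⟨r, h0, h1, -⟩ := hR
  linarith

theorem NearInfinity.notMem (hR : p.NearInfinity R) {z : ℂ} (hz : R ≤ ‖z‖) : z ∉ p.P := by
  obtain ⟨r, h0, h1, h2, -⟩ := hR
  intro h
  linarith [h2 z h]

theorem NearInfinity.map_notMem (hR : p.NearInfinity R) {z : ℂ} (hz : R ≤ ‖z‖) :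
    p.toFun z ∉ p.P := by
  obtain ⟨r, h0, h1, h2, h3⟩ := hR
  intro h
  linarith [h2 _ h, (h3 z hz).1]

/-- The point of the circle of radius `R` at angle `2πx`. -/
noncomputable def circlePt (R x : ℝ) : ℂ := R * Complex.exp (2 * Real.pi * x * Complex.I)

theorem circlePt_eq (R x : ℝ) :
    circlePt R x = R * Complex.exp ((2 * Real.pi * x : ℝ) * Complex.I) := by
  simp [circlePt]

theorem norm_circlePt (hR : 0 < R) (x : ℝ) : ‖circlePt R x‖ = R := by
  rw [circlePt_eq, norm_mul, Complex.norm_exp_ofReal_mul_I]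
  simp [abs_of_pos hR]

theorem circlePt_add_int (R x : ℝ) (k : ℤ) : circlePt R (x + k) = circlePt R x := by
  rw [circlePt, circlePt, Complex.ofReal_add, mul_add, add_mul, Complex.exp_add,
    Complex.ofReal_intCast, show 2 * (Real.pi : ℂ) * k * Complex.I
      = k * (2 * Real.pi * Complex.I) by ring, Complex.exp_int_mul_two_pi_mul_I, mul_one]

theorem circlePt_int (R : ℝ) (k : ℤ) : circlePt R k = R := by
  have := circlePt_add_int R 0 k
  rw [zero_add] at this
  rw [this, circlePt]
  simp

theorem continuous_circlePt (R : ℝ) : Continuous (circlePt R) := by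
  unfold circlePt
  fun_prop

/-- The circle of radius `R`, as a map `ℝ → ℂ \ P(p)` of period `1`. -/
noncomputable def circle (hR : p.NearInfinity R) : C(ℝ, {z : ℂ // z ∉ p.P}) where
  toFun x := ⟨circlePt R x, hR.notMem (norm_circlePt hR.pos x).ge⟩
  continuous_toFun := (continuous_circlePt R).subtype_mk _

/-- The same circle in the domain `ℂ \ p⁻¹(P(p))` of the partial self-covering `p`. -/
noncomputable def circleDom (hR : p.NearInfinity R) : C(ℝ, {z : ℂ // p.map z ∉ p.P}) where
  toFun x := ⟨circlePt R x, hR.map_notMem (norm_circlePt hR.pos x).ge⟩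
  continuous_toFun := (continuous_circlePt R).subtype_mk _

theorem circle_add_int (hR : p.NearInfinity R) (x : ℝ) (k : ℤ) :
    circle hR (x + k) = circle hR x := Subtype.ext (circlePt_add_int R x k)

theorem circleDom_add_int (hR : p.NearInfinity R) (x : ℝ) (k : ℤ) :
    circleDom hR (x + k) = circleDom hR x := Subtype.ext (circlePt_add_int R x k)

/-- The basepoint `R ∈ ℂ \ P(p)` close to infinity. -/
def base (hR : p.NearInfinity R) : {z : ℂ // z ∉ p.P} :=
  ⟨(R : ℂ), hR.notMem (by simp [abs_of_pos hR.pos])⟩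

theorem circle_int (hR : p.NearInfinity R) (k : ℤ) : circle hR k = base hR :=
  Subtype.ext (circlePt_int R k)

theorem circle_zero (hR : p.NearInfinity R) : circle hR 0 = base hR := by
  simpa using circle_int hR 0

/-- The segment from `a` to `b` in `ℝ`. -/
noncomputable def seg (a b : ℝ) : Path a b where
  toFun s := (1 - s) * a + s * b
  source' := by simp
  target' := by simp

theorem seg_trans (a b c : ℝ) : ((seg a b).trans (seg b c)).Homotopic (seg a c) :=
  SimplyConnectedSpace.paths_homotopic _ _

/-- The class of the path `s ↦ R exp(2πi((1 - s) a + s b))`, viewed as a path from `x` to `y`. -/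
noncomputable def arc (hR : p.NearInfinity R) (a b : ℝ) {x y : {z : ℂ // z ∉ p.P}}
    (hx : x = circle hR a) (hy : y = circle hR b) : PathClass x y :=
  .mk (((seg a b).map (circle hR).continuous).cast hx hy)

theorem arc_trans (hR : p.NearInfinity R) (a b c : ℝ) {x y z : {z : ℂ // z ∉ p.P}}
    (hx : x = circle hR a) (hy : y = circle hR b) (hz : z = circle hR c) :
    (arc hR a b hx hy).trans (arc hR b c hy hz) = arc hR a c hx hz := by
  subst hx hy hz
  refine (Path.Homotopic.Quotient.mk_trans _ _).symm.trans (Quotient.sound ?_)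
  have := (seg_trans a b c).map (circle hR)
  rwa [Path.map_trans] at this

theorem arc_shift (hR : p.NearInfinity R) (a b a' b' : ℝ) (k : ℤ) (ha : a' = a + k)
    (hb : b' = b + k) {x y : {z : ℂ // z ∉ p.P}} (hx : x = circle hR a) (hy : y = circle hR b)
    (hx' : x = circle hR a') (hy' : y = circle hR b') :
    arc hR a' b' hx' hy' = arc hR a b hx hy := by
  subst ha hb
  refine congrArg Path.Homotopic.Quotient.mk (Path.ext (funext fun s => ?_))
  simp only [Path.cast_coe, Path.map_coe, Function.comp]
  rw [← circle_add_int hR (seg a b s) k]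
  congr 1
  simp only [seg, Path.coe_mk_mk]
  ring

/-- The class of the loop around infinity that runs `n` times along the circle of radius `R`. -/
noncomputable def loop (hR : p.NearInfinity R) : Multiplicative ℤ →* Pi1 (base hR) where
  toFun n := arc hR 0 (n.toAdd : ℤ) (circle_zero hR).symm (circle_int hR _).symm
  map_one' := by
    refine congrArg Path.Homotopic.Quotient.mk (Path.ext (funext fun s => ?_))
    simp [seg, ← circle_zero hR]
  map_mul' m n := by
    have h1 := arc_shift hR 0 (n.toAdd : ℤ) (m.toAdd : ℤ) ((m * n).toAdd : ℤ) m.toAdd (by simp)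
      (by rw [toAdd_mul]; push_cast; ring) (circle_zero hR).symm (circle_int hR _).symm
      (circle_int hR _).symm (circle_int hR _).symm
    have h2 := arc_trans hR 0 (m.toAdd : ℤ) ((m * n).toAdd : ℤ) (circle_zero hR).symm
      (circle_int hR _).symm (circle_int hR _).symm
    rw [h1] at h2
    exact h2.symm

theorem segment_notMem (hR : p.NearInfinity R) (t : unitInterval) (x : ℝ) :
    (1 - t : ℝ) * p.toFun (circlePt R x) + (t : ℝ) * circlePt R (d * x) ∉ p.P := by
  obtain ⟨r, h0, h1, h2, h3⟩ := id hR
  intro hmem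
  obtain ⟨h4, h5⟩ := h3 (circlePt R x) (norm_circlePt hR.pos x).ge
  have hle := h2 _ hmem
  set w := p.toFun (circlePt R x) with hw
  have hwpos : 0 < ‖w‖ := by linarith
  have hwne : (‖w‖ : ℂ) ≠ 0 := by exact_mod_cast hwpos.ne'
  set u : ℂ := Complex.exp ((2 * Real.pi * (d * x) : ℝ) * Complex.I) with hu
  have hunorm : ‖u‖ = 1 := Complex.norm_exp_ofReal_mul_I _
  have hu1 : circlePt R (d * x) = R * u := circlePt_eq _ _
  have hu2 : (circlePt R x / (‖circlePt R x‖ : ℂ)) ^ d = u := by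
    have hRne : (R : ℂ) ≠ 0 := by exact_mod_cast hR.pos.ne'
    rw [norm_circlePt hR.pos, circlePt_eq, mul_div_cancel_left₀ _ hRne, ← Complex.exp_nat_mul, hu]
    congr 1
    push_cast
    ring
  rw [hu2] at h5
  have hcu : u * (starRingEnd ℂ) u = 1 := by
    rw [Complex.mul_conj, Complex.normSq_eq_norm_sq, hunorm]; simp
  set v : ℂ := w / (‖w‖ : ℂ) with hv
  have hvnorm : ‖v‖ = 1 := by
    rw [hv, norm_div, Complex.norm_real, norm_norm, div_self hwpos.ne']
  have hre : 1 / 2 ≤ (v * (starRingEnd ℂ) u).re := by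
    have h6 : ‖v - u‖ ^ 2 ≤ 1 := by nlinarith [norm_nonneg (v - u)]
    have h7 : ‖v - u‖ ^ 2 = ‖v‖ ^ 2 + ‖u‖ ^ 2 - 2 * (v * (starRingEnd ℂ) u).re := by
      simp only [← Complex.normSq_eq_norm_sq]
      exact Complex.normSq_sub v u
    rw [hvnorm, hunorm] at h7
    linarith
  have hwv : w = (‖w‖ : ℂ) * v := by rw [hv]; field_simp
  have hre2 : (((1 - t : ℝ) * w + (t : ℝ) * circlePt R (d * x)) * (starRingEnd ℂ) u).re
      = (1 - t : ℝ) * (‖w‖ * (v * (starRingEnd ℂ) u).re) + t * R := by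
    have : ((1 - t : ℝ) * w + (t : ℝ) * circlePt R (d * x)) * (starRingEnd ℂ) u
        = ((1 - t : ℝ) : ℂ) * ((‖w‖ : ℂ) * (v * (starRingEnd ℂ) u)) + ((t * R : ℝ) : ℂ) := by
      rw [hu1]
      conv_lhs => rw [hwv]
      have : ((t : ℝ) : ℂ) * (R * u) * (starRingEnd ℂ) u = ((t : ℝ) : ℂ) * R := by
        rw [mul_assoc, mul_assoc, hcu, mul_one]
      rw [add_mul, this]
      push_cast
      ring
    rw [this, Complex.add_re, Complex.ofReal_re, Complex.re_ofReal_mul, Complex.re_ofReal_mul]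
  have hle2 : (((1 - t : ℝ) * w + (t : ℝ) * circlePt R (d * x)) * (starRingEnd ℂ) u).re ≤ r := by
    refine (Complex.re_le_norm _).trans ?_
    rw [norm_mul, RCLike.norm_conj, hunorm, mul_one]
    exact hle
  rw [hre2] at hle2
  have ht0 := t.2.1
  have ht1 := t.2.2
  have h8 : r < ‖w‖ * (v * (starRingEnd ℂ) u).re := by nlinarith
  have h9 : 0 < (1 - (t : ℝ)) ∨ 0 < (t : ℝ) := by
    by_contra! h
    linarith
  rcases h9 with h | h
  · nlinarith
  · nlinarith

/-- The straight-line homotopy in `ℂ \ P(p)` from `x ↦ p(R exp(2πix))` to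
`x ↦ R exp(2πidx)`. -/
noncomputable def straight (hR : p.NearInfinity R) :
    ((restriction p.map p.P).comp (circleDom hR)).Homotopy
      ((circle hR).comp ⟨fun x => d * x, by fun_prop⟩) where
  toFun s := ⟨(1 - s.1 : ℝ) * p.toFun (circlePt R s.2) + (s.1 : ℝ) * circlePt R (d * s.2),
    segment_notMem hR s.1 s.2⟩
  continuous_toFun := by
    have h1 := p.continuous
    have h2 := continuous_circlePt R
    refine Continuous.subtype_mk ?_ _
    fun_prop
  map_zero_left x := Subtype.ext (by
    change (1 - ((0 : unitInterval) : ℝ) : ℝ) * p.toFun (circlePt R x) + _ = p.toFun (circlePt R x)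
    simp)
  map_one_left x := Subtype.ext (by simp [circle])

/-- For `circle (d x) = base`, the class of the straight path from `p(R exp(2πix))` to `R`. -/
noncomputable def straightTo (hR : p.NearInfinity R) (x : ℝ) (hx : circle hR (d * x) = base hR) :
    PathClass (restriction p.map p.P (circleDom hR x)) (base hR) :=
  .mk (((straight hR).evalAt x).cast rfl hx.symm)

/-- The biset `B(p)` over `π₁(ℂ \ P(p), R)`. -/
noncomputable def biset (hR : p.NearInfinity R) : Biset (Pi1 (base hR)) (Pi1 (base hR)) :=
  partialBiset p.map p.mapsTo_P (base hR) (base hR)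

theorem circle_mul_div (hR : p.NearInfinity R) (j : ℤ) :
    circle hR (d * (j / d : ℝ)) = base hR := by
  have : (d : ℝ) ≠ 0 := by exact_mod_cast p.degree_pos.ne'
  rw [mul_div_cancel₀ _ this, circle_int]

/-- The element `t ^ (j / d)` of the regular cyclic biset, viewed at infinity: the arc from `R` to
`z = R exp(2πij/d)`, the point `z`, and the straight path from `p z` to `z ^ d / R ^ (d - 1) = R`. -/
noncomputable def atInfinity (hR : p.NearInfinity R) (j : ℤ) : (biset hR).carrier :=
  Corr.mk (circleDom hR (j / d)) (arc hR 0 (j / d) (circle_zero hR).symm rfl)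
    (straightTo hR (j / d) (circle_mul_div hR j))

theorem straightTo_loop (hR : p.NearInfinity R) (x y : ℝ) (n : ℤ) (hxy : d * y = d * x + n)
    (j : ℤ) (hj : d * x = j) (hx : circle hR (d * x) = base hR)
    (hy : circle hR (d * y) = base hR) :
    (straightTo hR x hx).trans (loop hR (Multiplicative.ofAdd n)) =
      ((Path.Homotopic.Quotient.mk ((seg x y).map (circleDom hR).continuous)).map
        (restriction p.map p.P)).trans (straightTo hR y hy) := by
  have h1 : loop hR (Multiplicative.ofAdd n) = arc hR (d * x) (d * y) hx.symm hy.symm :=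
    (arc_shift hR 0 n (d * x) (d * y) j (by rw [hj, zero_add]) (by rw [hxy, hj, add_comm])
      (circle_zero hR).symm (circle_int hR _).symm _ _).symm
  rw [h1]
  have h2 := Path.Homotopic.map_trans_evalAt (straight hR) (seg x y)
  have h3 : (((straight hR).evalAt x).cast rfl hx.symm).trans
      (((seg (d * x) (d * y)).map (circle hR).continuous).cast hx.symm hy.symm) =
      (((straight hR).evalAt x).trans ((seg x y).map
        (map_continuous ((circle hR).comp ⟨fun x => d * x, by fun_prop⟩)))).cast rfl hy.symm := by
    ext s
    simp only [Path.trans_apply, Path.cast_coe]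
    split_ifs
    · rfl
    · simp only [Path.map_coe, Function.comp, seg, Path.coe_mk_mk, ContinuousMap.comp_apply,
        ContinuousMap.coe_mk]
      congr 3
      ring
  have h4 := (h2.pathCast rfl hy.symm).symm
  refine Eq.trans (b := Path.Homotopic.Quotient.mk ((((straight hR).evalAt x).cast rfl hx.symm).trans
      (((seg (d * x) (d * y)).map (circle hR).continuous).cast hx.symm hy.symm))) rfl ?_
  rw [h3]
  exact Quotient.sound h4

theorem atInfinity_congr (hR : p.NearInfinity R) :
    (regularCyclic d).IsCongruence (biset hR) (loop hR) (loop hR) (atInfinity hR) := by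
  have hd : (d : ℝ) ≠ 0 := by exact_mod_cast p.degree_pos.ne'
  intro m j n
  change ℤ at j
  have hy : circle hR (d * (((j + n.toAdd : ℤ) : ℝ) / d)) = base hR := circle_mul_div hR _
  have hxy : (d : ℝ) * (((j + n.toAdd : ℤ) : ℝ) / d) = d * ((j : ℝ) / d) + (n.toAdd : ℤ) := by
    rw [mul_div_cancel₀ _ hd, mul_div_cancel₀ _ hd]; push_cast; ring
  have h1 := straightTo_loop hR ((j : ℝ) / d) (((j + n.toAdd : ℤ) : ℝ) / d) n.toAdd hxy j
    (mul_div_cancel₀ _ hd) (circle_mul_div hR j) hy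
  change Corr.mk _ _ _ = Corr.mk (circleDom hR (j / d))
    ((loop hR m).trans (arc hR 0 (j / d) (circle_zero hR).symm rfl))
    ((straightTo hR (j / d) (circle_mul_div hR j)).trans (loop hR n))
  rw [← ofAdd_toAdd n, h1, Corr.mk_move]
  set y : ℝ := ((j + n.toAdd : ℤ) : ℝ) / d with hydef
  set J : ℤ := (d : ℤ) * m.toAdd + j + n.toAdd with hJ
  have hJy : (J : ℝ) / d = y + (m.toAdd : ℤ) := by
    rw [hydef, hJ]; push_cast; field_simp; ring
  have hz : circleDom hR ((J : ℝ) / d) = circleDom hR y := by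
    rw [hJy, circleDom_add_int]
  refine Eq.trans ?_ (Corr.mk_cast hz _ _)
  have hz' : circle hR y = circle hR ((J : ℝ) / d) := by rw [hJy, circle_add_int]
  have e1 : ((arc hR 0 (m.toAdd : ℤ) (circle_zero hR).symm (circle_int hR _).symm).trans
      (arc hR 0 (j / d) (circle_zero hR).symm rfl)).trans (arc hR (j / d) y rfl rfl) =
      arc hR 0 (J / d) (circle_zero hR).symm hz' := by
    rw [Path.Homotopic.Quotient.trans_assoc, arc_trans,
      ← arc_shift hR 0 y (m.toAdd : ℤ) (J / d) m.toAdd (by simp) hJy (circle_zero hR).symm rfl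
        (circle_int hR _).symm hz', arc_trans]
  refine congrArg₂ (Corr.mk _) ?_ ?_
  · exact (congrArg (fun a => Path.Homotopic.Quotient.cast a rfl hz'.symm) e1).symm
  · refine congrArg Path.Homotopic.Quotient.mk (Path.ext (funext fun s => Subtype.ext ?_))
    change (1 - s : ℝ) * p.toFun (circlePt R (J / d)) + (s : ℝ) * circlePt R (d * (J / d)) =
      (1 - s : ℝ) * p.toFun (circlePt R y) + (s : ℝ) * circlePt R (d * y)
    have h3 : circlePt R (d * ((J : ℝ) / d)) = circlePt R (d * y) := by
      rw [hJy, mul_add, ← circlePt_add_int R (d * y) (d * m.toAdd)]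
      push_cast
      rfl
    rw [h3, hJy, circlePt_add_int]

end TopologicalPolynomial

/-! ### The formal mating -/

/-- The unit sphere in `ℂ × ℝ`. -/
abbrev Sphere : Type := {s : ℂ × ℝ // ‖s.1‖ ^ 2 + s.2 ^ 2 = 1}

/-- The reflection `(w, t) ↦ (w̄, -t)`. -/
def reflect : C(Sphere, Sphere) where
  toFun s := ⟨((starRingEnd ℂ) s.1.1, -s.1.2), by
    simpa only [RCLike.norm_conj, neg_sq] using s.2⟩
  continuous_toFun := by
    refine Continuous.subtype_mk ?_ _
    exact (Complex.continuous_conj.comp (by fun_prop)).prodMk (by fun_prop)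

theorem reflect_reflect (s : Sphere) : reflect (reflect s) = s :=
  Subtype.ext (Prod.ext (Complex.conj_conj _) (neg_neg _))

/-- The gnomonic projection of the plane onto the open southern hemisphere,
`z ↦ (z, -1) / |(z, -1)|`. -/
noncomputable def south : C(ℂ, Sphere) where
  toFun z := ⟨(z / (√(1 + ‖z‖ ^ 2) : ℝ), -1 / √(1 + ‖z‖ ^ 2)), by
    have h : (0 : ℝ) ≤ 1 + ‖z‖ ^ 2 := by positivity
    have h' : (1 + ‖z‖ ^ 2 : ℝ) ≠ 0 := by positivity
    simp only [norm_div, Complex.norm_real, Real.norm_eq_abs, div_pow, sq_abs, Real.sq_sqrt h]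
    field_simp
    ring⟩
  continuous_toFun := by
    have h (z : ℂ) : √(1 + ‖z‖ ^ 2) ≠ 0 := by positivity
    refine Continuous.subtype_mk (Continuous.prodMk ?_ ?_) _
    · exact continuous_id.div (by fun_prop) fun z => by exact_mod_cast h z
    · exact continuous_const.div (by fun_prop) h

/-- The projection of the plane onto the open northern hemisphere, `z ↦ (z̄, 1) / |(z̄, 1)|`. The
points at infinity of the two planes are thus identified by `∞ · u ↔ ∞ · ū`. -/
noncomputable def north : C(ℂ, Sphere) := reflect.comp south

theorem south_snd_neg (z : ℂ) : (south z).1.2 < 0 := by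
  change -1 / √(1 + ‖z‖ ^ 2) < 0
  have : 0 < √(1 + ‖z‖ ^ 2) := by positivity
  exact div_neg_of_neg_of_pos (by norm_num) this

theorem north_snd_pos (z : ℂ) : 0 < (north z).1.2 := neg_pos.mpr (south_snd_neg z)

theorem south_div (z : ℂ) : (south z).1.1 / ((|(south z).1.2| : ℝ) : ℂ) = z := by
  rw [abs_of_neg (south_snd_neg z)]
  change z / ((√(1 + ‖z‖ ^ 2) : ℝ) : ℂ) / ((-(-1 / √(1 + ‖z‖ ^ 2)) : ℝ) : ℂ) = z
  have : √(1 + ‖z‖ ^ 2) ≠ 0 := by positivity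
  have : ((√(1 + ‖z‖ ^ 2) : ℝ) : ℂ) ≠ 0 := by exact_mod_cast this
  push_cast
  field_simp

theorem south_injective : Function.Injective south := fun z w h => by
  rw [← south_div z, h, south_div]

namespace TopologicalPolynomial

variable {d : ℕ}

/-- The action of `p` on the closed southern hemisphere: as `p` on the open hemisphere, and as
`w ↦ w ^ d` on the equator; extended symmetrically to the sphere. -/
noncomputable def hemisphereMap (p : TopologicalPolynomial d) (s : Sphere) : Sphere :=
  if h : s.1.2 = 0 then ⟨(s.1.1 ^ d, 0), by
    have hs := s.2
    rw [h, zero_pow two_ne_zero, add_zero] at hs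
    simp only [norm_pow]
    rw [← pow_mul, mul_comm, pow_mul, hs]
    simp⟩
  else south (p.toFun (s.1.1 / (|s.1.2| : ℝ)))

theorem hemisphereMap_south (p : TopologicalPolynomial d) (z : ℂ) :
    p.hemisphereMap (south z) = south (p.toFun z) := by
  rw [hemisphereMap, dif_neg (south_snd_neg z).ne, south_div]

theorem tendsto_south {α : Type} {l : Filter α} {y : α → ℂ} {u : ℂ}
    (hy : Tendsto y l (cocompact ℂ)) (hu : Tendsto (fun a => y a / (‖y a‖ : ℂ)) l (𝓝 u)) :
    Tendsto (fun a => (south (y a)).1) l (𝓝 (u, 0)) := by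
  have h1 : Tendsto (fun a => ‖y a‖) l atTop := (tendsto_norm_cocompact_atTop).comp hy
  have h2 : Tendsto (fun a => 1 + ‖y a‖ ^ 2) l atTop :=
    tendsto_atTop_add_const_left _ _ ((tendsto_pow_atTop two_ne_zero).comp h1)
  have h3 : Tendsto (fun a => ‖y a‖ / √(1 + ‖y a‖ ^ 2)) l (𝓝 1) := by
    have h4 : Tendsto (fun a => √(1 - (1 + ‖y a‖ ^ 2)⁻¹)) l (𝓝 1) := by
      have := (tendsto_const_nhds (x := (1 : ℝ))).sub (tendsto_inv_atTop_zero.comp h2)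
      simpa [Function.comp_def] using (Real.continuous_sqrt.tendsto _).comp this
    refine h4.congr fun a => ?_
    have h5 : (0 : ℝ) < 1 + ‖y a‖ ^ 2 := by positivity
    rw [show 1 - (1 + ‖y a‖ ^ 2)⁻¹ = ‖y a‖ ^ 2 / (1 + ‖y a‖ ^ 2) by field_simp; ring,
      Real.sqrt_div (sq_nonneg _), Real.sqrt_sq (norm_nonneg _)]
  refine Tendsto.prodMk_nhds ?_ ?_
  · have h6 : Tendsto (fun a => y a / (‖y a‖ : ℂ) * ((‖y a‖ / √(1 + ‖y a‖ ^ 2) : ℝ) : ℂ)) l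
        (𝓝 (u * ((1 : ℝ) : ℂ))) :=
      hu.mul ((Complex.continuous_ofReal.tendsto _).comp h3)
    rw [Complex.ofReal_one, mul_one] at h6
    refine h6.congr' ?_
    filter_upwards [h1.eventually_gt_atTop 0] with a ha
    have : (‖y a‖ : ℂ) ≠ 0 := by exact_mod_cast ha.ne'
    change _ = y a / (√(1 + ‖y a‖ ^ 2) : ℝ)
    push_cast
    field_simp
  · exact tendsto_const_nhds.div_atTop (Real.tendsto_sqrt_atTop.comp h2)

theorem continuous_hemisphereMap (p : TopologicalPolynomial d) : Continuous p.hemisphereMap := by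
  rw [continuous_iff_continuousAt]
  intro s₀
  by_cases h0 : s₀.1.2 = 0
  · rw [ContinuousAt, tendsto_subtype_rng]
    have hw0 : ‖s₀.1.1‖ = 1 := by
      have hs := s₀.2
      rw [h0, zero_pow two_ne_zero, add_zero] at hs
      nlinarith [norm_nonneg s₀.1.1]
    have hval : ∀ s : Sphere, (p.hemisphereMap s).1 = if s.1.2 = 0 then (s.1.1 ^ d, 0)
        else (south (p.toFun (s.1.1 / (|s.1.2| : ℝ)))).1 := by
      intro s
      rw [hemisphereMap]
      split_ifs <;> rfl
    have c1 : Continuous fun s : Sphere => s.1.1 := continuous_fst.comp continuous_subtype_val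
    have c2 : Continuous fun s : Sphere => s.1.2 := continuous_snd.comp continuous_subtype_val
    rw [hval s₀, if_pos h0]
    refine Tendsto.congr (fun s => (hval s).symm) (Tendsto.if ?_ ?_)
    · refine Tendsto.mono_left ?_ inf_le_left
      exact ((c1.pow d).prodMk continuous_const).tendsto' _ _ rfl
    · have hne : ∀ᶠ s : Sphere in 𝓝 s₀ ⊓ 𝓟 {s | ¬ s.1.2 = 0}, s.1.2 ≠ 0 :=
        eventually_inf_principal.mpr (Eventually.of_forall fun s hs => hs)
      have hz : Tendsto (fun s : Sphere => s.1.1 / ((|s.1.2| : ℝ) : ℂ))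
          (𝓝 s₀ ⊓ 𝓟 {s | ¬ s.1.2 = 0}) (cocompact ℂ) := by
        rw [← Metric.cobounded_eq_cocompact, ← tendsto_norm_atTop_iff_cobounded]
        have h1 : Tendsto (fun s : Sphere => |s.1.2|) (𝓝 s₀ ⊓ 𝓟 {s | ¬ s.1.2 = 0}) (𝓝[>] 0) := by
          refine tendsto_nhdsWithin_iff.mpr ⟨?_, hne.mono fun s hs => abs_pos.mpr hs⟩
          exact (c2.abs.tendsto' _ _ (by rw [h0, abs_zero])).mono_left inf_le_left
        have h2 : Tendsto (fun s : Sphere => ‖s.1.1‖) (𝓝 s₀ ⊓ 𝓟 {s | ¬ s.1.2 = 0}) (𝓝 1) :=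
          (c1.norm.tendsto' _ _ hw0).mono_left inf_le_left
        refine (h2.pos_mul_atTop one_pos (tendsto_inv_nhdsGT_zero.comp h1)).congr fun s => ?_
        simp [div_eq_mul_inv]
      refine tendsto_south (p.tendsto.comp hz) ?_
      have h3 := p.normalized.comp hz
      have h4 : Tendsto (fun s : Sphere => (s.1.1 / (‖s.1.1‖ : ℂ)) ^ d)
          (𝓝 s₀ ⊓ 𝓟 {s | ¬ s.1.2 = 0}) (𝓝 (s₀.1.1 ^ d)) := by
        refine Tendsto.mono_left ?_ inf_le_left
        have : ContinuousAt (fun s : Sphere => (s.1.1 / (‖s.1.1‖ : ℂ)) ^ d) s₀ := by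
          refine (c1.continuousAt.div ?_ (by simp [hw0])).pow d
          exact (Complex.continuous_ofReal.comp c1.norm).continuousAt
        have := this.tendsto
        simpa [hw0] using this
      have h5 := h3.add h4
      rw [zero_add] at h5
      refine h5.congr' ?_
      filter_upwards [hne] with s hs
      have ha : ((|s.1.2| : ℝ) : ℂ) ≠ 0 := by exact_mod_cast (abs_pos.mpr hs).ne'
      have h6 : s.1.1 / ((|s.1.2| : ℝ) : ℂ) / (‖s.1.1 / ((|s.1.2| : ℝ) : ℂ)‖ : ℂ) =
          s.1.1 / (‖s.1.1‖ : ℂ) := by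
        rw [norm_div, Complex.norm_real, Real.norm_eq_abs, abs_abs, Complex.ofReal_div,
          div_div_div_cancel_right₀ ha]
      simp only [Function.comp, h6]
      ring
  · have hev : ∀ᶠ s : Sphere in 𝓝 s₀, s.1.2 ≠ 0 :=
      (continuous_snd.comp continuous_subtype_val).continuousAt.eventually_ne h0
    have hc : ContinuousAt (fun s : Sphere => south (p.toFun (s.1.1 / (|s.1.2| : ℝ)))) s₀ := by
      refine south.continuous.continuousAt.comp (p.continuous.continuousAt.comp ?_)
      refine ContinuousAt.div (by fun_prop) ?_ (by simpa using h0)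
      exact (Complex.continuous_ofReal.comp (continuous_abs.comp
        (continuous_snd.comp continuous_subtype_val))).continuousAt
    refine hc.congr ?_
    filter_upwards [hev] with s hs
    rw [hemisphereMap, dif_neg hs]

end TopologicalPolynomial

open TopologicalPolynomial

variable {d : ℕ}

/-- The formal mating `p ⊔ q`: it acts as `p` on the southern hemisphere, as `q` on the northern
hemisphere, and as `w ↦ w ^ d` on the equator. -/
noncomputable def formalMating (p q : TopologicalPolynomial d) : C(Sphere, Sphere) where
  toFun s := if s.1.2 ≤ 0 then p.hemisphereMap s else reflect (q.hemisphereMap (reflect s))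
  continuous_toFun := by
    refine Continuous.if_le p.continuous_hemisphereMap
      (reflect.continuous.comp (q.continuous_hemisphereMap.comp reflect.continuous))
      (continuous_snd.comp continuous_subtype_val) continuous_const ?_
    intro s hs
    have hs' : (reflect s).1.2 = 0 := by change -s.1.2 = 0; rw [hs, neg_zero]
    rw [hemisphereMap, dif_pos hs, hemisphereMap, dif_pos hs']
    refine Subtype.ext (Prod.ext ?_ ?_)
    · change s.1.1 ^ d = (starRingEnd ℂ) (((starRingEnd ℂ) s.1.1) ^ d)
      rw [← map_pow, Complex.conj_conj]
    · change (0 : ℝ) = -0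
      simp

theorem formalMating_south (p q : TopologicalPolynomial d) (z : ℂ) :
    formalMating p q (south z) = south (p.toFun z) :=
  (if_pos (south_snd_neg z).le).trans (p.hemisphereMap_south z)

theorem formalMating_north (p q : TopologicalPolynomial d) (z : ℂ) :
    formalMating p q (north z) = north (q.toFun z) := by
  refine (if_neg (north_snd_pos z).not_ge).trans ?_
  rw [north, ContinuousMap.comp_apply, reflect_reflect, hemisphereMap_south]
  rfl

/-- The images of the post-critical sets of `p` and `q` in the two hemispheres. -/
def matingP (p q : TopologicalPolynomial d) : Set Sphere := south '' p.P ∪ north '' q.P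

theorem mapsTo_matingP (p q : TopologicalPolynomial d) :
    MapsTo (formalMating p q) (matingP p q) (matingP p q) := by
  rintro _ (⟨z, hz, rfl⟩ | ⟨z, hz, rfl⟩)
  · exact .inl ⟨_, p.mapsTo_P hz, (formalMating_south p q z).symm⟩
  · exact .inr ⟨_, q.mapsTo_P hz, (formalMating_north p q z).symm⟩

theorem south_mem_iff (p q : TopologicalPolynomial d) (z : ℂ) :
    south z ∈ matingP p q ↔ z ∈ p.P := by
  refine ⟨?_, fun h => .inl ⟨z, h, rfl⟩⟩
  rintro (⟨w, hw, h⟩ | ⟨w, hw, h⟩)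
  · rwa [← south_injective h]
  · exact absurd (north_snd_pos w) (by rw [h]; exact (south_snd_neg z).not_gt)

theorem north_mem_iff (p q : TopologicalPolynomial d) (z : ℂ) :
    north z ∈ matingP p q ↔ z ∈ q.P := by
  refine ⟨?_, fun h => .inr ⟨z, h, rfl⟩⟩
  rintro (⟨w, hw, h⟩ | ⟨w, hw, h⟩)
  · exact absurd (south_snd_neg w) (by rw [h]; exact (north_snd_pos z).not_gt)
  · have : south w = south z := by
      rw [← reflect_reflect (south w), ← reflect_reflect (south z)]
      exact congrArg reflect h
    rwa [← south_injective this]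

/-- The inclusion of `ℂ \ P(p)` as the southern hemisphere, and its analogues. -/
noncomputable def southX (p q : TopologicalPolynomial d) :
    C({z : ℂ // z ∉ p.P}, {s : Sphere // s ∉ matingP p q}) where
  toFun z := ⟨south z.1, fun h => z.2 ((south_mem_iff p q _).mp h)⟩

noncomputable def northX (p q : TopologicalPolynomial d) :
    C({z : ℂ // z ∉ q.P}, {s : Sphere // s ∉ matingP p q}) where
  toFun z := ⟨north z.1, fun h => z.2 ((north_mem_iff p q _).mp h)⟩

noncomputable def southZ (p q : TopologicalPolynomial d) :
    C({z : ℂ // p.map z ∉ p.P}, {s : Sphere // formalMating p q s ∉ matingP p q}) where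
  toFun z := ⟨south z.1, fun h => z.2 ((south_mem_iff p q _).mp (formalMating_south p q z ▸ h))⟩

noncomputable def northZ (p q : TopologicalPolynomial d) :
    C({z : ℂ // q.map z ∉ q.P}, {s : Sphere // formalMating p q s ∉ matingP p q}) where
  toFun z := ⟨north z.1, fun h => z.2 ((north_mem_iff p q _).mp (formalMating_north p q z ▸ h))⟩

/-- The biset `B(p ⊔ q)` with basepoints `a` and `b`. -/
noncomputable abbrev matingBiset (p q : TopologicalPolynomial d)
    (a b : {s : Sphere // s ∉ matingP p q}) : Biset (Pi1 a) (Pi1 b) :=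
  partialBiset (formalMating p q) (mapsTo_matingP p q) a b

/-- The maps `B(p) → B(p ⊔ q)` and `B(q) → B(p ⊔ q)` induced by the inclusions. -/
noncomputable def southPush (p q : TopologicalPolynomial d) {a b : {z : ℂ // z ∉ p.P}} :
    (partialBiset p.map p.mapsTo_P a b).carrier →
      (matingBiset p q (southX p q a) (southX p q b)).carrier :=
  Corr.push (southZ p q) (southX p q) (southX p q) (fun _ => rfl)
    (fun z => Subtype.ext (formalMating_south p q z.1))

noncomputable def northPush (p q : TopologicalPolynomial d) {a b : {z : ℂ // z ∉ q.P}} :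
    (partialBiset q.map q.mapsTo_P a b).carrier →
      (matingBiset p q (northX p q a) (northX p q b)).carrier :=
  Corr.push (northZ p q) (northX p q) (northX p q) (fun _ => rfl)
    (fun z => Subtype.ext (formalMating_north p q z.1))

/-! ### The graph of groups and the graph of bisets -/

section MatingGraph

/-- The objects of the graph with two vertices `south`, `north` and one edge `edge`, from `south`
to `north`, with its reverse. -/
inductive Segment
  | south
  | north
  | edge
  | edgeRev

/-- The origin. -/
def Segment.src : Segment → Segment
  | .south => .south
  | .north => .north
  | .edge => .south
  | .edgeRev => .north

/-- The reversal. -/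
def Segment.rev : Segment → Segment
  | .south => .south
  | .north => .north
  | .edge => .edgeRev
  | .edgeRev => .edge

/-- The graph with two vertices and one edge. -/
def segmentGraph : Graph where
  Obj := Segment
  src := Segment.src
  rev := Segment.rev
  rev_rev x := by cases x <;> rfl
  src_src x := by cases x <;> rfl
  src_eq_iff x := by cases x <;> simp [Segment.src, Segment.rev]

theorem segmentGraph_connected : segmentGraph.IsConnected := by
  rintro ⟨_ | _ | _ | _, hu⟩ ⟨_ | _ | _ | _, hv⟩ <;>
  first
  | exact .refl
  | exact .single ⟨.edge, rfl, rfl⟩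
  | exact .single ⟨.edgeRev, rfl, rfl⟩
  | nomatch hu

variable {p q : TopologicalPolynomial d} {R R' : ℝ}

/-- The groups: `π₁(ℂ \ P(p), R)` and `π₁(ℂ \ P(q), R')` at the vertices, and `ℤ` at the edge. -/
def matingGroup (hR : p.NearInfinity R) (hR' : q.NearInfinity R') : Segment → Type
  | .south => Pi1 (base hR)
  | .north => Pi1 (base hR')
  | .edge => Multiplicative ℤ
  | .edgeRev => Multiplicative ℤ

noncomputable instance matingGroupGroup (hR : p.NearInfinity R) (hR' : q.NearInfinity R')
    (x : Segment) :
    Group (matingGroup hR hR' x) :=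
  match x with
  | .south => inferInstanceAs (Group (Pi1 (base hR)))
  | .north => inferInstanceAs (Group (Pi1 (base hR')))
  | .edge => inferInstanceAs (Group (Multiplicative ℤ))
  | .edgeRev => inferInstanceAs (Group (Multiplicative ℤ))

/-- Inversion on `ℤ`: the circle at infinity of `p`, positively oriented, is glued to the circle
at infinity of `q`, negatively oriented. -/
def reverseZ : Multiplicative ℤ →* Multiplicative ℤ := invMonoidHom

/-- The homomorphisms to the groups at the origins: the generator of the group at the edge (at its
reverse) is sent to the loop around infinity of `p` (of `q`). -/
noncomputable def matingToSrc (hR : p.NearInfinity R) (hR' : q.NearInfinity R') :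
    ∀ x : Segment, matingGroup hR hR' x →* matingGroup hR hR' (Segment.src x)
  | .south => MonoidHom.id (Pi1 (base hR))
  | .north => MonoidHom.id (Pi1 (base hR'))
  | .edge => loop hR
  | .edgeRev => loop hR'

noncomputable def matingBar (hR : p.NearInfinity R) (hR' : q.NearInfinity R') :
    ∀ x : Segment, matingGroup hR hR' x →* matingGroup hR hR' (Segment.rev x)
  | .south => MonoidHom.id (Pi1 (base hR))
  | .north => MonoidHom.id (Pi1 (base hR'))
  | .edge => reverseZ
  | .edgeRev => reverseZ

/-- The graph of groups with the vertex groups `π₁(ℂ \ P(p), R)` and `π₁(ℂ \ P(q), R')` and the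
edge group `ℤ`. -/
noncomputable def matingGroups (hR : p.NearInfinity R) (hR' : q.NearInfinity R') :
    GraphOfGroups where
  graph := segmentGraph
  connected := segmentGraph_connected
  G := matingGroup hR hR'
  grp := matingGroupGroup hR hR'
  toSrc := matingToSrc hR hR'
  bar := matingBar hR hR'
  bar_bar x g := by
    cases x
    · rfl
    · rfl
    · exact heq_of_eq (inv_inv (G := Multiplicative ℤ) g)
    · exact heq_of_eq (inv_inv (G := Multiplicative ℤ) g)
  toSrc_vert x hx g := by cases x <;> first | rfl | nomatch hx
  bar_vert x hx g := by cases x <;> first | rfl | nomatch hx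

/-- The bisets: `B(p)` and `B(q)` at the vertices, and the regular cyclic biset at the edge. -/
noncomputable def matingBisetAt (hR : p.NearInfinity R) (hR' : q.NearInfinity R') (x : Segment) :
    Biset (matingGroup hR hR' x) (matingGroup hR hR' x) :=
  match x with
  | .south => biset hR
  | .north => biset hR'
  | .edge => regularCyclic d
  | .edgeRev => regularCyclic d

/-- The congruences to the bisets at the origins. -/
noncomputable def matingBisetToSrc (hR : p.NearInfinity R) (hR' : q.NearInfinity R') :
    ∀ x : Segment, (matingBisetAt hR hR' x).carrier →
      (matingBisetAt hR hR' (Segment.src x)).carrier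
  | .south => fun b => b
  | .north => fun b => b
  | .edge => atInfinity hR
  | .edgeRev => atInfinity hR'

noncomputable def matingBisetBar (hR : p.NearInfinity R) (hR' : q.NearInfinity R') :
    ∀ x : Segment, (matingBisetAt hR hR' x).carrier →
      (matingBisetAt hR hR' (Segment.rev x)).carrier
  | .south => fun b => b
  | .north => fun b => b
  | .edge => fun b : ℤ => (-b : ℤ)
  | .edgeRev => fun b : ℤ => (-b : ℤ)

/-- The graph of bisets. -/
noncomputable def matingBisets (hR : p.NearInfinity R) (hR' : q.NearInfinity R') :
    GraphOfBisets (matingGroups hR hR') (matingGroups hR hR') where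
  graph := segmentGraph
  lam := GraphHom.id segmentGraph
  rho := GraphHom.id segmentGraph
  B := matingBisetAt hR hR'
  toSrc := matingBisetToSrc hR hR'
  toSrc_congr x := match x with
    | .south => fun _ _ _ => rfl
    | .north => fun _ _ _ => rfl
    | .edge => atInfinity_congr hR
    | .edgeRev => atInfinity_congr hR'
  bar := matingBisetBar hR hR'
  bar_congr x := match x with
    | .south => fun _ _ _ => rfl
    | .north => fun _ _ _ => rfl
    | .edge => fun (h : Multiplicative ℤ) (b : ℤ) (g : Multiplicative ℤ) => by
      change -((d : ℤ) * Multiplicative.toAdd h + b + Multiplicative.toAdd g) =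
        (d : ℤ) * -Multiplicative.toAdd h + -b + -Multiplicative.toAdd g
      ring
    | .edgeRev => fun (h : Multiplicative ℤ) (b : ℤ) (g : Multiplicative ℤ) => by
      change -((d : ℤ) * Multiplicative.toAdd h + b + Multiplicative.toAdd g) =
        (d : ℤ) * -Multiplicative.toAdd h + -b + -Multiplicative.toAdd g
      ring
  bar_bar x b := by
    cases x
    · rfl
    · rfl
    · exact heq_of_eq (neg_neg (G := ℤ) b)
    · exact heq_of_eq (neg_neg (G := ℤ) b)
  toSrc_vert x hx b := by cases x <;> first | rfl | nomatch hx
  bar_vert x hx b := by cases x <;> first | rfl | nomatch hx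

/-! ### Realization in the sphere -/

/-- The basepoints in the sphere. -/
noncomputable def matingPt (hR : p.NearInfinity R) (hR' : q.NearInfinity R') :
    Segment → {s : Sphere // s ∉ matingP p q}
  | .south => southX p q (base hR)
  | .north => northX p q (base hR')
  | .edge => southX p q (base hR)
  | .edgeRev => northX p q (base hR')

/-- The point of the unit sphere in the direction `(x, t)`, for `x > 0` real. -/
noncomputable def directionPt (x t : ℝ) (hx : 0 < x) : Sphere :=
  ⟨(((x / √(x ^ 2 + t ^ 2) : ℝ) : ℂ), t / √(x ^ 2 + t ^ 2)), by
    have h : (0 : ℝ) ≤ x ^ 2 + t ^ 2 := by positivity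
    have h' : (x ^ 2 + t ^ 2 : ℝ) ≠ 0 := by positivity
    simp only [Complex.norm_real, Real.norm_eq_abs, sq_abs, div_pow, Real.sq_sqrt h]
    field_simp⟩

theorem directionPt_south {x t : ℝ} {hx : 0 < x} {z : ℂ} (h : south z = directionPt x t hx) :
    t < 0 ∧ ‖z‖ = x / (-t) := by
  have hs : 0 < √(x ^ 2 + t ^ 2) := by positivity
  have h1 := south_snd_neg z
  rw [h] at h1
  have ht : t < 0 := by
    by_contra! hle
    exact absurd h1 (div_nonneg hle hs.le).not_gt
  refine ⟨ht, ?_⟩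
  rw [← south_div z, h]
  change ‖((x / √(x ^ 2 + t ^ 2) : ℝ) : ℂ) / ((|t / √(x ^ 2 + t ^ 2)| : ℝ) : ℂ)‖ = x / (-t)
  rw [norm_div, Complex.norm_real, Complex.norm_real, Real.norm_eq_abs, Real.norm_eq_abs, abs_abs,
    abs_div, abs_div, abs_of_pos hs, abs_of_pos hx, abs_of_neg ht, div_div_div_cancel_right₀ hs.ne']

theorem directionPt_north {x t : ℝ} {hx : 0 < x} {z : ℂ} (h : north z = directionPt x t hx) :
    0 < t ∧ ‖z‖ = x / t := by
  have h1 : south z = directionPt x (-t) hx := by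
    rw [← reflect_reflect (south z)]
    refine (congrArg reflect h).trans (Subtype.ext (Prod.ext ?_ ?_))
    · change (starRingEnd ℂ) ((x / √(x ^ 2 + t ^ 2) : ℝ) : ℂ) = ((x / √(x ^ 2 + (-t) ^ 2) : ℝ) : ℂ)
      rw [Complex.conj_ofReal, neg_sq]
    · change -(t / √(x ^ 2 + t ^ 2)) = -t / √(x ^ 2 + (-t) ^ 2)
      rw [neg_sq, neg_div]
  obtain ⟨h2, h3⟩ := directionPt_south h1
  exact ⟨by linarith, by rw [h3, neg_neg]⟩

theorem meridian_pos (hR : p.NearInfinity R) (hR' : q.NearInfinity R') (s : unitInterval) :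
    0 < (1 - s : ℝ) * R + s * R' := by
  have h0 := s.2.1
  have h1 := s.2.2
  have := hR.pos
  have := hR'.pos
  rcases h0.lt_or_eq with h | h
  · nlinarith [mul_pos h hR'.pos]
  · rw [← h]; linarith

theorem meridian_notMem (hR : p.NearInfinity R) (hR' : q.NearInfinity R') (s : unitInterval) :
    directionPt ((1 - s : ℝ) * R + s * R') (2 * s - 1) (meridian_pos hR hR' s) ∉ matingP p q := by
  have h0 := s.2.1
  have h1 := s.2.2
  have hp := hR.pos
  have hp' := hR'.pos
  rintro (⟨z, hz, h⟩ | ⟨z, hz, h⟩)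
  · obtain ⟨h2, h3⟩ := directionPt_south h
    refine hR.notMem ?_ hz
    rw [h3, le_div_iff₀ (by linarith)]
    nlinarith
  · obtain ⟨h2, h3⟩ := directionPt_north h
    refine hR'.notMem ?_ hz
    rw [h3, le_div_iff₀ (by linarith)]
    nlinarith

/-- The path along a meridian, through the equator, from the point `R` of the southern to the
point `R'` of the northern hemisphere. -/
noncomputable def meridian (hR : p.NearInfinity R) (hR' : q.NearInfinity R') :
    Path (southX p q (base hR)) (northX p q (base hR')) where
  toFun s := ⟨directionPt ((1 - s : ℝ) * R + s * R') (2 * s - 1) (meridian_pos hR hR' s),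
    meridian_notMem hR hR' s⟩
  continuous_toFun := by
    have hne (s : unitInterval) :
        √(((1 - s : ℝ) * R + s * R') ^ 2 + (2 * s - 1) ^ 2) ≠ 0 := by
      have := meridian_pos hR hR' s
      positivity
    refine Continuous.subtype_mk (Continuous.subtype_mk (Continuous.prodMk ?_ ?_) _) _
    · exact Complex.continuous_ofReal.comp (Continuous.div (by fun_prop) (by fun_prop) hne)
    · exact Continuous.div (by fun_prop) (by fun_prop) hne
  source' := by
    refine Subtype.ext (Subtype.ext (Prod.ext ?_ ?_))
    · simp [directionPt, southX, south, base, add_comm]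
    · simp [directionPt, southX, south, base, add_comm]
  target' := by
    refine Subtype.ext (Subtype.ext (Prod.ext ?_ ?_))
    · simp [directionPt, northX, north, reflect, south, base, add_comm]
      norm_num
    · simp [directionPt, northX, north, reflect, south, base, add_comm]
      norm_num [neg_div]

/-- The path in the sphere that represents an object of the graph. -/
noncomputable def edgePath (hR : p.NearInfinity R) (hR' : q.NearInfinity R') :
    ∀ x : Segment, PathClass (matingPt hR hR' (Segment.src x)) (matingPt hR hR' (Segment.src (Segment.rev x)))
  | .south => .refl _
  | .north => .refl _
  | .edge => .mk (meridian hR hR')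
  | .edgeRev => .symm (.mk (meridian hR hR'))

/-- The loop in the sphere that represents an element of an object's group. -/
noncomputable def eltPath (hR : p.NearInfinity R) (hR' : q.NearInfinity R') :
    ∀ x : Segment, matingGroup hR hR' x → PathClass (matingPt hR hR' x) (matingPt hR hR' x)
  | .south => fun g => Path.Homotopic.Quotient.map g (southX p q)
  | .north => fun g => Path.Homotopic.Quotient.map g (northX p q)
  | .edge => fun n => Path.Homotopic.Quotient.map (loop hR n) (southX p q)
  | .edgeRev => fun n => Path.Homotopic.Quotient.map (loop hR' n) (northX p q)

/-- The path in the sphere that represents a group-decorated path of the graph of groups: the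
concatenation of its pieces. -/
noncomputable def realize (hR : p.NearInfinity R) (hR' : q.NearInfinity R') :
    ∀ {u v : (matingGroups hR hR').graph.Vert}, GraphOfGroups.GPath (matingGroups hR hR') u v →
      PathClass (matingPt hR hR' u.1) (matingPt hR hR' v.1)
  | _, _, .elt (v := v) g => eltPath hR hR' v.1 g
  | _, _, .edge x hu hv => (edgePath hR hR' x).cast (congrArg (matingPt hR hR') hu.symm)
      (congrArg (matingPt hR hR') hv.symm)
  | _, _, .comp a b => (realize hR hR' a).trans (realize hR hR' b)
  | _, _, .inv a => (realize hR hR' a).symm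

/-- The maps to `B(p ⊔ q)` from the bisets of the graph of bisets, induced by the inclusions of the
hemispheres. -/
noncomputable def realizeBiset (hR : p.NearInfinity R) (hR' : q.NearInfinity R') :
    ∀ x : Segment, (matingBisetAt hR hR' x).carrier →
      (matingBiset p q (matingPt hR hR' x) (matingPt hR hR' x)).carrier
  | .south => fun b => southPush p q b
  | .north => fun b => northPush p q b
  | .edge => fun b => southPush p q (atInfinity hR b)
  | .edgeRev => fun b => northPush p q (atInfinity hR' b)

end MatingGraph

end Mating

open Mating

/-! The punctured sphere is covered by the two open hemispheres, which are copies of `ℂ \ P(p)` and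
`ℂ \ P(q)`, and by a closed collar of the equator bounded by the images of the circles of radius `R`
and `R'`. Neither the collar nor its image under the mating meets the post-critical set. Its
universal cover is a convex strip with coordinates (angle, slope) and deck group `ℤ`, so a path
class in the collar is determined by the endpoints of a lift. Nearly all homotopies of the proof are
obtained by comparing endpoints in this strip.

The isomorphism of fundamental groups is van Kampen's theorem. A formal path of the graph of groups
is realized in the sphere; the only relation that is not formal is the one that slides a loop across
the edge, and its two sides lift to paths in the strip with the same endpoints. The realization is
full because every path can be cut into pieces inside the three charts (`offEquator_induction`,
`exists_factorization`). It is faithful because there is a functor from the fundamental groupoid of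
the sphere back to the fundamental group of the graph of groups (`exists_sphere_functor`). This
functor is defined on each chart by joining endpoints to the basepoint along a tree. Near infinity
the trees follow circles and rays, so that on the collar every chart value reduces to an integer,
the change of angle corrected by the tree, and the values agree. Functors to a group defined on the
charts are extended to all paths by potentials: a local cocycle on a compact star-shaped set is a
coboundary (`exists_potential`), which is applied to an interval for existence and to a square for
homotopy invariance. The post-critical sets are only known to be bounded, so their complements may
be disconnected, and the trees reach only the component of the basepoint.

For the bisets, the map is well defined once the edge relation holds in the sphere. The action of
`ℤ` reduces it to the element `0` at infinity, where the point of the triple is moved along the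
meridian from `R` to `R'`. The image of the meridian, together with the straight segments of the two
elements, stays in a sector around the positive real direction: `p` turns large positive numbers by
at most 60 degrees and gives them modulus more than `2r`, hence real part more than `r`. The sector
avoids the post-critical set and is the central projection of a convex cone, so the required
homotopy exists (`meridianZ_map_restriction`).

Surjectivity is obtained by moving the point of a triple off the equator and factoring its two
paths. For injectivity, two triples are equal exactly when a single path `ε` in the domain carries
one to the other (`Corr.mk_eq_iff`). That domain is covered in the same way, so `ε` is a product of
paths in hemispheres and of meridians. A piece in a hemisphere is accounted for by the relations of
the tensor product, by faithfulness on the paths; a meridian is accounted for by the edge relation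
(`compatible_all`).

Finally, the hemispheres are invariant open embeddings that conjugate the mating to `p` and `q`, and
the equator carries no critical point, since `w ↦ w ^ d` is locally injective there. This gives the
post-critical set. -/

namespace Mating

/-! ### Van Kampen's theorem for group-valued functors -/

section LocalFunctor

variable {G : Type*} [Group G]

/-- A local cocycle on a bounded star-shaped set is a coboundary. -/
theorem exists_potential {E : Type*} [NormedAddCommGroup E] [NormedSpace ℝ E] {K : Set E} {B δ : ℝ}
    (hstar : ∀ x ∈ K, ∀ t : ℝ, 0 ≤ t → t ≤ 1 → t • x ∈ K) (hB : ∀ x ∈ K, ‖x‖ ≤ B) (hδ : 0 < δ)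
    (c : E → E → G) (hc : ∀ x ∈ K, ∀ y ∈ K, ∀ z ∈ K, dist x y < δ → dist x z < δ →
      c x z = c x y * c y z) :
    ∃ f : E → G, ∀ x ∈ K, ∀ y ∈ K, dist x y < δ / 2 → f y = f x * c x y := by
  have hself : ∀ x ∈ K, c x x = 1 := fun x hx => by
    have := hc x hx x hx x hx (by simpa) (by simpa)
    exact left_eq_mul.mp this
  -- Each ray from 0 is cut into `N + 1` steps of length `‖x‖ / (N + 1) < δ / 2`; using `N + 1`
  -- keeps the denominator nonzero.
  obtain ⟨N, hN⟩ := exists_nat_gt (2 * B / δ)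
  have hmem : ∀ x ∈ K, ∀ k : ℕ, k ≤ N + 1 → ((k : ℝ) / (N + 1 : ℝ)) • x ∈ K := fun x hx k hk => by
    refine hstar x hx _ (by positivity) ?_
    rw [div_le_one (by positivity)]
    exact_mod_cast hk
  have hstep : ∀ x ∈ K, ∀ k : ℕ,
      dist (((k : ℝ) / (N + 1 : ℝ)) • x) ((((k + 1 : ℕ) : ℝ) / (N + 1 : ℝ)) • x) < δ / 2 := by
    intro x hx k
    rw [dist_eq_norm, ← sub_smul, norm_smul]
    have h1 : (k : ℝ) / (N + 1 : ℝ) - ((k + 1 : ℕ) : ℝ) / (N + 1 : ℝ) = -(1 / (N + 1 : ℝ)) := by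
      push_cast; ring
    rw [h1, norm_neg, Real.norm_of_nonneg (by positivity), one_div, inv_mul_lt_iff₀ (by positivity)]
    have := hB x hx
    rw [div_lt_iff₀ hδ] at hN
    nlinarith
  -- The product of the cocycle over the first `n` steps of the ray from 0 to `x`. The potential is
  -- the full product, `n = N + 1`.
  let F : ℕ → E → G := fun n x => Nat.rec 1 (fun k g =>
    g * c (((k : ℝ) / (N + 1 : ℝ)) • x) ((((k + 1 : ℕ) : ℝ) / (N + 1 : ℝ)) • x)) n
  have key : ∀ x ∈ K, ∀ y ∈ K, dist x y < δ / 2 → ∀ k : ℕ, k ≤ N + 1 →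
      F k y = F k x * c (((k : ℝ) / (N + 1 : ℝ)) • x) (((k : ℝ) / (N + 1 : ℝ)) • y) := by
    intro x hx y hy hxy k
    induction k with
    | zero =>
      intro _
      have h0 := hmem x hx 0 (by omega)
      simp only [Nat.cast_zero, zero_div, zero_smul] at h0 ⊢
      simp [F, hself 0 h0]
    | succ k ih =>
      intro hk
      have hd : ∀ j : ℕ, j ≤ N + 1 →
          dist (((j : ℝ) / (N + 1 : ℝ)) • x) (((j : ℝ) / (N + 1 : ℝ)) • y) < δ / 2 := by
        intro j hj
        rw [dist_smul₀]
        refine lt_of_le_of_lt ?_ hxy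
        refine mul_le_of_le_one_left dist_nonneg ?_
        rw [Real.norm_of_nonneg (by positivity), div_le_one (by positivity)]
        exact_mod_cast hj
      -- The cell between consecutive steps of the two rays is cut by a diagonal, and both ways
      -- around the cell equal the value on it. A side and a step are each shorter than `δ / 2`, so
      -- the diagonal is shorter than `δ`; this is why `x` and `y` are taken at distance less than
      -- `δ / 2`.
      have e1 := hc _ (hmem x hx k (by omega)) _ (hmem y hy k (by omega)) _
        (hmem y hy (k + 1) hk) (by linarith [hd k (by omega)])
        (by
          have := dist_triangle (((k : ℝ) / (N + 1 : ℝ)) • x) (((k : ℝ) / (N + 1 : ℝ)) • y)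
            ((((k + 1 : ℕ) : ℝ) / (N + 1 : ℝ)) • y)
          linarith [hd k (by omega), hstep y hy k])
      have e2 := hc _ (hmem x hx k (by omega)) _ (hmem x hx (k + 1) hk) _
        (hmem y hy (k + 1) hk) (by linarith [hstep x hx k])
        (by
          have := dist_triangle (((k : ℝ) / (N + 1 : ℝ)) • x) (((k : ℝ) / (N + 1 : ℝ)) • y)
            ((((k + 1 : ℕ) : ℝ) / (N + 1 : ℝ)) • y)
          linarith [hd k (by omega), hstep y hy k])
      change F k y * _ = F k x * _ * _
      rw [ih (by omega), mul_assoc, ← e1, e2, mul_assoc]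
  refine ⟨F (N + 1), fun x hx y hy hxy => ?_⟩
  have := key x hx y hy hxy (N + 1) le_rfl
  have h1 : ((N + 1 : ℕ) : ℝ) / (N + 1 : ℝ) = 1 := by
    push_cast
    exact div_self (by positivity)
  rwa [h1, one_smul, one_smul] at this

variable {Y : Type*} [TopologicalSpace Y] {ι : Type*}

/-- A function on paths that is invariant under homotopies inside the sets `U i`, whose interiors
cover the space, and multiplicative inside them. -/
structure IsLocalFunctor (U : ι → Set Y) (φ : ∀ x y : Y, Path x y → G) : Prop where
  cover : ∀ y, ∃ i, U i ∈ 𝓝 y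
  homotopy : ∀ i {x y : Y} (γ γ' : Path x y) (F : γ.Homotopy γ'), (∀ s, F s ∈ U i) →
    φ _ _ γ = φ _ _ γ'
  trans : ∀ i {x y z : Y} (γ : Path x y) (γ' : Path y z), (∀ t, γ t ∈ U i) → (∀ t, γ' t ∈ U i) →
    φ _ _ (γ.trans γ') = φ _ _ γ * φ _ _ γ'

/-- Pointwise equal paths may have endpoints that are only propositionally equal; evaluation at 0
and 1 identifies them, which avoids casts later. -/
theorem path_fun_congr {α : Type*} (φ : ∀ x y : Y, Path x y → α) {x y x' y' : Y} (γ : Path x y)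
    (γ' : Path x' y') (h : ∀ t, γ t = γ' t) : φ _ _ γ = φ _ _ γ' := by
  obtain rfl : x = x' := by simpa using h 0
  obtain rfl : y = y' := by simpa using h 1
  exact congrArg _ (Path.ext (funext h))

namespace IsLocalFunctor

variable {U : ι → Set Y} {φ : ∀ x y : Y, Path x y → G} (hφ : IsLocalFunctor U φ)
include hφ

/-- The straight-line homotopy from a segment to the broken path with the same ends stays in the
convex set `C`, so its image stays in `U i`, where `φ` is invariant and multiplicative. -/
theorem segment_trans {E : Type*} [NormedAddCommGroup E] [NormedSpace ℝ E] (H : C(E, Y)) {C : Set E}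
    (hC : Convex ℝ C) (i : ι) (hU : ∀ e ∈ C, H e ∈ U i) {a b c : E} (ha : a ∈ C) (hb : b ∈ C)
    (hc : c ∈ C) :
    φ _ _ ((Path.segment a c).map H.continuous) =
      φ _ _ ((Path.segment a b).map H.continuous) * φ _ _ ((Path.segment b c).map H.continuous) := by
  have hseg : ∀ {x y : E}, x ∈ C → y ∈ C → ∀ t, Path.segment x y t ∈ C := fun {x y} hx hy t =>
    hC.segment_subset hx hy (by rw [← Path.range_segment]; exact mem_range_self t)
  have htr : ∀ t, (Path.segment a b).trans (Path.segment b c) t ∈ C := fun t => by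
    rw [Path.trans_apply]
    split_ifs
    · exact hseg ha hb _
    · exact hseg hb hc _
  rw [← hφ.trans i _ _ (fun t => hU _ (hseg ha hb t)) (fun t => hU _ (hseg hb hc t)),
    ← Path.map_trans]
  let F : (Path.segment a c).Homotopy ((Path.segment a b).trans (Path.segment b c)) :=
    { toFun := fun s => AffineMap.lineMap (Path.segment a c s.2)
        ((Path.segment a b).trans (Path.segment b c) s.2) (s.1 : ℝ)
      continuous_toFun := by
        simp only [AffineMap.lineMap_apply_module]
        fun_prop
      map_zero_left := by simp
      map_one_left := by simp
      prop' := by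
        rintro t x (rfl | rfl) <;> simp }
  exact hφ.homotopy i _ _ (F.map H) fun s => hU _ (hC.lineMap_mem (hseg ha hc _) (htr _) s.1.2)

/-- By the Lebesgue number lemma a ball of radius `δ` around a point of `K` is mapped into a single
`U i`. There `segment_trans` is the local cocycle identity for the values on segments, and
`exists_potential` applies. -/
theorem exists_potential_comp {E : Type*} [NormedAddCommGroup E] [NormedSpace ℝ E] {K : Set E}
    (hK : IsCompact K) (hstar : ∀ x ∈ K, ∀ t : ℝ, 0 ≤ t → t ≤ 1 → t • x ∈ K) (H : C(E, Y)) :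
    ∃ f : E → G, ∃ δ > 0, ∀ x ∈ K, ∀ y ∈ K, dist x y < δ →
      f y = f x * φ _ _ ((Path.segment x y).map H.continuous) := by
  obtain ⟨δ, hδ, hL⟩ := lebesgue_number_lemma_of_metric (c := fun i => H ⁻¹' interior (U i)) hK
    (fun i => isOpen_interior.preimage H.continuous) (fun x _ => by
      obtain ⟨i, hi⟩ := hφ.cover (H x)
      exact mem_iUnion.mpr ⟨i, mem_interior_iff_mem_nhds.mpr hi⟩)
  obtain ⟨B, hB⟩ := hK.isBounded.exists_norm_le
  obtain ⟨f, hf⟩ := exists_potential hstar hB hδ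
    (fun x y => φ _ _ ((Path.segment x y).map H.continuous)) (fun x hx y _ z _ hxy hxz => by
      obtain ⟨i, hi⟩ := hL x hx
      exact hφ.segment_trans H (convex_ball x δ) i (fun e he => interior_subset (hi he))
        (Metric.mem_ball_self hδ) (Metric.mem_ball'.mpr hxy) (Metric.mem_ball'.mpr hxz))
  exact ⟨f, δ / 2, half_pos hδ, hf⟩

end IsLocalFunctor

/-- `g` is the total value of the local functor `φ` along the path `γ`. -/
def IsTotal (φ : ∀ x y : Y, Path x y → G) {x y : Y} (γ : Path x y) (g : G) : Prop :=
  ∃ f : ℝ → G, ∃ δ > 0, (∀ a ∈ Icc (0 : ℝ) 1, ∀ b ∈ Icc (0 : ℝ) 1, dist a b < δ →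
    f b = f a * φ _ _ ((Path.segment a b).map γ.continuous_extend)) ∧ g = (f 0)⁻¹ * f 1

theorem eq_of_locally_eq {α : Type*} (h : ℝ → α) {δ : ℝ} (hδ : 0 < δ)
    (hh : ∀ a ∈ Icc (0 : ℝ) 1, ∀ b ∈ Icc (0 : ℝ) 1, dist a b < δ → h a = h b) : h 0 = h 1 := by
  obtain ⟨N, hN⟩ := exists_nat_gt (1 / δ)
  have hN' : (0 : ℝ) < N := lt_trans (by positivity) hN
  have key : ∀ k : ℕ, k ≤ N → h 0 = h (k / N) := by
    intro k
    induction k with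
    | zero => simp
    | succ k ih =>
      intro hk
      have hk1 : ((k + 1 : ℕ) : ℝ) ≤ N := by exact_mod_cast hk
      push_cast at hk1
      rw [ih (by omega)]
      refine hh _ ⟨by positivity, (div_le_one hN').mpr (by linarith)⟩ _
        ⟨by positivity, (div_le_one hN').mpr (by push_cast; linarith)⟩ ?_
      rw [Real.dist_eq, show (k : ℝ) / N - ((k + 1 : ℕ) : ℝ) / N = -(1 / N) by push_cast; ring,
        abs_neg, abs_of_pos (by positivity)]
      rw [div_lt_iff₀ hδ] at hN
      rw [div_lt_iff₀ hN']
      linarith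
  have := key N le_rfl
  rwa [div_self hN'.ne'] at this

/-- Two potentials along the same path satisfy the same difference equation, so `f' f⁻¹` is locally
constant and has equal values at the two ends. -/
theorem IsTotal.unique {φ : ∀ x y : Y, Path x y → G} {x y : Y} {γ : Path x y} {g g' : G}
    (h : IsTotal φ γ g) (h' : IsTotal φ γ g') : g = g' := by
  obtain ⟨f, δ, hδ, hf, rfl⟩ := h
  obtain ⟨f', δ', hδ', hf', rfl⟩ := h'
  have := eq_of_locally_eq (fun t => f' t * (f t)⁻¹) (lt_min hδ hδ') (fun a ha b hb hab => by
    rw [hf a ha b hb (hab.trans_le (min_le_left _ _)),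
      hf' a ha b hb (hab.trans_le (min_le_right _ _))]
    group)
  have h1 : f' 1 = f' 0 * (f 0)⁻¹ * f 1 := by
    rw [mul_inv_eq_iff_eq_mul.mp this.symm]
  rw [h1]
  group

namespace IsLocalFunctor

variable {U : ι → Set Y} {φ : ∀ x y : Y, Path x y → G}

theorem exists_isTotal (hφ : IsLocalFunctor U φ) {x y : Y} (γ : Path x y) :
    ∃ g, IsTotal φ γ g := by
  obtain ⟨f, δ, hδ, hf⟩ := hφ.exists_potential_comp (K := Icc (0 : ℝ) 1) isCompact_Icc
    (fun x hx t h0 h1 => ⟨mul_nonneg h0 hx.1, mul_le_one₀ h1 hx.1 hx.2⟩)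
    ⟨γ.extend, γ.continuous_extend⟩
  exact ⟨_, f, δ, hδ, hf, rfl⟩

/-- A constant path is idempotent under concatenation, and 1 is the only idempotent of a group. -/
theorem apply_refl (hφ : IsLocalFunctor U φ) (y : Y) : φ _ _ (Path.refl y) = 1 := by
  obtain ⟨i, hi⟩ := hφ.cover y
  have hy := mem_of_mem_nhds hi
  have := hφ.trans i (Path.refl y) (Path.refl y) (fun _ => hy) (fun _ => hy)
  rw [Path.refl_trans_refl] at this
  exact left_eq_mul.mp this

/-- A potential on the whole square of the homotopy restricts to potentials for `γ` and `γ'` on two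
opposite sides. Along the other two sides the homotopy is constant, hence so is the potential, and
the totals agree. -/
theorem isTotal_of_homotopic (hφ : IsLocalFunctor U φ) {x y : Y} {γ γ' : Path x y}
    (h : γ.Homotopic γ') {g : G} (hg : IsTotal φ γ g) : IsTotal φ γ' g := by
  obtain ⟨F⟩ := h
  -- The homotopy is extended to the whole plane, with the coordinates exchanged: the first is the
  -- parameter of the paths, the second the time of the homotopy.
  let H : C(ℝ × ℝ, Y) := ⟨fun a => F (projIcc 0 1 zero_le_one a.2, projIcc 0 1 zero_le_one a.1), by
    have := continuous_projIcc (a := (0 : ℝ)) (b := 1) (h := zero_le_one)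
    fun_prop⟩
  obtain ⟨f, δ, hδ, hf⟩ := hφ.exists_potential_comp (K := Icc (0 : ℝ) 1 ×ˢ Icc (0 : ℝ) 1)
    (isCompact_Icc.prod isCompact_Icc)
    (fun x hx t h0 h1 => ⟨⟨mul_nonneg h0 hx.1.1, mul_le_one₀ h1 hx.1.1 hx.1.2⟩,
      ⟨mul_nonneg h0 hx.2.1, mul_le_one₀ h1 hx.2.1 hx.2.2⟩⟩) H
  have hl0 : (0 : ℝ) ∈ Icc (0 : ℝ) 1 := by simp
  have hl1 : (1 : ℝ) ∈ Icc (0 : ℝ) 1 := by simp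
  have h0 : IsTotal φ γ ((f (0, 0))⁻¹ * f (1, 0)) := by
    refine ⟨fun a => f (a, 0), δ, hδ, fun a ha b hb hab => ?_, rfl⟩
    have hd : dist ((a, 0) : ℝ × ℝ) (b, 0) < δ := by simpa [Prod.dist_eq] using hab
    change f (b, 0) = f (a, 0) * _
    rw [hf (a, 0) ⟨ha, hl0⟩ (b, 0) ⟨hb, hl0⟩ hd]
    congr 1
    refine path_fun_congr φ _ _ fun t => ?_
    exact Eq.trans (b := γ.extend (AffineMap.lineMap a b (t : ℝ)))
      (by simp [H, Path.extend, IccExtend, AffineMap.lineMap_apply]) rfl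
  have h1 : IsTotal φ γ' ((f (0, 1))⁻¹ * f (1, 1)) := by
    refine ⟨fun a => f (a, 1), δ, hδ, fun a ha b hb hab => ?_, rfl⟩
    have hd : dist ((a, 1) : ℝ × ℝ) (b, 1) < δ := by simpa [Prod.dist_eq] using hab
    change f (b, 1) = f (a, 1) * _
    rw [hf (a, 1) ⟨ha, hl1⟩ (b, 1) ⟨hb, hl1⟩ hd]
    congr 1
    refine path_fun_congr φ _ _ fun t => ?_
    exact Eq.trans (b := γ'.extend (AffineMap.lineMap a b (t : ℝ)))
      (by simp [H, Path.extend, IccExtend, AffineMap.lineMap_apply]) rfl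
  have e0 : f (0, 0) = f (0, 1) := eq_of_locally_eq (fun s => f (0, s)) hδ fun a ha b hb hab => by
    have hd : dist ((0, a) : ℝ × ℝ) (0, b) < δ := by simpa [Prod.dist_eq] using hab
    have h2 : φ _ _ ((Path.segment ((0, a) : ℝ × ℝ) (0, b)).map H.continuous) = 1 := by
      rw [← hφ.apply_refl x]
      exact path_fun_congr φ _ _ fun t => by simp [H, AffineMap.lineMap_apply]
    rw [hf (0, a) ⟨hl0, ha⟩ (0, b) ⟨hl0, hb⟩ hd, h2, mul_one]
  have e1 : f (1, 0) = f (1, 1) := eq_of_locally_eq (fun s => f (1, s)) hδ fun a ha b hb hab => by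
    have hd : dist ((1, a) : ℝ × ℝ) (1, b) < δ := by simpa [Prod.dist_eq] using hab
    have h2 : φ _ _ ((Path.segment ((1, a) : ℝ × ℝ) (1, b)).map H.continuous) = 1 := by
      rw [← hφ.apply_refl y]
      exact path_fun_congr φ _ _ fun t => by simp [H, AffineMap.lineMap_apply]
    rw [hf (1, a) ⟨hl1, ha⟩ (1, b) ⟨hl1, hb⟩ hd, h2, mul_one]
  rw [hg.unique h0, e0, e1]
  exact h1

/-- A potential along the concatenation, restricted to each half and rescaled, is a potential along
the factor; the differences over the two halves telescope. -/
theorem isTotal_trans (hφ : IsLocalFunctor U φ) {x y z : Y} {γ : Path x y} {γ' : Path y z}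
    {g g' : G} (hg : IsTotal φ γ g) (hg' : IsTotal φ γ' g') : IsTotal φ (γ.trans γ') (g * g') := by
  obtain ⟨k, f, δ, hδ, hf, rfl⟩ := hφ.exists_isTotal (γ.trans γ')
  have h0 : IsTotal φ γ ((f (0 / 2))⁻¹ * f (1 / 2)) := by
    refine ⟨fun a => f (a / 2), δ, hδ, fun a ha b hb hab => ?_, rfl⟩
    change f (b / 2) = f (a / 2) * _
    rw [hf (a / 2) ⟨by linarith [ha.1], by linarith [ha.2]⟩ (b / 2)
      ⟨by linarith [hb.1], by linarith [hb.2]⟩ (by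
        rw [Real.dist_eq] at hab ⊢
        rw [← sub_div, abs_div, abs_two]
        linarith [abs_nonneg (a - b)])]
    congr 1
    refine path_fun_congr φ _ _ fun t => ?_
    have hc : AffineMap.lineMap a b (t : ℝ) ∈ Icc (0 : ℝ) 1 :=
      (convex_Icc 0 1).lineMap_mem ha hb t.2
    have e : AffineMap.lineMap (a / 2) (b / 2) (t : ℝ) = AffineMap.lineMap a b (t : ℝ) / 2 := by
      simp only [AffineMap.lineMap_apply_module, smul_eq_mul]; ring
    simp only [Path.map_coe, Function.comp, Path.segment_apply, e]
    rw [Path.extend_apply _ ⟨by linarith [hc.1], by linarith [hc.2]⟩, Path.trans_apply,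
      dif_pos (by linarith [hc.2]), Path.extend_apply _ hc]
    congr 1
    exact Subtype.ext (by ring)
  have h1 : IsTotal φ γ' ((f ((0 + 1) / 2))⁻¹ * f ((1 + 1) / 2)) := by
    refine ⟨fun a => f ((a + 1) / 2), δ, hδ, fun a ha b hb hab => ?_, rfl⟩
    change f ((b + 1) / 2) = f ((a + 1) / 2) * _
    rw [hf ((a + 1) / 2) ⟨by linarith [ha.1], by linarith [ha.2]⟩ ((b + 1) / 2)
      ⟨by linarith [hb.1], by linarith [hb.2]⟩ (by
        rw [Real.dist_eq] at hab ⊢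
        rw [← sub_div, abs_div, abs_two, add_sub_add_right_eq_sub]
        linarith [abs_nonneg (a - b)])]
    congr 1
    refine path_fun_congr φ _ _ fun t => ?_
    have hc : AffineMap.lineMap a b (t : ℝ) ∈ Icc (0 : ℝ) 1 :=
      (convex_Icc 0 1).lineMap_mem ha hb t.2
    have e : AffineMap.lineMap ((a + 1) / 2) ((b + 1) / 2) (t : ℝ) =
        (AffineMap.lineMap a b (t : ℝ) + 1) / 2 := by
      simp only [AffineMap.lineMap_apply_module, smul_eq_mul]; ring
    simp only [Path.map_coe, Function.comp, Path.segment_apply, e]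
    rw [Path.extend_apply _ ⟨by linarith [hc.1], by linarith [hc.2]⟩, Path.extend_apply _ hc,
      Path.trans_apply]
    -- `Path.trans` assigns the parameter `1 / 2` to the first path. This branch occurs only there,
    -- where `γ'` is at its source.
    split_ifs with h
    · simp only at h
      have h2 : AffineMap.lineMap a b (t : ℝ) = (0 : ℝ) := by linarith [hc.1]
      simp [h2]
    · congr 1
      exact Subtype.ext (by simp only; ring)
  rw [hg.unique h0, hg'.unique h1]
  refine ⟨f, δ, hδ, hf, ?_⟩
  rw [zero_div, zero_add, show ((1 : ℝ) + 1) / 2 = 1 by norm_num]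
  group

/-- For a path inside one member of the cover no subdivision is needed: the value from 0 to `a` is
itself a potential, and any positive `δ` serves. -/
theorem isTotal_of_forall_mem (hφ : IsLocalFunctor U φ) {x y : Y} (γ : Path x y) (i : ι)
    (hi : ∀ t, γ t ∈ U i) : IsTotal φ γ (φ _ _ γ) := by
  let H : C(ℝ, Y) := ⟨γ.extend, γ.continuous_extend⟩
  refine ⟨fun a => φ _ _ ((Path.segment 0 a).map H.continuous), 1, one_pos, fun a _ b _ _ => ?_, ?_⟩
  · exact hφ.segment_trans H convex_univ i (fun e _ => hi _) trivial trivial trivial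
  · have h0 : φ _ _ ((Path.segment 0 0).map H.continuous) = 1 := by
      rw [← hφ.apply_refl x]
      exact path_fun_congr φ _ _ fun t => by simp [H]
    simp only [h0, inv_one, one_mul]
    refine path_fun_congr φ _ _ fun t => ?_
    simp [H, AffineMap.lineMap_apply]

/-- The universal property of the fundamental groupoid of a union, for functors to a group. -/
theorem exists_extension (hφ : IsLocalFunctor U φ) :
    ∃ Ψ : ∀ x y : Y, Path.Homotopic.Quotient x y → G,
      (∀ {x y z : Y} (a : Path.Homotopic.Quotient x y) (b : Path.Homotopic.Quotient y z),
        Ψ _ _ (a.trans b) = Ψ _ _ a * Ψ _ _ b) ∧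
      ∀ i {x y : Y} (γ : Path x y), (∀ t, γ t ∈ U i) →
        Ψ _ _ (Path.Homotopic.Quotient.mk γ) = φ _ _ γ := by
  choose T hT using fun (x y : Y) (γ : Path x y) => hφ.exists_isTotal γ
  refine ⟨fun x y => Quotient.lift (T x y) fun γ γ' h =>
    (hφ.isTotal_of_homotopic h (hT _ _ γ)).unique (hT _ _ γ'), ?_, ?_⟩
  · intro x y z a b
    induction a using Path.Homotopic.Quotient.ind
    induction b using Path.Homotopic.Quotient.ind
    exact (hT _ _ _).unique (hφ.isTotal_trans (hT _ _ _) (hT _ _ _))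
  · intro i x y γ h
    exact (hT _ _ γ).unique (hφ.isTotal_of_forall_mem γ i h)

end IsLocalFunctor

/-- A property of path classes that is stable under composition holds everywhere if it holds for
the paths inside the members of a cover. -/
theorem pathClass_induction {U : ι → Set Y} (cover : ∀ y, ∃ i, U i ∈ 𝓝 y)
    (M : ∀ x y : Y, Path.Homotopic.Quotient x y → Prop)
    (trans : ∀ {x y z : Y} (a : Path.Homotopic.Quotient x y) (b : Path.Homotopic.Quotient y z),
      M _ _ a → M _ _ b → M _ _ (a.trans b))
    (small : ∀ i {x y : Y} (γ : Path x y), (∀ t, γ t ∈ U i) →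
      M _ _ (Path.Homotopic.Quotient.mk γ)) {x y : Y} (a : Path.Homotopic.Quotient x y) :
    M _ _ a := by
  induction a using Path.Homotopic.Quotient.ind with | mk γ =>
  let H : C(ℝ, Y) := ⟨γ.extend, γ.continuous_extend⟩
  obtain ⟨δ, hδ, hL⟩ := lebesgue_number_lemma_of_metric (c := fun i => H ⁻¹' interior (U i))
    (isCompact_Icc (a := (0 : ℝ)) (b := 1))
    (fun i => isOpen_interior.preimage H.continuous) (fun x _ => by
      obtain ⟨i, hi⟩ := cover (H x)
      exact mem_iUnion.mpr ⟨i, mem_interior_iff_mem_nhds.mpr hi⟩)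
  obtain ⟨N, hN⟩ := exists_nat_gt (1 / δ)
  have hN' : (0 : ℝ) < N := lt_trans (by positivity) hN
  have hsmall : ∀ k : ℕ, k ≤ N → ∀ a : ℝ, dist (k / N : ℝ) a < δ →
      M _ _ (Path.Homotopic.Quotient.mk ((Path.segment (k / N : ℝ) a).map H.continuous)) := by
    intro k hk a ha
    have hk1 : (k : ℝ) ≤ N := by exact_mod_cast hk
    obtain ⟨i, hi⟩ := hL (k / N) ⟨by positivity, (div_le_one hN').mpr hk1⟩
    refine small i _ fun t => interior_subset (hi ?_)
    exact (convex_ball _ δ).lineMap_mem (Metric.mem_ball_self hδ) (Metric.mem_ball'.mpr ha) t.2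
  -- Initial pieces of the path are extended one short piece at a time. The concatenation agrees
  -- with the longer initial piece up to homotopy, because paths in `ℝ` with the same ends are
  -- homotopic.
  have key : ∀ k : ℕ, k ≤ N →
      M _ _ (Path.Homotopic.Quotient.mk ((Path.segment (0 : ℝ) (k / N : ℝ)).map H.continuous)) := by
    intro k
    induction k with
    | zero =>
      intro _
      have := hsmall 0 (Nat.zero_le _) 0 (by simpa)
      have e : ((0 : ℕ) : ℝ) / N = 0 := by simp
      rw [e] at this ⊢
      exact this
    | succ k ih =>
      intro hk
      have h1 := trans _ _ (ih (by omega)) (hsmall k (by omega) ((k + 1 : ℕ) / N) (by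
        rw [Real.dist_eq, show (k : ℝ) / N - ((k + 1 : ℕ) : ℝ) / N = -(1 / N) by push_cast; ring,
          abs_neg, abs_of_pos (by positivity)]
        rw [div_lt_iff₀ hδ] at hN
        rw [div_lt_iff₀ hN']
        linarith))
      rw [← Path.Homotopic.Quotient.mk_trans, ← Path.map_trans] at h1
      convert h1 using 1
      exact Path.Homotopic.Quotient.eq.mpr ((SimplyConnectedSpace.paths_homotopic _ _).map H)
  have h1 := key N le_rfl
  have h2 : ∀ {x' y' : Y} (γ' : Path x' y'), (∀ t, γ' t = γ t) →
      M _ _ (Path.Homotopic.Quotient.mk γ') → M _ _ (Path.Homotopic.Quotient.mk γ) := by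
    intro x' y' γ' h h'
    rwa [path_fun_congr (fun x y γ => M x y (Path.Homotopic.Quotient.mk γ)) γ' γ h] at h'
  refine h2 _ (fun t => ?_) h1
  simp [H, AffineMap.lineMap_apply, div_self hN'.ne']

end LocalFunctor

/-! ### Path classes through simply connected spaces -/

section Via

variable {W W' X X' : Type} [TopologicalSpace W] [TopologicalSpace W'] [TopologicalSpace X]
  [TopologicalSpace X'] [SimplyConnectedSpace W] [SimplyConnectedSpace W']

/-- The class of the image in `X` of the paths from `a` to `b` in a simply connected space. -/
noncomputable def via (f : C(W, X)) (a b : W) {x y : X} (hx : x = f a) (hy : y = f b) :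
    PathClass x y :=
  (Path.Homotopic.Quotient.mk ((PathConnectedSpace.somePath a b).map f.continuous)).cast hx hy

/-- Since `W` is simply connected, any lift `δ` can replace the path chosen in `via`. Classes of
paths that lift to `W` therefore depend only on the endpoints of a lift. -/
theorem mk_eq_via (f : C(W, X)) {a b : W} {x y : X} (hx : x = f a) (hy : y = f b) (γ : Path x y)
    (δ : Path a b) (h : ∀ t, γ t = f (δ t)) : Path.Homotopic.Quotient.mk γ = via f a b hx hy := by
  subst hx hy
  obtain rfl : γ = δ.map f.continuous := Path.ext (funext h)
  rw [via, Path.Homotopic.Quotient.cast_rfl_rfl]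
  exact Path.Homotopic.Quotient.eq.mpr ((SimplyConnectedSpace.paths_homotopic _ _).map f)

theorem via_trans (f : C(W, X)) (a b c : W) {x y z : X} (hx : x = f a) (hy : y = f b)
    (hz : z = f c) : (via f a b hx hy).trans (via f b c hy hz) = via f a c hx hz := by
  subst hx hy hz
  rw [← mk_eq_via f rfl rfl ((PathConnectedSpace.somePath a b).map f.continuous) _ fun _ => rfl,
    ← mk_eq_via f rfl rfl ((PathConnectedSpace.somePath b c).map f.continuous) _ fun _ => rfl,
    ← Path.Homotopic.Quotient.mk_trans, ← Path.map_trans]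
  exact mk_eq_via f rfl rfl _ _ fun _ => rfl

theorem via_self (f : C(W, X)) (a : W) {x : X} (hx hx' : x = f a) :
    via f a a hx hx' = Path.Homotopic.Quotient.refl x := by
  subst hx
  exact (mk_eq_via f rfl rfl (Path.refl _) (Path.refl a) fun _ => rfl).symm

theorem via_symm (f : C(W, X)) (a b : W) {x y : X} (hx : x = f a) (hy : y = f b) :
    (via f a b hx hy).symm = via f b a hy hx := by
  rw [← Path.Homotopic.Quotient.trans_refl (via f a b hx hy).symm, ← via_self f a hx hx,
    ← via_trans f a b a hx hy hx, ← Path.Homotopic.Quotient.trans_assoc,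
    Path.Homotopic.Quotient.symm_trans, Path.Homotopic.Quotient.refl_trans]

theorem via_map (f : C(W, X)) (g : C(X, X')) (a b : W) {x y : X} (hx : x = f a) (hy : y = f b) :
    (via f a b hx hy).map g = via (g.comp f) a b (congrArg g hx) (congrArg g hy) := by
  subst hx hy
  rfl

/-- With `k` a deck translation of a covering, this replaces a lift by a translate without changing
the class. -/
theorem via_comp (f : C(W, X)) (f' : C(W', X)) (k : C(W', W)) (h : ∀ w, f (k w) = f' w) (a b : W')
    {x y : X} (hx : x = f (k a)) (hy : y = f (k b)) :
    via f (k a) (k b) hx hy = via f' a b (hx.trans (h a)) (hy.trans (h b)) := by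
  subst hx hy
  exact (mk_eq_via f rfl rfl (((PathConnectedSpace.somePath a b).map f'.continuous).cast (h a) (h b))
    ((PathConnectedSpace.somePath a b).map k.continuous) fun t => (h _).symm).symm

end Via

/-! ### Points of the sphere -/

section Normalize

/-- The norm of a nonzero vector is positive. -/
theorem sqrt_norm_sq_pos (a : {a : ℂ × ℝ // a ≠ 0}) : 0 < √(‖a.1.1‖ ^ 2 + a.1.2 ^ 2) := by
  refine Real.sqrt_pos.mpr (lt_of_le_of_ne (by positivity) fun h0 => a.2 (Prod.ext ?_ ?_))
  · exact norm_eq_zero.mp ((pow_eq_zero_iff two_ne_zero).mp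
      (by nlinarith [sq_nonneg a.1.2, sq_nonneg ‖a.1.1‖]))
  · exact (pow_eq_zero_iff two_ne_zero).mp (by nlinarith [sq_nonneg a.1.2, sq_nonneg ‖a.1.1‖])

/-- Central projection to the unit sphere. -/
noncomputable def normalize : C({a : ℂ × ℝ // a ≠ 0}, Sphere) where
  toFun a := ⟨(a.1.1 / (√(‖a.1.1‖ ^ 2 + a.1.2 ^ 2) : ℝ), a.1.2 / √(‖a.1.1‖ ^ 2 + a.1.2 ^ 2)), by
    have h : (0 : ℝ) ≤ ‖a.1.1‖ ^ 2 + a.1.2 ^ 2 := by positivity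
    have h' : (‖a.1.1‖ ^ 2 + a.1.2 ^ 2 : ℝ) ≠ 0 := (Real.sqrt_pos.mp (sqrt_norm_sq_pos a)).ne'
    simp only [norm_div, Complex.norm_real, Real.norm_eq_abs, div_pow, sq_abs, Real.sq_sqrt h]
    field_simp⟩
  continuous_toFun := by
    have h (a : {a : ℂ × ℝ // a ≠ 0}) : √(‖a.1.1‖ ^ 2 + a.1.2 ^ 2) ≠ 0 := (sqrt_norm_sq_pos a).ne'
    refine Continuous.subtype_mk (Continuous.prodMk ?_ ?_) _
    · exact Continuous.div (by fun_prop) (by fun_prop) fun a => by exact_mod_cast h a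
    · exact Continuous.div (by fun_prop) (by fun_prop) h

theorem normalize_smul {s : ℝ} (hs : 0 < s) (a b : {a : ℂ × ℝ // a ≠ 0}) (h : b.1 = s • a.1) :
    normalize b = normalize a := by
  have e : √(‖b.1.1‖ ^ 2 + b.1.2 ^ 2) = s * √(‖a.1.1‖ ^ 2 + a.1.2 ^ 2) := by
    rw [h, Prod.smul_fst, Prod.smul_snd, norm_smul, smul_eq_mul, Real.norm_of_nonneg hs.le,
      mul_pow, mul_pow, ← mul_add, Real.sqrt_mul (sq_nonneg s), Real.sqrt_sq hs.le]
  refine Subtype.ext (Prod.ext ?_ ?_)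
  · change b.1.1 / (√(‖b.1.1‖ ^ 2 + b.1.2 ^ 2) : ℝ) = a.1.1 / (√(‖a.1.1‖ ^ 2 + a.1.2 ^ 2) : ℝ)
    rw [e, h, Prod.smul_fst, Complex.real_smul, Complex.ofReal_mul, mul_div_mul_left]
    exact_mod_cast hs.ne'
  · change b.1.2 / √(‖b.1.1‖ ^ 2 + b.1.2 ^ 2) = a.1.2 / √(‖a.1.1‖ ^ 2 + a.1.2 ^ 2)
    rw [e, h, Prod.smul_snd, smul_eq_mul, mul_div_mul_left _ _ hs.ne']

theorem Sphere.ne_zero (s : Sphere) : s.1 ≠ 0 := by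
  intro h
  have := s.2
  rw [h] at this
  simp at this

theorem normalize_self (s : Sphere) : normalize ⟨s.1, s.ne_zero⟩ = s := by
  refine Subtype.ext (Prod.ext ?_ ?_)
  · change s.1.1 / (√(‖s.1.1‖ ^ 2 + s.1.2 ^ 2) : ℝ) = s.1.1
    rw [s.2]; simp
  · change s.1.2 / √(‖s.1.1‖ ^ 2 + s.1.2 ^ 2) = s.1.2
    rw [s.2]; simp

theorem normalize_eq {t : ℝ} (ht : 0 < t) (s : Sphere) (a : {a : ℂ × ℝ // a ≠ 0})
    (h : a.1 = t • s.1) : normalize a = s :=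
  (normalize_smul ht ⟨s.1, s.ne_zero⟩ a h).trans (normalize_self s)

theorem normalize_south (z : ℂ) (h : ((z, -1) : ℂ × ℝ) ≠ 0) : normalize ⟨(z, -1), h⟩ = south z := by
  refine Subtype.ext (Prod.ext ?_ ?_)
  · change z / (√(‖z‖ ^ 2 + (-1) ^ 2) : ℝ) = z / (√(1 + ‖z‖ ^ 2) : ℝ)
    rw [neg_one_sq, add_comm]
  · change -1 / √(‖z‖ ^ 2 + (-1) ^ 2) = -1 / √(1 + ‖z‖ ^ 2)
    rw [neg_one_sq, add_comm]

theorem normalize_north (z : ℂ) (h : ((z, 1) : ℂ × ℝ) ≠ 0) :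
    normalize ⟨(z, 1), h⟩ = north ((starRingEnd ℂ) z) := by
  refine Subtype.ext (Prod.ext ?_ ?_)
  · change z / (√(‖z‖ ^ 2 + 1 ^ 2) : ℝ) =
      (starRingEnd ℂ) ((starRingEnd ℂ) z / (√(1 + ‖(starRingEnd ℂ) z‖ ^ 2) : ℝ))
    rw [one_pow, add_comm, map_div₀, Complex.conj_conj, Complex.conj_ofReal, RCLike.norm_conj]
  · change 1 / √(‖z‖ ^ 2 + 1 ^ 2) = -(-1 / √(1 + ‖(starRingEnd ℂ) z‖ ^ 2))
    rw [one_pow, add_comm, RCLike.norm_conj]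
    ring

theorem normalize_snd_neg (a : {a : ℂ × ℝ // a ≠ 0}) : (normalize a).1.2 < 0 ↔ a.1.2 < 0 := by
  change a.1.2 / √(‖a.1.1‖ ^ 2 + a.1.2 ^ 2) < 0 ↔ _
  rw [div_lt_iff₀ (sqrt_norm_sq_pos a), zero_mul]

theorem normalize_snd_pos (a : {a : ℂ × ℝ // a ≠ 0}) : 0 < (normalize a).1.2 ↔ 0 < a.1.2 := by
  change 0 < a.1.2 / √(‖a.1.1‖ ^ 2 + a.1.2 ^ 2) ↔ _
  rw [lt_div_iff₀ (sqrt_norm_sq_pos a), zero_mul]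

theorem south_of_neg {s : Sphere} (hs : s.1.2 < 0) : south (s.1.1 / ((-s.1.2 : ℝ) : ℂ)) = s := by
  have h : ((s.1.1 / ((-s.1.2 : ℝ) : ℂ), -1) : ℂ × ℝ) ≠ 0 := fun h => by simpa using congrArg Prod.snd h
  rw [← normalize_south _ h]
  refine normalize_eq (t := (-s.1.2)⁻¹) (inv_pos.mpr (by linarith)) s _ (Prod.ext ?_ ?_)
  · simp [Complex.real_smul, div_eq_mul_inv, mul_comm]
  · change -1 = (-s.1.2)⁻¹ * s.1.2
    field_simp [hs.ne]

theorem north_of_pos {s : Sphere} (hs : 0 < s.1.2) :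
    north ((starRingEnd ℂ) s.1.1 / ((s.1.2 : ℝ) : ℂ)) = s := by
  have h : (reflect s).1.2 < 0 := neg_neg_of_pos hs
  refine (congrArg reflect ?_).trans (reflect_reflect s)
  refine Eq.trans ?_ (south_of_neg h)
  change south _ = south (((starRingEnd ℂ) s.1.1) / ((-(-s.1.2) : ℝ) : ℂ))
  rw [neg_neg]

end Normalize

open TopologicalPolynomial

/-! ### The collar of the equator -/

section Collar

variable {R R' : ℝ}

/-- The universal cover of the collar of the equator: pairs (angle, slope). -/
def Collar (R R' : ℝ) : Type := {a : ℝ × ℝ // -1 ≤ R * a.2 ∧ R' * a.2 ≤ 1}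

instance : TopologicalSpace (Collar R R') := inferInstanceAs (TopologicalSpace (Subtype _))

theorem convex_collar (R R' : ℝ) : Convex ℝ {a : ℝ × ℝ | -1 ≤ R * a.2 ∧ R' * a.2 ≤ 1} := by
  rintro a ⟨ha, ha'⟩ b ⟨hb, hb'⟩ s t hs ht hst
  simp only [mem_ofPred_eq, Prod.snd_add, Prod.smul_snd, smul_eq_mul]
  constructor <;> nlinarith

instance : SimplyConnectedSpace (Collar R R') :=
  haveI := (convex_collar R R').contractibleSpace ⟨0, by simp⟩
  inferInstanceAs (SimplyConnectedSpace {a : ℝ × ℝ | -1 ≤ R * a.2 ∧ R' * a.2 ≤ 1})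

theorem circlePt_ne_zero {ρ : ℝ} (hρ : 0 < ρ) (x : ℝ) : circlePt ρ x ≠ 0 := by
  rw [← norm_ne_zero_iff, norm_circlePt hρ]
  exact hρ.ne'

theorem circlePt_eq_mul (ρ x : ℝ) : circlePt ρ x = ρ * circlePt 1 x := by simp [circlePt]

theorem circlePt_neg (ρ x : ℝ) : circlePt ρ (-x) = (starRingEnd ℂ) (circlePt ρ x) := by
  rw [circlePt, circlePt, map_mul, ← Complex.exp_conj, Complex.conj_ofReal]
  congr 2
  simp only [map_mul, Complex.conj_ofReal, Complex.conj_I, Complex.ofReal_neg, map_ofNat]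
  ring

theorem circlePt_eq_iff {x y : ℝ} : circlePt 1 x = circlePt 1 y ↔ ∃ n : ℤ, x = y + n := by
  constructor
  · intro h
    simp only [circlePt, Complex.ofReal_one, one_mul] at h
    obtain ⟨n, hn⟩ := Complex.exp_eq_exp_iff_exists_int.mp h
    refine ⟨n, ?_⟩
    have hpi : (2 * Real.pi * Complex.I : ℂ) ≠ 0 := by
      simp [Real.pi_ne_zero, Complex.I_ne_zero]
    have : (x : ℂ) = y + n := by
      apply mul_left_cancel₀ hpi
      linear_combination hn
    exact_mod_cast this
  · rintro ⟨n, rfl⟩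
    exact circlePt_add_int 1 y n

/-- The covering of the collar. -/
noncomputable def polar (R R' : ℝ) : C(Collar R R', Sphere) :=
  normalize.comp ⟨fun a => ⟨(circlePt 1 a.1.1, a.1.2), fun h =>
    circlePt_ne_zero one_pos _ (congrArg Prod.fst h)⟩, by
      refine Continuous.subtype_mk (Continuous.prodMk ?_ ?_) _
      · exact (continuous_circlePt 1).comp (continuous_fst.comp continuous_subtype_val)
      · exact continuous_snd.comp continuous_subtype_val⟩

/-- Translation of the angle by an integer. -/
def Collar.shift (n : ℤ) : C(Collar R R', Collar R R') where
  toFun a := ⟨(a.1.1 + n, a.1.2), a.2⟩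
  continuous_toFun := by
    refine Continuous.subtype_mk (Continuous.prodMk ?_ ?_) _
    · exact (continuous_fst.comp continuous_subtype_val).add continuous_const
    · exact continuous_snd.comp continuous_subtype_val

theorem polar_shift (n : ℤ) (a : Collar R R') : polar R R' (a.shift n) = polar R R' a := by
  refine congrArg normalize (Subtype.ext (Prod.ext ?_ rfl))
  exact circlePt_add_int 1 _ n

theorem polar_snd_neg (a : Collar R R') : (polar R R' a).1.2 < 0 ↔ a.1.2 < 0 :=
  normalize_snd_neg _

theorem polar_snd_pos (a : Collar R R') : 0 < (polar R R' a).1.2 ↔ 0 < a.1.2 :=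
  normalize_snd_pos _

theorem polar_south {a : Collar R R'} (ha : a.1.2 < 0) :
    polar R R' a = south (circlePt (-a.1.2)⁻¹ a.1.1) := by
  have h : ((circlePt (-a.1.2)⁻¹ a.1.1, -1) : ℂ × ℝ) ≠ 0 := fun h => by
    simpa using congrArg Prod.snd h
  rw [← normalize_south _ h]
  refine (normalize_smul (inv_pos.mpr (neg_pos.mpr ha)) _ _ (Prod.ext ?_ ?_)).symm
  · change circlePt _ _ = ((-a.1.2)⁻¹ : ℝ) • circlePt 1 a.1.1
    rw [circlePt_eq_mul, Complex.real_smul]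
  · change -1 = (-a.1.2)⁻¹ * a.1.2
    field_simp [ha.ne]

theorem polar_north {a : Collar R R'} (ha : 0 < a.1.2) :
    polar R R' a = north (circlePt (a.1.2)⁻¹ (-a.1.1)) := by
  have h : ((circlePt (a.1.2)⁻¹ a.1.1, 1) : ℂ × ℝ) ≠ 0 := fun h => by
    simpa using congrArg Prod.snd h
  rw [circlePt_neg, ← normalize_north _ h]
  refine (normalize_smul (inv_pos.mpr ha) _ _ (Prod.ext ?_ ?_)).symm
  · change circlePt _ _ = ((a.1.2)⁻¹ : ℝ) • circlePt 1 a.1.1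
    rw [circlePt_eq_mul, Complex.real_smul]
  · change 1 = (a.1.2)⁻¹ * a.1.2
    field_simp [ha.ne']

/-- The closed collar of the equator. -/
def InCollar (R R' : ℝ) (s : Sphere) : Prop := R * -s.1.2 ≤ ‖s.1.1‖ ∧ R' * s.1.2 ≤ ‖s.1.1‖

theorem polar_inCollar (a : Collar R R') : InCollar R R' (polar R R' a) := by
  let b : {a : ℂ × ℝ // a ≠ 0} := ⟨(circlePt 1 a.1.1, a.1.2), fun h =>
    circlePt_ne_zero one_pos _ (congrArg Prod.fst h)⟩
  have h : 0 < √(‖b.1.1‖ ^ 2 + b.1.2 ^ 2) := sqrt_norm_sq_pos b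
  have h1 : ‖(polar R R' a).1.1‖ = 1 / √(‖b.1.1‖ ^ 2 + b.1.2 ^ 2) := by
    change ‖circlePt 1 a.1.1 / ((√(‖b.1.1‖ ^ 2 + b.1.2 ^ 2) : ℝ) : ℂ)‖ = _
    rw [norm_div, Complex.norm_real, Real.norm_of_nonneg h.le]
    exact congrArg (· / _) (norm_circlePt one_pos _)
  have h2 : (polar R R' a).1.2 = a.1.2 / √(‖b.1.1‖ ^ 2 + b.1.2 ^ 2) := rfl
  obtain ⟨ha, ha'⟩ := a.2
  constructor
  · rw [h1, h2, ← neg_div, ← mul_div_assoc]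
    exact div_le_div_of_nonneg_right (by linarith) h.le
  · rw [h1, h2, ← mul_div_assoc]
    exact div_le_div_of_nonneg_right (by linarith) h.le

theorem InCollar.ne_zero (hR : 0 < R) (hR' : 0 < R') {s : Sphere} (hs : InCollar R R' s) :
    s.1.1 ≠ 0 := by
  intro h
  obtain ⟨h1, h2⟩ := hs
  rw [h, norm_zero] at h1 h2
  have : s.1.2 = 0 := by nlinarith
  exact s.ne_zero (Prod.ext h this)

theorem polar_eq {s : Sphere} (hs : s.1.1 ≠ 0) (a : Collar R R')
    (h1 : circlePt 1 a.1.1 = s.1.1 / (‖s.1.1‖ : ℂ)) (h2 : a.1.2 = s.1.2 / ‖s.1.1‖) :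
    polar R R' a = s := by
  refine normalize_eq (t := ‖s.1.1‖⁻¹) (inv_pos.mpr (norm_pos_iff.mpr hs)) s _ (Prod.ext ?_ ?_)
  · change circlePt 1 a.1.1 = (‖s.1.1‖⁻¹ : ℝ) • s.1.1
    rw [h1, Complex.real_smul, div_eq_inv_mul, Complex.ofReal_inv]
  · change a.1.2 = ‖s.1.1‖⁻¹ * s.1.2
    rw [h2, div_eq_inv_mul]

theorem polar_div {s : Sphere} {a : Collar R R'} (h : polar R R' a = s) :
    circlePt 1 a.1.1 = s.1.1 / (‖s.1.1‖ : ℂ) ∧ a.1.2 = s.1.2 / ‖s.1.1‖ := by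
  subst h
  let b : {a : ℂ × ℝ // a ≠ 0} := ⟨(circlePt 1 a.1.1, a.1.2), fun h =>
    circlePt_ne_zero one_pos _ (congrArg Prod.fst h)⟩
  have h : 0 < √(‖b.1.1‖ ^ 2 + b.1.2 ^ 2) := sqrt_norm_sq_pos b
  have h0 : (polar R R' a).1.1 = circlePt 1 a.1.1 / ((√(‖b.1.1‖ ^ 2 + b.1.2 ^ 2) : ℝ) : ℂ) := rfl
  have h1 : ‖(polar R R' a).1.1‖ = 1 / √(‖b.1.1‖ ^ 2 + b.1.2 ^ 2) := by
    rw [h0, norm_div, Complex.norm_real, Real.norm_of_nonneg h.le]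
    exact congrArg (· / _) (norm_circlePt one_pos _)
  have h2 : (polar R R' a).1.2 = a.1.2 / √(‖b.1.1‖ ^ 2 + b.1.2 ^ 2) := rfl
  rw [h1, h2, h0]
  have h3 : ((√(‖b.1.1‖ ^ 2 + b.1.2 ^ 2) : ℝ) : ℂ) ≠ 0 := by exact_mod_cast h.ne'
  constructor
  · push_cast
    field_simp
  · field_simp

/-- A point of the collar determines its slope, and its angle modulo `ℤ` (`polar_div`); hence the
fibres are the orbits of the deck translations. -/
theorem polar_eq_iff {a b : Collar R R'} :
    polar R R' a = polar R R' b ↔ ∃ n : ℤ, a = b.shift n := by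
  constructor
  · intro h
    obtain ⟨h1, h2⟩ := polar_div h
    obtain ⟨h3, h4⟩ := polar_div (a := b) rfl
    obtain ⟨n, hn⟩ := circlePt_eq_iff.mp (h1.trans h3.symm)
    exact ⟨n, Subtype.ext (Prod.ext hn (h2.trans h4.symm))⟩
  · rintro ⟨n, rfl⟩
    exact polar_shift n b

theorem exists_circlePt {w : ℂ} (hw : ‖w‖ = 1) : ∃ x, circlePt 1 x = w := by
  refine ⟨w.arg / (2 * Real.pi), ?_⟩
  rw [circlePt_eq, mul_div_cancel₀ _ (by positivity), Complex.ofReal_one, one_mul]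
  have := Complex.norm_mul_exp_arg_mul_I w
  rwa [hw, Complex.ofReal_one, one_mul] at this

theorem collar_mem (hR : 0 < R) (hR' : 0 < R') {s : Sphere} (hs : InCollar R R' s) :
    -1 ≤ R * (s.1.2 / ‖s.1.1‖) ∧ R' * (s.1.2 / ‖s.1.1‖) ≤ 1 := by
  have h : 0 < ‖s.1.1‖ := norm_pos_iff.mpr (hs.ne_zero hR hR')
  obtain ⟨h1, h2⟩ := hs
  rw [← mul_div_assoc, ← mul_div_assoc, le_div_iff₀ h, div_le_one h]
  constructor <;> linarith

theorem exists_polar_eq (hR : 0 < R) (hR' : 0 < R') {s : Sphere} (hs : InCollar R R' s) :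
    ∃ a : Collar R R', polar R R' a = s := by
  have h := hs.ne_zero hR hR'
  obtain ⟨x, hx⟩ := exists_circlePt (w := s.1.1 / (‖s.1.1‖ : ℂ)) (by
    rw [norm_div, Complex.norm_real, norm_norm, div_self (norm_ne_zero_iff.mpr h)])
  exact ⟨⟨(x, s.1.2 / ‖s.1.1‖), collar_mem hR hR' hs⟩, polar_eq h _ hx rfl⟩

/-- Paths in the collar lift to the universal cover. -/
theorem exists_polar_lift (hR : 0 < R) (hR' : 0 < R') {s s' : Sphere} (γ : Path s s')
    (hγ : ∀ t, InCollar R R' (γ t)) (a : Collar R R') (ha : polar R R' a = s) :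
    ∃ (b : Collar R R') (δ : Path a b), ∀ t, polar R R' (δ t) = γ t := by
  have hne (t) : (γ t).1.1 ≠ 0 := (hγ t).ne_zero hR hR'
  have hc1 : Continuous fun t => (γ t).1.1 :=
    continuous_fst.comp (continuous_subtype_val.comp γ.continuous)
  have hc2 : Continuous fun t => (γ t).1.2 :=
    continuous_snd.comp (continuous_subtype_val.comp γ.continuous)
  -- The slope is a function on the collar itself, so only the direction has to be lifted; this is
  -- path lifting for the exponential covering of the circle.
  let c : C(unitInterval, Circle) := ⟨fun t => ⟨(γ t).1.1 / (‖(γ t).1.1‖ : ℂ), by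
      change _ ∈ Metric.sphere (0 : ℂ) 1
      rw [mem_sphere_zero_iff_norm, norm_div, Complex.norm_real, norm_norm,
        div_self (norm_ne_zero_iff.mpr (hne t))]⟩, by
    refine Continuous.subtype_mk (hc1.div (by fun_prop) fun t => ?_) _
    exact_mod_cast norm_ne_zero_iff.mpr (hne t)⟩
  have h0 : c 0 = Circle.exp (2 * Real.pi * a.1.1) := by
    refine Circle.ext ?_
    change (γ 0).1.1 / (‖(γ 0).1.1‖ : ℂ) = _
    rw [γ.source, Circle.coe_exp, ← (polar_div ha).1, circlePt_eq, Complex.ofReal_one, one_mul]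
  obtain ⟨Γ, hΓ, hΓ0⟩ := Circle.isCoveringMap_exp.exists_path_lifts c _ h0
  let f : C(unitInterval, Collar R R') := ⟨fun t => ⟨(Γ t / (2 * Real.pi), (γ t).1.2 / ‖(γ t).1.1‖),
    collar_mem hR hR' (hγ t)⟩, by
      refine Continuous.subtype_mk (Continuous.prodMk (by fun_prop) ?_) _
      exact hc2.div hc1.norm fun t => norm_ne_zero_iff.mpr (hne t)⟩
  refine ⟨f 1, ⟨f, ?_, rfl⟩, fun t => ?_⟩
  · refine Subtype.ext (Prod.ext ?_ ?_)
    · change Γ 0 / (2 * Real.pi) = a.1.1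
      rw [hΓ0]
      field_simp
    · change (γ 0).1.2 / ‖(γ 0).1.1‖ = a.1.2
      rw [γ.source, (polar_div ha).2]
  · refine polar_eq (hne t) _ ?_ rfl
    change circlePt 1 (Γ t / (2 * Real.pi)) = (c t : ℂ)
    rw [← congrFun hΓ t, Function.comp, Circle.coe_exp, circlePt_eq, Complex.ofReal_one, one_mul,
      mul_div_cancel₀ _ (by positivity)]

/-- The indices of a cover of the sphere by the open hemispheres and the collar. -/
inductive Chart
  | south
  | north
  | collar

/-- The open hemispheres and the collar. -/
def Chart.domain (R R' : ℝ) : Chart → Set Sphere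
  | .south => {s | s.1.2 < 0}
  | .north => {s | 0 < s.1.2}
  | .collar => {s | InCollar R R' s}

/-- The collar is closed, but the strict form of its inequalities is open and holds on the equator.
This is why the covers are only required to contain neighbourhoods. -/
theorem Chart.exists_domain_mem_nhds (R R' : ℝ) (s : Sphere) :
    ∃ i, Chart.domain R R' i ∈ 𝓝 s := by
  have hc : Continuous fun s : Sphere => s.1.2 := continuous_snd.comp continuous_subtype_val
  rcases lt_trichotomy s.1.2 0 with h | h | h
  · exact ⟨.south, (isOpen_lt hc continuous_const).mem_nhds h⟩
  · refine ⟨.collar, ?_⟩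
    have hn : Continuous fun s : Sphere => ‖s.1.1‖ :=
      (continuous_fst.comp continuous_subtype_val).norm
    have hs : 0 < ‖s.1.1‖ := norm_pos_iff.mpr fun h' => s.ne_zero (Prod.ext h' h)
    have h1 : {s : Sphere | R * -s.1.2 < ‖s.1.1‖ ∧ R' * s.1.2 < ‖s.1.1‖} ∈ 𝓝 s :=
      ((isOpen_lt (hc.neg.const_mul R) hn).inter (isOpen_lt (hc.const_mul R') hn)).mem_nhds
        (by constructor <;> simp [h, hs])
    exact mem_of_superset h1 fun s hs => ⟨hs.1.le, hs.2.le⟩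
  · exact ⟨.north, (isOpen_lt continuous_const hc).mem_nhds h⟩

end Collar

/-! ### Generation of fundamental groupoids by the hemispheres and the meridian -/

section Generation

variable {R R' : ℝ} {B : Sphere → Prop} {AS AN : ℂ → Prop}

/-- The points of the universal cover of the collar over the boundary circles. -/
noncomputable def Collar.southEnd (hR : 0 < R) (hR' : 0 < R') (x : ℝ) : Collar R R' :=
  ⟨(x, -R⁻¹), by
    change -1 ≤ R * -R⁻¹ ∧ R' * -R⁻¹ ≤ 1
    have h1 := mul_inv_cancel₀ hR.ne'
    have h2 := mul_pos hR' (inv_pos.mpr hR)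
    constructor <;> linarith⟩

noncomputable def Collar.northEnd (hR : 0 < R) (hR' : 0 < R') (x : ℝ) : Collar R R' :=
  ⟨(x, R'⁻¹), by
    change -1 ≤ R * R'⁻¹ ∧ R' * R'⁻¹ ≤ 1
    have h1 := mul_inv_cancel₀ hR'.ne'
    have h2 := mul_pos hR (inv_pos.mpr hR')
    constructor <;> linarith⟩

theorem polar_southEnd (hR : 0 < R) (hR' : 0 < R') (x : ℝ) :
    polar R R' (Collar.southEnd hR hR' x) = south (circlePt R x) := by
  rw [polar_south (show -R⁻¹ < 0 from neg_neg_of_pos (inv_pos.mpr hR))]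
  simp [Collar.southEnd]

theorem polar_northEnd (hR : 0 < R) (hR' : 0 < R') (x : ℝ) :
    polar R R' (Collar.northEnd hR hR' x) = north (circlePt R' (-x)) := by
  rw [polar_north (show 0 < R'⁻¹ from inv_pos.mpr hR')]
  simp [Collar.northEnd]

/-- The covering of the collar inside a subset of the sphere. -/
noncomputable def polarIn (hB : ∀ s, InCollar R R' s → B s) : C(Collar R R', {s // B s}) :=
  ⟨fun a => ⟨polar R R' a, hB _ (polar_inCollar a)⟩, (polar R R').continuous.subtype_mk _⟩

theorem polarIn_shift (hB : ∀ s, InCollar R R' s → B s) (n : ℤ) (a : Collar R R') :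
    polarIn hB (a.shift n) = polarIn hB a := Subtype.ext (polar_shift n a)

theorem via_polarIn_shift (hB : ∀ s, InCollar R R' s → B s) (n : ℤ) (a b : Collar R R')
    {x y : {s // B s}} (hx : x = polarIn hB a) (hy : y = polarIn hB b) :
    via (polarIn hB) (a.shift n) (b.shift n) (hx.trans (polarIn_shift hB n a).symm)
      (hy.trans (polarIn_shift hB n b).symm) = via (polarIn hB) a b hx hy :=
  via_comp (polarIn hB) (polarIn hB) (Collar.shift n) (polarIn_shift hB n) a b _ _

/-- A path in the collar is determined by the endpoints of a lift, of which one can be chosen. -/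
theorem exists_mk_eq_via (hR : 0 < R) (hR' : 0 < R') (hB : ∀ s, InCollar R R' s → B s)
    {x y : {s // B s}} (γ : Path x y) (hγ : ∀ t, InCollar R R' (γ t).1) (a : Collar R R')
    (ha : x = polarIn hB a) :
    ∃ (b : Collar R R') (δ : Path a b) (hb : y = polarIn hB b),
      (∀ t, γ t = polarIn hB (δ t)) ∧ Path.Homotopic.Quotient.mk γ = via (polarIn hB) a b ha hb := by
  obtain ⟨b, δ, hδ⟩ := exists_polar_lift hR hR' (γ.map continuous_subtype_val) hγ a
    (congrArg Subtype.val ha).symm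
  have h : ∀ t, γ t = polarIn hB (δ t) := fun t => Subtype.ext (hδ t).symm
  have hb : y = polarIn hB b := by simpa using h 1
  exact ⟨b, δ, hb, h, mk_eq_via _ _ _ _ δ h⟩

variable {iS : C({z // AS z}, {s // B s})} {iN : C({z // AN z}, {s // B s})}

theorem north_injective : Function.Injective north := fun z w h => by
  have := congrArg reflect h
  simp only [north, ContinuousMap.comp_apply, reflect_reflect] at this
  exact south_injective this

/-- Paths in the open southern hemisphere come from the plane. -/
theorem exists_path_south (hiS : ∀ z, (iS z).1 = south z.1) (memS : ∀ z, B (south z) → AS z)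
    {z z' : {z // AS z}} (γ : Path (iS z) (iS z')) (h : ∀ t, (γ t).1.1.2 < 0) :
    ∃ ε : Path z z', ∀ t, γ t = iS (ε t) := by
  have hc : Continuous fun t => (γ t).1 := continuous_subtype_val.comp γ.continuous
  have hc1 : Continuous fun t => (γ t).1.1 := continuous_subtype_val.comp hc
  let g (t : unitInterval) : ℂ := (γ t).1.1.1 / ((-(γ t).1.1.2 : ℝ) : ℂ)
  have hg (t) : south (g t) = (γ t).1 := south_of_neg (h t)
  let f (t : unitInterval) : {z // AS z} := ⟨g t, memS _ (by rw [hg]; exact (γ t).2)⟩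
  have hf (t) : iS (f t) = γ t := Subtype.ext ((hiS _).trans (hg t))
  have hinj {z w : {z // AS z}} (h : iS z = iS w) : z = w :=
    Subtype.ext (south_injective ((hiS z).symm.trans ((congrArg Subtype.val h).trans (hiS w))))
  refine ⟨⟨⟨f, ?_⟩, hinj ((hf 0).trans γ.source), hinj ((hf 1).trans γ.target)⟩,
    fun t => (hf t).symm⟩
  refine Continuous.subtype_mk ((continuous_fst.comp hc1).div ?_ fun t => ?_) _
  · exact Complex.continuous_ofReal.comp (continuous_snd.comp hc1).neg
  · exact_mod_cast (neg_pos.mpr (h t)).ne'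

/-- Paths in the open northern hemisphere come from the plane. -/
theorem exists_path_north (hiN : ∀ z, (iN z).1 = north z.1) (memN : ∀ z, B (north z) → AN z)
    {z z' : {z // AN z}} (γ : Path (iN z) (iN z')) (h : ∀ t, 0 < (γ t).1.1.2) :
    ∃ ε : Path z z', ∀ t, γ t = iN (ε t) := by
  have hc : Continuous fun t => (γ t).1 := continuous_subtype_val.comp γ.continuous
  have hc1 : Continuous fun t => (γ t).1.1 := continuous_subtype_val.comp hc
  let g (t : unitInterval) : ℂ := (starRingEnd ℂ) (γ t).1.1.1 / (((γ t).1.1.2 : ℝ) : ℂ)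
  have hg (t) : north (g t) = (γ t).1 := north_of_pos (h t)
  let f (t : unitInterval) : {z // AN z} := ⟨g t, memN _ (by rw [hg]; exact (γ t).2)⟩
  have hf (t) : iN (f t) = γ t := Subtype.ext ((hiN _).trans (hg t))
  have hinj {z w : {z // AN z}} (h : iN z = iN w) : z = w :=
    Subtype.ext (north_injective ((hiN z).symm.trans ((congrArg Subtype.val h).trans (hiN w))))
  refine ⟨⟨⟨f, ?_⟩, hinj ((hf 0).trans γ.source), hinj ((hf 1).trans γ.target)⟩,
    fun t => (hf t).symm⟩
  refine Continuous.subtype_mk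
    ((Complex.continuous_conj.comp (continuous_fst.comp hc1)).div ?_ fun t => ?_) _
  · exact Complex.continuous_ofReal.comp (continuous_snd.comp hc1)
  · exact_mod_cast (h t).ne'

/-- The straight path between two points of the universal cover of the collar. -/
noncomputable def Collar.segment (a b : Collar R R') : Path a b where
  toFun t := ⟨AffineMap.lineMap a.1 b.1 (t : ℝ), (convex_collar R R').lineMap_mem a.2 b.2 t.2⟩
  continuous_toFun := by
    refine Continuous.subtype_mk ?_ _
    simp only [AffineMap.lineMap_apply_module]
    fun_prop
  source' := Subtype.ext (by simp)
  target' := Subtype.ext (by simp)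

theorem Collar.segment_snd_neg {a b : Collar R R'} (ha : a.1.2 < 0) (hb : b.1.2 < 0)
    (t : unitInterval) : (Collar.segment a b t).1.2 < 0 := by
  have hc : Convex ℝ {c : ℝ × ℝ | c.2 < 0} :=
    (convex_Iio (0 : ℝ)).linear_preimage (LinearMap.snd ℝ ℝ ℝ)
  exact hc.lineMap_mem ha hb t.2

theorem Collar.segment_snd_pos {a b : Collar R R'} (ha : 0 < a.1.2) (hb : 0 < b.1.2)
    (t : unitInterval) : 0 < (Collar.segment a b t).1.2 := by
  have hc : Convex ℝ {c : ℝ × ℝ | 0 < c.2} :=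
    (convex_Ioi (0 : ℝ)).linear_preimage (LinearMap.snd ℝ ℝ ℝ)
  exact hc.lineMap_mem ha hb t.2

/-- Both ends have negative slope, which is a convex condition in the strip. The straight path
between them thus stays in the open hemisphere and comes from the plane. -/
theorem exists_via_south (hB : ∀ s, InCollar R R' s → B s) (hiS : ∀ z, (iS z).1 = south z.1)
    (memS : ∀ z, B (south z) → AS z) {z z' : {z // AS z}} (k k' : Collar R R')
    (h : iS z = polarIn hB k) (h' : iS z' = polarIn hB k') :
    ∃ ε : PathClass z z', ε.map iS = via (polarIn hB) k k' h h' := by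
  have neg {z : {z // AS z}} {k : Collar R R'} (h : iS z = polarIn hB k) : k.1.2 < 0 :=
    (polar_snd_neg k).mp (by
      have := congrArg Subtype.val h
      rw [hiS] at this
      exact (show polar R R' k = south z.1 from this.symm) ▸ south_snd_neg z.1)
  obtain ⟨ε, hε⟩ := exists_path_south hiS memS
    (((Collar.segment k k').map (polarIn hB).continuous).cast h h') fun t =>
      (polar_snd_neg _).mpr (Collar.segment_snd_neg (neg h) (neg h') t)
  refine ⟨.mk ε, ?_⟩
  rw [← Path.Homotopic.Quotient.mk_map]
  exact mk_eq_via _ _ _ _ (Collar.segment k k') fun t => (hε t).symm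

theorem exists_via_north (hB : ∀ s, InCollar R R' s → B s) (hiN : ∀ z, (iN z).1 = north z.1)
    (memN : ∀ z, B (north z) → AN z) {z z' : {z // AN z}} (k k' : Collar R R')
    (h : iN z = polarIn hB k) (h' : iN z' = polarIn hB k') :
    ∃ ε : PathClass z z', ε.map iN = via (polarIn hB) k k' h h' := by
  have pos {z : {z // AN z}} {k : Collar R R'} (h : iN z = polarIn hB k) : 0 < k.1.2 :=
    (polar_snd_pos k).mp (by
      have := congrArg Subtype.val h
      rw [hiN] at this
      exact (show polar R R' k = north z.1 from this.symm) ▸ north_snd_pos z.1)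
  obtain ⟨ε, hε⟩ := exists_path_north hiN memN
    (((Collar.segment k k').map (polarIn hB).continuous).cast h h') fun t =>
      (polar_snd_pos _).mpr (Collar.segment_snd_pos (pos h) (pos h') t)
  refine ⟨.mk ε, ?_⟩
  rw [← Path.Homotopic.Quotient.mk_map]
  exact mk_eq_via _ _ _ _ (Collar.segment k k') fun t => (hε t).symm

/-- A standard path to `x` from a point off the equator: the constant path, or a path in the
collar if `x` lies on the equator. -/
inductive IsConnector (hB : ∀ s, InCollar R R' s → B s) (iS : C({z // AS z}, {s // B s}))
    (iN : C({z // AN z}, {s // B s})) :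
    ∀ (a : {z // AS z} ⊕ {z // AN z}) (x : {s // B s}), PathClass (Sum.elim iS iN a) x → Prop
  | refl (a) : IsConnector hB iS iN a (Sum.elim iS iN a) (.refl _)
  | collar (a) (x : {s // B s}) (k k' : Collar R R') (h : Sum.elim iS iN a = polarIn hB k)
      (h' : x = polarIn hB k') (hx : x.1.1.2 = 0) :
      IsConnector hB iS iN a x (via (polarIn hB) k k' h h')

theorem exists_isConnector (hR : 0 < R) (hR' : 0 < R') (hB : ∀ s, InCollar R R' s → B s)
    (hiS : ∀ z, (iS z).1 = south z.1) (memS : ∀ z, B (south z) → AS z)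
    (hiN : ∀ z, (iN z).1 = north z.1) (memN : ∀ z, B (north z) → AN z) (x : {s // B s}) :
    ∃ a c, IsConnector hB iS iN a x c := by
  rcases lt_trichotomy x.1.1.2 0 with h | h | h
  · obtain ⟨z, rfl⟩ : ∃ z, iS z = x :=
      ⟨⟨_, memS _ ((south_of_neg h).symm ▸ x.2)⟩, Subtype.ext ((hiS _).trans (south_of_neg h))⟩
    exact ⟨.inl z, _, .refl _⟩
  -- A point of the equator is joined to the point of the southern boundary circle with the same
  -- angle.
  · have hc : InCollar R R' x.1 := by constructor <;> simp [h]
    obtain ⟨k, hk⟩ := exists_polar_eq hR hR' hc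
    have h1 : B (south (circlePt R k.1.1)) := by
      rw [← polar_southEnd hR hR']
      exact hB _ (polar_inCollar _)
    refine ⟨.inl ⟨circlePt R k.1.1, memS _ h1⟩, _,
      .collar _ _ (Collar.southEnd hR hR' k.1.1) k (Subtype.ext ?_) (Subtype.ext hk.symm) h⟩
    exact (hiS _).trans (polar_southEnd hR hR' _).symm
  · obtain ⟨z, rfl⟩ : ∃ z, iN z = x :=
      ⟨⟨_, memN _ ((north_of_pos h).symm ▸ x.2)⟩, Subtype.ext ((hiN _).trans (north_of_pos h))⟩
    exact ⟨.inr z, _, .refl _⟩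

open Path.Homotopic.Quotient in
/-- A property of path classes between points off the equator holds everywhere if it is stable under
composition and holds for the paths in the hemispheres and for the meridian. -/
theorem offEquator_induction (hR : 0 < R) (hR' : 0 < R') (hB : ∀ s, InCollar R R' s → B s)
    (hiS : ∀ z, (iS z).1 = south z.1) (memS : ∀ z, B (south z) → AS z)
    (hiN : ∀ z, (iN z).1 = north z.1) (memN : ∀ z, B (north z) → AN z)
    (M : ∀ a b : {z // AS z} ⊕ {z // AN z},
      PathClass (Sum.elim iS iN a) (Sum.elim iS iN b) → Prop)
    (trans : ∀ {a b c} (ε : PathClass (Sum.elim iS iN a) (Sum.elim iS iN b))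
      (ε' : PathClass (Sum.elim iS iN b) (Sum.elim iS iN c)), M a b ε → M b c ε' →
      M a c (ε.trans ε'))
    (mapS : ∀ {z z' : {z // AS z}} (ε : PathClass z z'), M (.inl z) (.inl z') (ε.map iS))
    (mapN : ∀ {z z' : {z // AN z}} (ε : PathClass z z'), M (.inr z) (.inr z') (ε.map iN))
    (bS : {z // AS z}) (bN : {z // AN z}) (hbS : iS bS = polarIn hB (Collar.southEnd hR hR' 0))
    (hbN : iN bN = polarIn hB (Collar.northEnd hR hR' 0))
    (mer : M (.inl bS) (.inr bN) (via (polarIn hB) _ _ hbS hbN))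
    (mer' : M (.inr bN) (.inl bS) (via (polarIn hB) _ _ hbN hbS))
    {a b : {z // AS z} ⊕ {z // AN z}} (ε : PathClass (Sum.elim iS iN a) (Sum.elim iS iN b)) :
    M a b ε := by
  have viaS {z z' : {z // AS z}} (k k' : Collar R R') (h : iS z = polarIn hB k)
      (h' : iS z' = polarIn hB k') : M (.inl z) (.inl z') (via (polarIn hB) k k' h h') := by
    obtain ⟨ε, hε⟩ := exists_via_south hB hiS memS k k' h h'
    exact hε ▸ mapS ε
  have viaN {z z' : {z // AN z}} (k k' : Collar R R') (h : iN z = polarIn hB k)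
      (h' : iN z' = polarIn hB k') : M (.inr z) (.inr z') (via (polarIn hB) k k' h h') := by
    obtain ⟨ε, hε⟩ := exists_via_north hB hiN memN k k' h h'
    exact hε ▸ mapN ε
  -- In the strip, a path from one side of the equator to the other is homotopic to one that passes
  -- through both ends of the meridian of angle 0.
  have viaM : ∀ (a b) (k k' : Collar R R') (h : Sum.elim iS iN a = polarIn hB k)
      (h' : Sum.elim iS iN b = polarIn hB k'), M a b (via (polarIn hB) k k' h h') := by
    rintro (z | z) (z' | z') k k' h h'
    · exact viaS k k' h h'
    · have := trans (a := .inl z) (b := .inl bS) (c := .inr z') _ _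
        (viaS k (Collar.southEnd hR hR' 0) h hbS)
        (trans (a := .inl bS) (b := .inr bN) (c := .inr z') _ _ mer
          (viaN (Collar.northEnd hR hR' 0) k' hbN h'))
      refine (congrArg (M _ _) ?_).mp this
      exact (congrArg (Path.Homotopic.Quotient.trans _) (via_trans _ _ _ _ _ _ _)).trans
        (via_trans _ _ _ _ _ _ _)
    · have := trans (a := .inr z) (b := .inr bN) (c := .inl z') _ _
        (viaN k (Collar.northEnd hR hR' 0) h hbN)
        (trans (a := .inr bN) (b := .inl bS) (c := .inl z') _ _ mer'
          (viaS (Collar.southEnd hR hR' 0) k' hbS h'))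
      refine (congrArg (M _ _) ?_).mp this
      exact (congrArg (Path.Homotopic.Quotient.trans _) (via_trans _ _ _ _ _ _ _)).trans
        (via_trans _ _ _ _ _ _ _)
    · exact viaN k k' h h'
  let U (i : Chart) : Set {s // B s} := {x | x.1 ∈ Chart.domain R R' i}
  have cover : ∀ y, ∃ i, U i ∈ 𝓝 y := fun y => by
    obtain ⟨i, hi⟩ := Chart.exists_domain_mem_nhds R R' y.1
    exact ⟨i, continuous_subtype_val.continuousAt.preimage_mem_nhds hi⟩
  -- The ends of the small pieces may lie on the equator, so the property is tested after composing
  -- with connectors. All connectors are allowed at once, so that a common one can be inserted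
  -- between consecutive pieces.
  have key := pathClass_induction cover
    (fun x y ε => ∀ a b c c', IsConnector hB iS iN a x c → IsConnector hB iS iN b y c' →
      M a b ((c.trans ε).trans c'.symm)) ?_ ?_ ε a b _ _ (.refl a) (.refl b)
  · have h1 : ((Path.Homotopic.Quotient.refl (Sum.elim iS iN a)).trans ε).trans
        (Path.Homotopic.Quotient.refl (Sum.elim iS iN b)).symm = ε := by
      rw [refl_trans]
      exact trans_refl ε
    rwa [h1] at key
  · intro x y w ε ε' h h' a b c c' hc hc'
    obtain ⟨m, d, hd⟩ := exists_isConnector hR hR' hB hiS memS hiN memN y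
    have := trans _ _ (h a m c d hc hd) (h' m b d c' hd hc')
    have e : ((c.trans ε).trans d.symm).trans ((d.trans ε').trans c'.symm) =
        (c.trans (ε.trans ε')).trans c'.symm := by
      rw [trans_assoc, trans_assoc d, ← trans_assoc d.symm, symm_trans, refl_trans,
        ← trans_assoc, trans_assoc c]
    rwa [e] at this
  · have hrefl {x y : {s // B s}} (ε : PathClass x y) :
        ((Path.Homotopic.Quotient.refl x).trans ε).trans
          (Path.Homotopic.Quotient.refl y).symm = ε := by
      rw [refl_trans]
      exact trans_refl ε
    intro i x y γ hγ a b c c' hc hc'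
    cases i with
    | south =>
      have hx : x.1.1.2 < 0 := by simpa using (show (γ 0).1.1.2 < 0 from hγ 0)
      have hy : y.1.1.2 < 0 := by simpa using (show (γ 1).1.1.2 < 0 from hγ 1)
      cases hc with
      | collar _ k k' h h' h0 => exact absurd h0 hx.ne
      | refl =>
      cases hc' with
      | collar _ k k' h h' h0 => exact absurd h0 hy.ne
      | refl =>
      rw [hrefl]
      rcases a with z | z
      · rcases b with z' | z'
        · obtain ⟨ε, hε⟩ := exists_path_south hiS memS γ hγ
          obtain rfl : γ = ε.map iS.continuous := Path.ext (funext hε)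
          exact mapS (.mk ε)
        · exact absurd hy (by
            change ¬ (iN z').1.1.2 < 0
            rw [hiN]; exact (north_snd_pos _).not_gt)
      · exact absurd hx (by
          change ¬ (iN z).1.1.2 < 0
          rw [hiN]; exact (north_snd_pos _).not_gt)
    | north =>
      have hx : 0 < x.1.1.2 := by simpa using (show 0 < (γ 0).1.1.2 from hγ 0)
      have hy : 0 < y.1.1.2 := by simpa using (show 0 < (γ 1).1.1.2 from hγ 1)
      cases hc with
      | collar _ k k' h h' h0 => exact absurd h0 hx.ne'
      | refl =>
      cases hc' with
      | collar _ k k' h h' h0 => exact absurd h0 hy.ne'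
      | refl =>
      rw [hrefl]
      rcases a with z | z
      · exact absurd hx (by
          change ¬ 0 < (iS z).1.1.2
          rw [hiS]; exact (south_snd_neg _).not_gt)
      · rcases b with z' | z'
        · exact absurd hy (by
            change ¬ 0 < (iS z').1.1.2
            rw [hiS]; exact (south_snd_neg _).not_gt)
        · obtain ⟨ε, hε⟩ := exists_path_north hiN memN γ hγ
          obtain rfl : γ = ε.map iN.continuous := Path.ext (funext hε)
          exact mapN (.mk ε)
    | collar =>
      have hv {a x c} (hc : IsConnector hB iS iN a x c) (hx : InCollar R R' x.1) :
          ∃ k k' h h', c = via (polarIn hB) k k' h h' := by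
        cases hc with
        | collar _ k k' h h' h0 => exact ⟨k, k', h, h', rfl⟩
        | refl =>
          obtain ⟨k, hk⟩ := exists_polar_eq hR hR' hx
          have h : Sum.elim iS iN a = polarIn hB k := Subtype.ext hk.symm
          exact ⟨k, k, h, h, (via_self _ _ _ _).symm⟩
      obtain ⟨k, k', h, h', rfl⟩ := hv hc (γ.source ▸ hγ 0)
      obtain ⟨m, m', g, g', rfl⟩ := hv hc' (γ.target ▸ hγ 1)
      -- The path is lifted from the end of the first connector. The end of this lift and the end of
      -- the second connector differ by a deck translation; after translating the second connector,
      -- all three pieces form a single path in the strip.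
      obtain ⟨l, -, hl, -, e⟩ := exists_mk_eq_via hR hR' hB γ hγ k' h'
      obtain ⟨n, rfl⟩ := polar_eq_iff.mp (congrArg Subtype.val (hl.symm.trans g'))
      rw [e, via_trans, ← via_polarIn_shift hB n m m' g g', via_symm, via_trans]
      exact viaM _ _ _ _ _ _

end Generation

/-! ### Realization of paths of groups -/

section Realize

theorem le_norm_of_le_south {z : ℂ} {ρ : ℝ} (h : ρ * -(south z).1.2 ≤ ‖(south z).1.1‖) :
    ρ ≤ ‖z‖ := by
  have h0 := south_snd_neg z
  rwa [← south_div z, norm_div, Complex.norm_real, Real.norm_eq_abs, abs_abs, abs_of_neg h0,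
    le_div_iff₀ (neg_pos.mpr h0)]

theorem le_norm_of_le_north {z : ℂ} {ρ : ℝ} (h : ρ * (north z).1.2 ≤ ‖(north z).1.1‖) :
    ρ ≤ ‖z‖ := by
  refine le_norm_of_le_south ?_
  have : ρ * -(south z).1.2 ≤ ‖(starRingEnd ℂ) (south z).1.1‖ := h
  rwa [RCLike.norm_conj] at this

variable {d : ℕ} {p q : TopologicalPolynomial d} {R R' : ℝ} (hR : p.NearInfinity R)
  (hR' : q.NearInfinity R')

include hR hR' in
theorem collar_notMem {s : Sphere} (hs : InCollar R R' s) : s ∉ matingP p q := by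
  rintro (⟨z, hz, rfl⟩ | ⟨z, hz, rfl⟩)
  · exact hR.notMem (le_norm_of_le_south hs.1) hz
  · exact hR'.notMem (le_norm_of_le_north hs.2) hz

theorem formalMating_equator (p q : TopologicalPolynomial d) {s : Sphere} (hs : s.1.2 = 0) :
    (formalMating p q s).1 = (s.1.1 ^ d, 0) := by
  refine (congrArg Subtype.val (if_pos hs.le)).trans ?_
  rw [hemisphereMap, dif_pos hs]

include hR hR' in
-- Off the equator this is the condition on images in `NearInfinity`; the equator is mapped to
-- itself, away from both open hemispheres.
theorem collar_map_notMem {s : Sphere} (hs : InCollar R R' s) :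
    formalMating p q s ∉ matingP p q := by
  rcases lt_trichotomy s.1.2 0 with h | h | h
  · obtain ⟨z, rfl⟩ : ∃ z, south z = s := ⟨_, south_of_neg h⟩
    rw [formalMating_south, south_mem_iff]
    exact hR.map_notMem (le_norm_of_le_south hs.1)
  · rintro (⟨z, hz, hz'⟩ | ⟨z, hz, hz'⟩)
    · have := south_snd_neg z
      rw [hz', formalMating_equator p q h] at this
      exact this.ne rfl
    · have := north_snd_pos z
      rw [hz', formalMating_equator p q h] at this
      exact this.ne rfl
  · obtain ⟨z, rfl⟩ : ∃ z, north z = s := ⟨_, north_of_pos h⟩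
    rw [formalMating_north, north_mem_iff]
    exact hR'.map_notMem (le_norm_of_le_north hs.2)

/-- The covering of the collar, in the complement of the post-critical set. -/
noncomputable abbrev polarX : C(Collar R R', {s : Sphere // s ∉ matingP p q}) :=
  polarIn fun _ => collar_notMem hR hR'

/-- The covering of the collar, in the domain of the correspondence. -/
noncomputable abbrev polarZ :
    C(Collar R R', {s : Sphere // formalMating p q s ∉ matingP p q}) :=
  polarIn fun _ => collar_map_notMem hR hR'

/-- The point of the universal cover of the collar above the basepoint of the south. -/
noncomputable abbrev southPt (x : ℝ) : Collar R R' := Collar.southEnd hR.pos hR'.pos x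

/-- The point of the universal cover of the collar above the basepoint of the north. -/
noncomputable abbrev northPt (x : ℝ) : Collar R R' := Collar.northEnd hR.pos hR'.pos x

theorem southX_eq {z : {z : ℂ // z ∉ p.P}} {x : ℝ} (h : z = circle hR x) :
    southX p q z = polarX hR hR' (southPt hR hR' x) := by
  subst h
  exact Subtype.ext (polar_southEnd hR.pos hR'.pos x).symm

theorem northX_eq {z : {z : ℂ // z ∉ q.P}} {x y : ℝ} (h : z = circle hR' x) (hy : y = -x) :
    northX p q z = polarX hR hR' (northPt hR hR' y) := by
  subst h hy
  refine Subtype.ext ((polar_northEnd hR.pos hR'.pos (-x)).trans ?_).symm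
  rw [neg_neg]
  rfl

theorem southX_base : southX p q (base hR) = polarX hR hR' (southPt hR hR' 0) :=
  southX_eq hR hR' (circle_zero hR).symm

theorem northX_base : northX p q (base hR') = polarX hR hR' (northPt hR hR' 0) :=
  northX_eq hR hR' (circle_zero hR').symm neg_zero.symm

theorem continuous_southPt : Continuous (southPt hR hR') :=
  Continuous.subtype_mk (continuous_id.prodMk continuous_const) _

theorem continuous_northPt : Continuous (northPt hR hR') :=
  Continuous.subtype_mk (continuous_id.prodMk continuous_const) _

theorem arc_map_southX (a b : ℝ) {x y : {z : ℂ // z ∉ p.P}} (hx : x = circle hR a)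
    (hy : y = circle hR b) : (arc hR a b hx hy).map (southX p q) =
      via (polarX hR hR') (southPt hR hR' a) (southPt hR hR' b) (southX_eq hR hR' hx)
        (southX_eq hR hR' hy) := by
  subst hx hy
  exact mk_eq_via _ _ _ _ ((seg a b).map (continuous_southPt hR hR')) fun t =>
    southX_eq hR hR' rfl

theorem arc_map_northX (a b a' b' : ℝ) {x y : {z : ℂ // z ∉ q.P}} (hx : x = circle hR' a)
    (hy : y = circle hR' b) (ha : a' = -a) (hb : b' = -b) : (arc hR' a b hx hy).map (northX p q) =
      via (polarX hR hR') (northPt hR hR' a') (northPt hR hR' b') (northX_eq hR hR' hx ha)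
        (northX_eq hR hR' hy hb) := by
  subst hx hy ha hb
  refine mk_eq_via _ _ _ _ ((seg (-a) (-b)).map (continuous_northPt hR hR')) fun t => ?_
  refine northX_eq hR hR' rfl ?_
  simp only [seg, Path.coe_mk_mk]
  ring

theorem loop_map_southX (n : Multiplicative ℤ) : (loop hR n).map (southX p q) =
    via (polarX hR hR') (southPt hR hR' 0) (southPt hR hR' n.toAdd) (southX_base hR hR')
      (southX_eq hR hR' (circle_int hR _).symm) :=
  arc_map_southX hR hR' _ _ _ _

theorem loop_map_northX (n : Multiplicative ℤ) : (loop hR' n).map (northX p q) =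
    via (polarX hR hR') (northPt hR hR' 0) (northPt hR hR' (-n.toAdd : ℤ)) (northX_base hR hR')
      (northX_eq hR hR' (circle_int hR' _).symm (Int.cast_neg _)) :=
  arc_map_northX hR hR' _ _ _ _ _ _ neg_zero.symm (Int.cast_neg _)

include hR hR' in
theorem meridian_ne (s : unitInterval) :
    ((((1 - s : ℝ) * R + s * R' : ℝ) : ℂ), (2 * s - 1 : ℝ)) ≠ (0 : ℂ × ℝ) := fun h =>
  (meridian_pos hR hR' s).ne' (Complex.ofReal_eq_zero.mp (congrArg Prod.fst h))

theorem exists_meridian_lift :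
    ∃ δ : Path (southPt hR hR' 0) (northPt hR hR' 0), (∀ t, (δ t).1.1 = 0) ∧
      ∀ t, meridian hR hR' t = polarX hR hR' (δ t) := by
  -- The meridian is the central projection of the segment from `(R, -1)` to `(R', 1)`, so its angle
  -- stays 0 and its slope is the quotient of the two coordinates.
  let f (s : unitInterval) : Collar R R' :=
    ⟨(0, (2 * s - 1 : ℝ) / ((1 - s : ℝ) * R + s * R')), by
      have h := meridian_pos hR hR' s
      have h0 := s.2.1
      have h1 := s.2.2
      have h2 := hR.pos
      have h3 := hR'.pos
      change -1 ≤ R * ((2 * s - 1 : ℝ) / ((1 - s : ℝ) * R + s * R')) ∧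
        R' * ((2 * s - 1 : ℝ) / ((1 - s : ℝ) * R + s * R')) ≤ 1
      rw [← mul_div_assoc, ← mul_div_assoc, le_div_iff₀ h, div_le_one h]
      constructor <;> nlinarith⟩
  have hf : Continuous f := by
    refine Continuous.subtype_mk (continuous_const.prodMk ?_) _
    exact Continuous.div (by fun_prop) (by fun_prop) fun s => (meridian_pos hR hR' s).ne'
  refine ⟨⟨⟨f, hf⟩, ?_, ?_⟩, fun _ => rfl, fun s => Subtype.ext ?_⟩
  · refine Subtype.ext (Prod.ext rfl ?_)
    change (2 * ((0 : unitInterval) : ℝ) - 1) / ((1 - ((0 : unitInterval) : ℝ)) * R +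
      ((0 : unitInterval) : ℝ) * R') = -R⁻¹
    simp [neg_div]
  · refine Subtype.ext (Prod.ext rfl ?_)
    change (2 * ((1 : unitInterval) : ℝ) - 1) / ((1 - ((1 : unitInterval) : ℝ)) * R +
      ((1 : unitInterval) : ℝ) * R') = R'⁻¹
    norm_num
  · have h := meridian_pos hR hR' s
    refine Eq.trans (b := normalize ⟨_, meridian_ne hR hR' s⟩) ?_ ?_
    · refine Subtype.ext (Prod.ext ?_ ?_)
      · change ((_ / √(_ ^ 2 + _ ^ 2) : ℝ) : ℂ) = (_ : ℂ) / ((√(‖(_ : ℂ)‖ ^ 2 + _ ^ 2) : ℝ) : ℂ)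
        rw [Complex.norm_real, Real.norm_eq_abs, sq_abs, Complex.ofReal_div]
      · change _ / √(_ ^ 2 + _ ^ 2) = _ / √(‖(_ : ℂ)‖ ^ 2 + _ ^ 2)
        rw [Complex.norm_real, Real.norm_eq_abs, sq_abs]
    · refine normalize_smul h _ _ (Prod.ext ?_ ?_)
      · change (((1 - s : ℝ) * R + s * R' : ℝ) : ℂ) = ((1 - s : ℝ) * R + s * R' : ℝ) • circlePt 1 0
        have : circlePt 1 0 = 1 := by simpa using circlePt_int 1 0
        rw [this, Complex.real_smul, mul_one]
      · change (2 * s - 1 : ℝ) = ((1 - s : ℝ) * R + s * R') *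
          ((2 * s - 1 : ℝ) / ((1 - s : ℝ) * R + s * R'))
        rw [mul_div_cancel₀ _ h.ne']

theorem mk_meridian : Path.Homotopic.Quotient.mk (meridian hR hR') =
    via (polarX hR hR') (southPt hR hR' 0) (northPt hR hR' 0) (southX_base hR hR')
      (northX_base hR hR') := by
  obtain ⟨δ, -, h⟩ := exists_meridian_lift hR hR'
  exact mk_eq_via _ _ _ _ δ h

theorem shift_southPt (n : ℤ) : (southPt hR hR' 0).shift n = southPt hR hR' n :=
  Subtype.ext (Prod.ext (zero_add _) rfl)

theorem shift_northPt (n : ℤ) : (northPt hR hR' 0).shift n = northPt hR hR' n :=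
  Subtype.ext (Prod.ext (zero_add _) rfl)

/-- The meridian has a lift at every integer angle; the one at angle `n` starts where the lift of
the loop that winds `n` times ends. -/
theorem mk_meridian_shift (n : ℤ) : Path.Homotopic.Quotient.mk (meridian hR hR') =
    via (polarX hR hR') (southPt hR hR' n) (northPt hR hR' n)
      (southX_eq hR hR' (circle_int hR _).symm)
      ((northX_base hR hR').trans ((polarIn_shift _ n _).symm.trans (by rw [shift_northPt]))) := by
  rw [mk_meridian, ← via_polarIn_shift _ n]
  congr 1
  · exact shift_southPt hR hR' n
  · exact shift_northPt hR hR' n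

/-- The loop around the equator, moved along the meridian. -/
theorem loop_trans_meridian (n : Multiplicative ℤ) :
    ((loop hR n).map (southX p q)).trans (.mk (meridian hR hR')) =
      Path.Homotopic.Quotient.trans (.mk (meridian hR hR')) ((loop hR' n⁻¹).map (northX p q)) := by
  -- Both sides lift to paths from the southern end at angle 0 to the northern end at angle `n`.
  -- Conjugation in `north` reverses angles, so the inverse loop of `q` is the one that ends at `n`.
  have h1 := mk_meridian_shift hR hR' n.toAdd
  rw [loop_map_southX hR hR' n, h1, via_trans, ← h1, mk_meridian, loop_map_northX hR hR' n⁻¹,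
    via_trans]
  congr 2
  rw [toAdd_inv, neg_neg]

theorem loop_trans_meridian_symm (n : Multiplicative ℤ) :
    ((loop hR' n).map (northX p q)).trans (Path.Homotopic.Quotient.symm (.mk (meridian hR hR'))) =
      (Path.Homotopic.Quotient.symm (.mk (meridian hR hR'))).trans
        ((loop hR n⁻¹).map (southX p q)) := by
  have h := loop_trans_meridian hR hR' n⁻¹
  rw [inv_inv] at h
  set m := Path.Homotopic.Quotient.mk (meridian hR hR')
  have h2 : (m.symm.trans (((loop hR n⁻¹).map (southX p q)).trans m)).trans m.symm =
      (m.symm.trans (m.trans ((loop hR' n).map (northX p q)))).trans m.symm := by rw [h]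
  rw [← Path.Homotopic.Quotient.trans_assoc m.symm m, Path.Homotopic.Quotient.symm_trans,
    Path.Homotopic.Quotient.refl_trans, Path.Homotopic.Quotient.trans_assoc,
    Path.Homotopic.Quotient.trans_assoc, Path.Homotopic.Quotient.trans_symm,
    Path.Homotopic.Quotient.trans_refl] at h2
  exact h2.symm

open GraphOfGroups in
theorem realize_one (v : (matingGroups hR hR').graph.Vert) :
    realize hR hR' (GPath.elt (v := v) 1) = Path.Homotopic.Quotient.refl _ := by
  obtain ⟨v, hv⟩ := v
  change Segment at v
  cases v with
  | south => rfl
  | north => rfl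
  | edge => nomatch hv
  | edgeRev => nomatch hv

open GraphOfGroups in
theorem realize_mul (v : (matingGroups hR hR').graph.Vert) (g h : (matingGroups hR hR').G v.1) :
    realize hR hR' (GPath.elt (v := v) (g * h)) =
      (realize hR hR' (GPath.elt (v := v) g)).trans (realize hR hR' (GPath.elt (v := v) h)) := by
  obtain ⟨v, hv⟩ := v
  change Segment at v
  cases v with
  | south => exact Corr.map_trans' _ _ _
  | north => exact Corr.map_trans' _ _ _
  | edge => nomatch hv
  | edgeRev => nomatch hv

open GraphOfGroups in
-- All relations are groupoid identities or functoriality, except `slide` at the edge and its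
-- reverse. There the geometry enters: the loop around the equator passes across the meridian with
-- reversed orientation.
theorem realize_rel {u v : (matingGroups hR hR').graph.Vert}
    {a b : GPath (matingGroups hR hR') u v} (h : Rel a b) :
    realize hR hR' a = realize hR hR' b := by
  induction h with
  | assoc a b c => exact Path.Homotopic.Quotient.trans_assoc _ _ _
  | @one_comp u v a =>
    exact (congrArg (fun x => Path.Homotopic.Quotient.trans x _) (realize_one hR hR' u)).trans
      (Path.Homotopic.Quotient.refl_trans _)
  | @comp_one u v a =>
    exact (congrArg (fun x => Path.Homotopic.Quotient.trans _ x) (realize_one hR hR' v)).trans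
      (Path.Homotopic.Quotient.trans_refl _)
  | @inv_comp u v a =>
    exact (Path.Homotopic.Quotient.symm_trans _).trans (realize_one hR hR' v).symm
  | @comp_inv u v a =>
    exact (Path.Homotopic.Quotient.trans_symm _).trans (realize_one hR hR' u).symm
  | comp_left b h ih => exact congrArg (fun x => Path.Homotopic.Quotient.trans x _) ih
  | comp_right a h ih => exact congrArg (fun x => Path.Homotopic.Quotient.trans _ x) ih
  | inv_congr h ih => exact congrArg Path.Homotopic.Quotient.symm ih
  | @elt_mul v g h => exact (realize_mul hR hR' v g h).symm
  | @vert v hs ht =>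
    obtain ⟨v, hv⟩ := v
    change Segment at v
    cases v with
    | south => rfl
    | north => rfl
    | edge => nomatch hv
    | edgeRev => nomatch hv
  | @edge_rev x u v hu hv hu' hv' =>
    obtain rfl : (matingGroups hR hR').graph.srcV x = u := Subtype.ext hu
    obtain rfl : (matingGroups hR hR').graph.tgtV x = v := Subtype.ext hv
    change Segment at x
    cases x
    · exact Path.Homotopic.Quotient.trans_refl _
    · exact Path.Homotopic.Quotient.trans_refl _
    · exact Path.Homotopic.Quotient.trans_symm _
    · exact Path.Homotopic.Quotient.symm_trans _
  | slide x g =>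
    change Segment at x
    cases x with
    | south =>
      exact (Path.Homotopic.Quotient.trans_refl _).trans (Path.Homotopic.Quotient.refl_trans _).symm
    | north =>
      exact (Path.Homotopic.Quotient.trans_refl _).trans (Path.Homotopic.Quotient.refl_trans _).symm
    | edge => exact loop_trans_meridian hR hR' g
    | edgeRev => exact loop_trans_meridian_symm hR hR' g

/-- The map from the fundamental groupoid of the graph of groups to that of the sphere. -/
noncomputable def realizeHom {u v : (matingGroups hR hR').graph.Vert} :
    (matingGroups hR hR').Hom u v → PathClass (matingPt hR hR' u.1) (matingPt hR hR' v.1) :=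
  Quot.lift (realize hR hR') fun _ _ h => realize_rel hR hR' h

theorem realizeHom_comp {u v w : (matingGroups hR hR').graph.Vert}
    (a : (matingGroups hR hR').Hom u v) (b : (matingGroups hR hR').Hom v w) :
    realizeHom hR hR' (a.comp b) = (realizeHom hR hR' a).trans (realizeHom hR hR' b) := by
  induction a using Quot.ind
  induction b using Quot.ind
  rfl

theorem realizeHom_inv {u v : (matingGroups hR hR').graph.Vert}
    (a : (matingGroups hR hR').Hom u v) :
    realizeHom hR hR' a.inv = (realizeHom hR hR' a).symm := by
  induction a using Quot.ind
  rfl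

theorem realizeHom_one (v : (matingGroups hR hR').graph.Vert) :
    realizeHom hR hR' (GraphOfGroups.Hom.one v) = Path.Homotopic.Quotient.refl _ :=
  realize_one hR hR' v

end Realize

open GraphOfGroups

/-! ### Fullness of the realization -/

section Surjective

variable {d : ℕ} {p q : TopologicalPolynomial d} {R R' : ℝ} (hR : p.NearInfinity R)
  (hR' : q.NearInfinity R')

/-- The two vertices. -/
def southV : (matingGroups hR hR').graph.Vert := ⟨Segment.south, rfl⟩

def northV : (matingGroups hR hR').graph.Vert := ⟨Segment.north, rfl⟩

theorem vert_cases (v : (matingGroups hR hR').graph.Vert) :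
    v = southV hR hR' ∨ v = northV hR hR' := by
  obtain ⟨v, hv⟩ := v
  change Segment at v
  cases v with
  | south => exact .inl rfl
  | north => exact .inr rfl
  | edge => nomatch hv
  | edgeRev => nomatch hv

/-- The elements of the vertex groups, and the edge, in the fundamental groupoid. -/
noncomputable def southElt (g : Pi1 (base hR)) :
    (matingGroups hR hR').Hom (southV hR hR') (southV hR hR') :=
  Hom.mk (GPath.elt (X := matingGroups hR hR') (v := southV hR hR') g)

noncomputable def northElt (g : Pi1 (base hR')) :
    (matingGroups hR hR').Hom (northV hR hR') (northV hR hR') :=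
  Hom.mk (GPath.elt (X := matingGroups hR hR') (v := northV hR hR') g)

noncomputable def edgeHom : (matingGroups hR hR').Hom (southV hR hR') (northV hR hR') :=
  Hom.mk (GPath.edge (X := matingGroups hR hR') Segment.edge (u := southV hR hR')
    (v := northV hR hR') rfl rfl)

/-- The points of the punctured sphere off the equator. -/
abbrev OffEquator (p q : TopologicalPolynomial d) : Type :=
  {z : ℂ // z ∉ p.P} ⊕ {z : ℂ // z ∉ q.P}

/-- The vertex of the hemisphere of a point. -/
def vertOf : OffEquator p q → (matingGroups hR hR').graph.Vert
  | .inl _ => southV hR hR'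
  | .inr _ => northV hR hR'

/-- The path classes in a hemisphere from the basepoint to a point. -/
def Tail : OffEquator p q → Type
  | .inl z => PathClass (base hR) z
  | .inr z => PathClass (base hR') z

/-- The image of such a path class in the sphere. -/
noncomputable def tailMap : ∀ a : OffEquator p q, Tail hR hR' a →
    PathClass (matingPt hR hR' (vertOf hR hR' a).1) (Sum.elim (southX p q) (northX p q) a)
  | .inl _ => fun α => Path.Homotopic.Quotient.map α (southX p q)
  | .inr _ => fun α => Path.Homotopic.Quotient.map α (northX p q)

open Path.Homotopic.Quotient in
-- Quantifying over the initial tail `α` makes the property stable under composition: the tail left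
-- over by one piece is the initial tail of the next. Pieces in a hemisphere are absorbed into the
-- tail; at a meridian the tail is a loop, which becomes an element of the vertex group followed by
-- the edge.
theorem exists_factorization {a b : OffEquator p q}
    (ε : PathClass (Sum.elim (southX p q) (northX p q) a) (Sum.elim (southX p q) (northX p q) b))
    (α : Tail hR hR' a) :
    ∃ (h : (matingGroups hR hR').Hom (vertOf hR hR' a) (vertOf hR hR' b)) (α' : Tail hR hR' b),
      (tailMap hR hR' a α).trans ε = (realizeHom hR hR' h).trans (tailMap hR hR' b α') := by
  refine offEquator_induction hR.pos hR'.pos (fun _ => collar_notMem hR hR') (fun _ => rfl)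
    (fun z hz hz' => hz ((south_mem_iff p q z).mpr hz')) (fun _ => rfl)
    (fun z hz hz' => hz ((north_mem_iff p q z).mpr hz'))
    (fun a b ε => ∀ α : Tail hR hR' a,
      ∃ (h : (matingGroups hR hR').Hom (vertOf hR hR' a) (vertOf hR hR' b)) (α' : Tail hR hR' b),
      (tailMap hR hR' a α).trans ε = (realizeHom hR hR' h).trans (tailMap hR hR' b α'))
    ?_ ?_ ?_ (base hR) (base hR') (southX_base hR hR') (northX_base hR hR') ?_ ?_ ε α
  · intro a b c ε ε' hε hε' α
    obtain ⟨h, α', e⟩ := hε α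
    obtain ⟨h', α'', e'⟩ := hε' α'
    refine ⟨h.comp h', α'', ?_⟩
    rw [realizeHom_comp, ← trans_assoc, e, trans_assoc, e', trans_assoc]
  · intro z z' ε α
    refine ⟨Hom.one _, Path.Homotopic.Quotient.trans (α : PathClass (base hR) z) ε, ?_⟩
    exact (Corr.map_trans' _ _ _).symm.trans ((refl_trans _).symm.trans
      (congrArg (fun x => Path.Homotopic.Quotient.trans x _)
        (realizeHom_one hR hR' (southV hR hR')).symm))
  · intro z z' ε α
    refine ⟨Hom.one _, Path.Homotopic.Quotient.trans (α : PathClass (base hR') z) ε, ?_⟩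
    exact (Corr.map_trans' _ _ _).symm.trans ((refl_trans _).symm.trans
      (congrArg (fun x => Path.Homotopic.Quotient.trans x _)
        (realizeHom_one hR hR' (northV hR hR')).symm))
  · intro α
    refine ⟨(southElt hR hR' α).comp (edgeHom hR hR'), .refl _, ?_⟩
    exact (congrArg (Path.Homotopic.Quotient.trans _) (mk_meridian hR hR').symm).trans
      ((realizeHom_comp hR hR' (southElt hR hR' α) (edgeHom hR hR')).symm.trans
        (trans_refl _).symm)
  · intro α
    refine ⟨(northElt hR hR' α).comp (edgeHom hR hR').inv, .refl _, ?_⟩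
    have e : Path.Homotopic.Quotient.symm (.mk (meridian hR hR')) = via (polarX hR hR') _ _
        (northX_base hR hR') (southX_base hR hR') := by rw [mk_meridian, via_symm]
    exact (congrArg (Path.Homotopic.Quotient.trans _) e.symm).trans
      ((realizeHom_comp hR hR' (northElt hR hR' α) (edgeHom hR hR').inv).symm.trans
        (trans_refl _).symm)

theorem exists_factor_south {u : (matingGroups hR hR').graph.Vert} {z : {z : ℂ // z ∉ p.P}}
    (δ : PathClass (matingPt hR hR' u.1) (southX p q z)) :
    ∃ (h : (matingGroups hR hR').Hom u (southV hR hR')) (α : PathClass (base hR) z),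
      δ = (realizeHom hR hR' h).trans (α.map (southX p q)) := by
  rcases vert_cases hR hR' u with rfl | rfl
  · obtain ⟨h, α, e⟩ := exists_factorization hR hR' (a := .inl (base hR)) (b := .inl z) δ
      (Path.Homotopic.Quotient.refl (base hR))
    exact ⟨h, α, (Path.Homotopic.Quotient.refl_trans δ).symm.trans e⟩
  · obtain ⟨h, α, e⟩ := exists_factorization hR hR' (a := .inr (base hR')) (b := .inl z) δ
      (Path.Homotopic.Quotient.refl (base hR'))
    exact ⟨h, α, (Path.Homotopic.Quotient.refl_trans δ).symm.trans e⟩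

theorem exists_factor_north {u : (matingGroups hR hR').graph.Vert} {z : {z : ℂ // z ∉ q.P}}
    (δ : PathClass (matingPt hR hR' u.1) (northX p q z)) :
    ∃ (h : (matingGroups hR hR').Hom u (northV hR hR')) (α : PathClass (base hR') z),
      δ = (realizeHom hR hR' h).trans (α.map (northX p q)) := by
  rcases vert_cases hR hR' u with rfl | rfl
  · obtain ⟨h, α, e⟩ := exists_factorization hR hR' (a := .inl (base hR)) (b := .inr z) δ
      (Path.Homotopic.Quotient.refl (base hR))
    exact ⟨h, α, (Path.Homotopic.Quotient.refl_trans δ).symm.trans e⟩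
  · obtain ⟨h, α, e⟩ := exists_factorization hR hR' (a := .inr (base hR')) (b := .inr z) δ
      (Path.Homotopic.Quotient.refl (base hR'))
    exact ⟨h, α, (Path.Homotopic.Quotient.refl_trans δ).symm.trans e⟩

theorem realizeHom_surjective (u v : (matingGroups hR hR').graph.Vert) :
    Function.Surjective (realizeHom hR hR' (u := u) (v := v)) := by
  intro δ
  rcases vert_cases hR hR' v with rfl | rfl
  · obtain ⟨h, α, e⟩ := exists_factor_south hR hR' (z := base hR) δ
    exact ⟨h.comp (southElt hR hR' α), by rw [realizeHom_comp]; exact e.symm⟩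
  · obtain ⟨h, α, e⟩ := exists_factor_north hR hR' (z := base hR') δ
    exact ⟨h.comp (northElt hR hR' α), by rw [realizeHom_comp]; exact e.symm⟩

end Surjective

/-! ### Retractions of fundamental groupoids onto fundamental groups -/

section Retraction

variable {A : Type} [TopologicalSpace A] {a₀ : A}

open Path.Homotopic.Quotient

open Classical in
/-- The retraction of the fundamental groupoid onto the fundamental group at `a₀` given by paths
from `a₀` to the points of its component; it is trivial on the other components. -/
noncomputable def retract (T : ∀ a, Nonempty (PathClass a₀ a) → PathClass a₀ a) {a b : A}
    (c : PathClass a b) : Pi1 a₀ :=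
  if h : Nonempty (PathClass a₀ a) then
    ((T a h).trans c).trans (T b ⟨h.some.trans c⟩).symm
  else (1 : Pi1 a₀)

variable {T : ∀ a, Nonempty (PathClass a₀ a) → PathClass a₀ a}

theorem retract_of_nonempty {a b : A} (h : Nonempty (PathClass a₀ a))
    (h' : Nonempty (PathClass a₀ b)) (c : PathClass a b) :
    retract T c = ((T a h).trans c).trans (T b h').symm := dif_pos h

theorem retract_of_isEmpty {a b : A} (h : ¬ Nonempty (PathClass a₀ a)) (c : PathClass a b) :
    retract T c = (1 : Pi1 a₀) := dif_neg h

theorem retract_trans {a b c : A} (x : PathClass a b) (y : PathClass b c) :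
    retract T (x.trans y) = retract T x * retract T y := by
  by_cases h : Nonempty (PathClass a₀ a)
  · have hb : Nonempty (PathClass a₀ b) := ⟨h.some.trans x⟩
    have hc : Nonempty (PathClass a₀ c) := ⟨hb.some.trans y⟩
    rw [retract_of_nonempty h hc, retract_of_nonempty h hb, retract_of_nonempty hb hc]
    change _ = (((T a h).trans x).trans (T b hb).symm).trans (((T b hb).trans y).trans (T c hc).symm)
    rw [trans_assoc ((T a h).trans x), trans_assoc (T b hb), ← trans_assoc (T b hb).symm,
      symm_trans, refl_trans, ← trans_assoc (T a h) x, trans_assoc]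
  · have hb : ¬ Nonempty (PathClass a₀ b) := fun h' => h ⟨h'.some.trans x.symm⟩
    rw [retract_of_isEmpty h, retract_of_isEmpty h, retract_of_isEmpty hb, mul_one]

theorem retract_self (hT : ∀ h, T a₀ h = Path.Homotopic.Quotient.refl a₀) (c : PathClass a₀ a₀) :
    retract T c = c := by
  have h : Nonempty (PathClass a₀ a₀) := ⟨c⟩
  rw [retract_of_nonempty h h, hT, refl_trans]
  exact trans_refl c

end Retraction

/-! ### Values of paths inside a member of a cover -/

section PushVal

variable {Y A G : Type} [TopologicalSpace Y] [TopologicalSpace A] {U : Set Y}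

/-- A path inside `U`, as a path in the subspace. -/
def restrictPath {x y : Y} (γ : Path x y) (h : ∀ t, γ t ∈ U) :
    Path (⟨x, γ.source ▸ h 0⟩ : U) ⟨y, γ.target ▸ h 1⟩ where
  toFun t := ⟨γ t, h t⟩
  continuous_toFun := γ.continuous.subtype_mk _
  source' := Subtype.ext γ.source
  target' := Subtype.ext γ.target

/-- The value on a path in `U` of a function on path classes of `A`, for a map `U → A`. -/
def pushVal (j : C(U, A)) (v : ∀ a b : A, PathClass a b → G) {x y : Y} (γ : Path x y)
    (h : ∀ t, γ t ∈ U) : G :=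
  v _ _ (Path.Homotopic.Quotient.mk ((restrictPath γ h).map j.continuous))

theorem pushVal_homotopy (j : C(U, A)) (v : ∀ a b : A, PathClass a b → G) {x y : Y}
    {γ γ' : Path x y} (F : γ.Homotopy γ') (hF : ∀ s, F s ∈ U) (h : ∀ t, γ t ∈ U)
    (h' : ∀ t, γ' t ∈ U) : pushVal j v γ h = pushVal j v γ' h' := by
  refine congrArg (v _ _) (Path.Homotopic.Quotient.eq.mpr (Path.Homotopic.map ⟨?_⟩ j))
  exact
    { toFun := fun s => ⟨F s, hF s⟩
      continuous_toFun := F.continuous.subtype_mk _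
      map_zero_left := fun t => Subtype.ext (F.apply_zero t)
      map_one_left := fun t => Subtype.ext (F.apply_one t)
      prop' := fun t x hx => Subtype.ext (F.eq_fst t hx) }

theorem pushVal_trans [Group G] (j : C(U, A)) (v : ∀ a b : A, PathClass a b → G)
    (hv : ∀ {a b c} (x : PathClass a b) (y : PathClass b c),
      v _ _ (x.trans y) = v _ _ x * v _ _ y) {x y z : Y}
    (γ : Path x y) (γ' : Path y z) (h : ∀ t, γ t ∈ U) (h' : ∀ t, γ' t ∈ U)
    (h'' : ∀ t, γ.trans γ' t ∈ U) :
    pushVal j v (γ.trans γ') h'' = pushVal j v γ h * pushVal j v γ' h' := by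
  rw [pushVal, pushVal, pushVal, ← hv, ← Path.Homotopic.Quotient.mk_trans, ← Path.map_trans]
  refine path_fun_congr (fun a b γ => v a b (Path.Homotopic.Quotient.mk γ)) _ _ fun t => ?_
  simp only [Path.map_coe, Function.comp]
  congr 1
  refine Subtype.ext ?_
  change γ.trans γ' t = _
  rw [Path.trans_apply, Path.trans_apply]
  split_ifs <;> rfl

theorem pushVal_eq (j : C(U, A)) (v : ∀ a b : A, PathClass a b → G) {x y : Y} (γ : Path x y)
    (h : ∀ t, γ t ∈ U) {a b : A} (δ : Path a b) (hδ : ∀ t, j ⟨γ t, h t⟩ = δ t) :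
    pushVal j v γ h = v _ _ (Path.Homotopic.Quotient.mk δ) :=
  path_fun_congr (fun a b γ => v a b (Path.Homotopic.Quotient.mk γ)) _ _ hδ

end PushVal

/-! ### Trees near infinity -/

section Tree

variable {d : ℕ} {p : TopologicalPolynomial d} {R : ℝ} (hR : p.NearInfinity R)

/-- The universal cover of a neighbourhood of infinity: pairs (angle, radius). -/
def Annulus (R : ℝ) : Type := {a : ℝ × ℝ // R ≤ a.2}

instance : TopologicalSpace (Annulus R) := inferInstanceAs (TopologicalSpace (Subtype _))

theorem convex_annulus (R : ℝ) : Convex ℝ {a : ℝ × ℝ | R ≤ a.2} :=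
  (convex_Ici R).linear_preimage (LinearMap.snd ℝ ℝ ℝ)

instance : SimplyConnectedSpace (Annulus R) :=
  haveI := (convex_annulus R).contractibleSpace ⟨(0, R), by simp⟩
  inferInstanceAs (SimplyConnectedSpace {a : ℝ × ℝ | R ≤ a.2})

/-- The point of given angle on the inner circle. -/
def Annulus.inner (R x : ℝ) : Annulus R := ⟨(x, R), le_refl R⟩

/-- Translation of the angle by an integer. -/
def Annulus.shift (n : ℤ) : C(Annulus R, Annulus R) where
  toFun a := ⟨(a.1.1 + n, a.1.2), a.2⟩
  continuous_toFun := by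
    refine Continuous.subtype_mk (Continuous.prodMk ?_ ?_) _
    · exact (continuous_fst.comp continuous_subtype_val).add continuous_const
    · exact continuous_snd.comp continuous_subtype_val

/-- The covering of a neighbourhood of infinity. -/
noncomputable def annulusMap : C(Annulus R, {z : ℂ // z ∉ p.P}) where
  toFun a := ⟨circlePt a.1.2 a.1.1,
    hR.notMem ((norm_circlePt (hR.pos.trans_le a.2) _).ge.trans' a.2)⟩
  continuous_toFun := by
    refine Continuous.subtype_mk ?_ _
    have h1 : Continuous fun a : Annulus R => a.1.1 := continuous_fst.comp continuous_subtype_val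
    have h2 : Continuous fun a : Annulus R => a.1.2 := continuous_snd.comp continuous_subtype_val
    unfold circlePt
    fun_prop

theorem annulusMap_shift (n : ℤ) (a : Annulus R) :
    annulusMap hR (a.shift n) = annulusMap hR a := Subtype.ext (circlePt_add_int _ _ n)

/-- A choice of the angle of every complex number. -/
structure IsAngle (ang : ℂ → ℝ) : Prop where
  circlePt_eq : ∀ z : ℂ, z ≠ 0 → circlePt ‖z‖ (ang z) = z
  ofReal : ∀ x : ℝ, 0 < x → ang x = 0
  scale : ∀ ρ x : ℝ, 0 < ρ → ang (circlePt ρ x) = ang (circlePt 1 x)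

variable {ang : ℂ → ℝ}

open Classical in
/-- Paths from the basepoint to the points of its component: near infinity, an arc followed by a
radial segment. -/
noncomputable def tree (hang : IsAngle ang) (z : {z : ℂ // z ∉ p.P})
    (h : Nonempty (PathClass (base hR) z)) : PathClass (base hR) z :=
  if hz : R ≤ ‖z.1‖ then
    via (annulusMap hR) (Annulus.inner R 0) ⟨(ang z, ‖z.1‖), hz⟩
      (Subtype.ext (by simp [annulusMap, Annulus.inner, circlePt, base]))
      (Subtype.ext (hang.circlePt_eq _ (norm_pos_iff.mp (hR.pos.trans_le hz))).symm)
  else h.some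

/-- Positive numbers have angle 0, so the tree path to the basepoint is constant. Hence `retract` is
the identity on the fundamental group. -/
theorem tree_base (hang : IsAngle ang) (h : Nonempty (PathClass (base hR) (base hR))) :
    tree hR hang (base hR) h = Path.Homotopic.Quotient.refl _ := by
  have hn : ‖(base hR).1‖ = R := by simp [base, abs_of_pos hR.pos]
  rw [tree, dif_pos hn.ge]
  have e : (⟨(ang (base hR).1, ‖(base hR).1‖), hn.ge⟩ : Annulus R) = (Annulus.inner R 0) :=
    Subtype.ext (Prod.ext (hang.ofReal R hR.pos) hn)
  refine Eq.trans ?_ (via_self (annulusMap hR) (Annulus.inner R 0)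
    (Subtype.ext (by simp [annulusMap, Annulus.inner, circlePt, base]))
    (Subtype.ext (by simp [annulusMap, Annulus.inner, circlePt, base])))
  congr 1

/-- The tree paths are lifted so that they end at `a` and `b`; they then start on the inner circle
at integer angles `k` and `m`. The retraction is the loop covered by a path from `k` to `m`, and `m
- k = n` is the change of angle corrected by the chosen angles of the ends. -/
theorem retract_via (hang : IsAngle ang) (a b : Annulus R) {x y : {z : ℂ // z ∉ p.P}}
    (hx : x = annulusMap hR a) (hy : y = annulusMap hR b) (n : ℤ)
    (hn : b.1.1 - a.1.1 = ang (circlePt 1 b.1.1) - ang (circlePt 1 a.1.1) + n) :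
    retract (tree hR hang) (via (annulusMap hR) a b hx hy) = loop hR (Multiplicative.ofAdd n) := by
  have hbase (m : ℤ) : base hR = annulusMap hR (Annulus.inner R m) :=
    Subtype.ext (circlePt_int R m).symm
  -- The standard lift of the tree path ends at the chosen angle of `x`. Translation by the integer
  -- `m` makes it end at the given lift `a`, and start at angle `m`.
  have hlift {x : {z : ℂ // z ∉ p.P}} (a : Annulus R) (hx : x = annulusMap hR a) :
      ∃ m : ℤ, a.1.1 = ang (circlePt 1 a.1.1) + m ∧ ∃ h, ∀ h',
        tree hR hang x h' = via (annulusMap hR) (Annulus.inner R m) a h hx := by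
    have ha := hR.pos.trans_le a.2
    have hnorm : ‖x.1‖ = a.1.2 := by rw [hx]; exact norm_circlePt ha _
    have e1 := hang.circlePt_eq (circlePt 1 a.1.1) (circlePt_ne_zero one_pos _)
    rw [norm_circlePt one_pos] at e1
    obtain ⟨m, hm⟩ := circlePt_eq_iff.mp e1.symm
    refine ⟨m, hm, hbase m, fun h' => ?_⟩
    have hz : R ≤ ‖x.1‖ := hnorm ▸ a.2
    rw [tree, dif_pos hz]
    have hangx : ang x.1 = ang (circlePt 1 a.1.1) := by rw [hx]; exact hang.scale _ _ ha
    have e0 : Annulus.shift m (Annulus.inner R 0) = (Annulus.inner R m) :=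
      Subtype.ext (Prod.ext (zero_add _) rfl)
    have e2 : Annulus.shift m (⟨(ang x, ‖x.1‖), hz⟩ : Annulus R) = a :=
      Subtype.ext (Prod.ext ((congrArg (· + (m : ℝ)) hangx).trans hm.symm) hnorm)
    rw [← via_comp (annulusMap hR) (annulusMap hR) (Annulus.shift m) (annulusMap_shift hR m) _ _
      ((hbase m).trans (congrArg _ e0.symm)) (hx.trans (congrArg _ e2.symm))]
    congr 1
  obtain ⟨k, hk, hk', hka⟩ := hlift a hx
  obtain ⟨m, hm, hm', hmb⟩ := hlift b hy
  have h1 : Nonempty (PathClass (base hR) x) := ⟨via (annulusMap hR) _ a hk' hx⟩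
  have h2 : Nonempty (PathClass (base hR) y) := ⟨via (annulusMap hR) _ b hm' hy⟩
  rw [retract_of_nonempty h1 h2, hka, hmb, via_trans, via_symm, via_trans]
  have hnm : m = n + k := by
    have : (m : ℝ) = n + k := by linarith
    exact_mod_cast this
  have e0 : Annulus.shift k (Annulus.inner R 0) = (Annulus.inner R k) :=
    Subtype.ext (Prod.ext (zero_add _) rfl)
  have e1 : Annulus.shift k (Annulus.inner R n) = (Annulus.inner R m) :=
    Subtype.ext (Prod.ext (by rw [hnm]; push_cast; rfl) rfl)
  have h0 : base hR = annulusMap hR (Annulus.inner R 0) := by simpa using hbase 0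
  refine Eq.trans (b := via (annulusMap hR) (Annulus.inner R 0) (Annulus.inner R n) h0 (hbase n)) ?_ ?_
  · rw [← via_comp (annulusMap hR) (annulusMap hR) (Annulus.shift k) (annulusMap_shift hR k) _ _
      (hk'.trans (congrArg _ e0.symm)) (hm'.trans (congrArg _ e1.symm))]
    congr 1
    · exact e0.symm
    · exact e1.symm
  · refine (mk_eq_via _ _ _ _ (((seg 0 (n : ℝ)).map (f := fun x => (Annulus.inner R x))
      (Continuous.subtype_mk (continuous_id.prodMk continuous_const) _))) fun t => ?_).symm
    rfl

/-- The angle in `(-1/2, 1/2]`. -/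
noncomputable def angle (z : ℂ) : ℝ := z.arg / (2 * Real.pi)

/-- The angle in `[-1/2, 1/2)`. -/
noncomputable def conjAngle (z : ℂ) : ℝ := -angle ((starRingEnd ℂ) z)

theorem isAngle_angle : IsAngle angle where
  circlePt_eq z _ := by
    rw [TopologicalPolynomial.circlePt_eq, angle, mul_div_cancel₀ _ (by positivity),
      Complex.norm_mul_exp_arg_mul_I]
  ofReal x hx := by rw [angle, Complex.arg_ofReal_of_nonneg hx.le, zero_div]
  scale ρ x hρ := by rw [angle, angle, circlePt_eq_mul ρ, Complex.arg_real_mul _ hρ]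

/-- The angle `x` on the sphere is `-x` in the plane of `q`. With this mirror-image choice the angle
there is exactly the negative of `angle`, even on the negative axis where `arg` is discontinuous, so
the integers computed from the two planes are opposite without correction. -/
theorem isAngle_conjAngle : IsAngle conjAngle where
  circlePt_eq z hz := by
    rw [conjAngle, circlePt_neg, ← RCLike.norm_conj,
      isAngle_angle.circlePt_eq _ (by simpa using hz), Complex.conj_conj]
  ofReal x hx := by rw [conjAngle, Complex.conj_ofReal, isAngle_angle.ofReal x hx, neg_zero]
  scale ρ x hρ := by
    rw [conjAngle, conjAngle, ← circlePt_neg, ← circlePt_neg, isAngle_angle.scale _ _ hρ]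

end Tree

/-! ### Gluing functors along a cover -/

section Glue

variable {ι Y G : Type*} [TopologicalSpace Y] [Group G]

open Classical in
/-- Functors to a group on the paths inside the members of a cover, which agree on the overlaps,
extend to the fundamental groupoid. -/
theorem exists_extension_of_compatible {U : ι → Set Y} (cover : ∀ y, ∃ i, U i ∈ 𝓝 y)
    (val : ∀ i {x y : Y} (γ : Path x y), (∀ t, γ t ∈ U i) → G)
    (homotopy : ∀ i {x y : Y} (γ γ' : Path x y) (F : γ.Homotopy γ'), (∀ s, F s ∈ U i) → ∀ h h',
      val i γ h = val i γ' h')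
    (trans : ∀ i {x y z : Y} (γ : Path x y) (γ' : Path y z) (h h' h''),
      val i (γ.trans γ') h'' = val i γ h * val i γ' h')
    (agree : ∀ i j {x y : Y} (γ : Path x y) (h h'), val i γ h = val j γ h') :
    ∃ Ψ : ∀ x y : Y, Path.Homotopic.Quotient x y → G,
      (∀ {x y z : Y} (a : Path.Homotopic.Quotient x y) (b : Path.Homotopic.Quotient y z),
        Ψ _ _ (a.trans b) = Ψ _ _ a * Ψ _ _ b) ∧
      ∀ i {x y : Y} (γ : Path x y) (h : ∀ t, γ t ∈ U i),
        Ψ _ _ (Path.Homotopic.Quotient.mk γ) = val i γ h := by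
  -- A local functor is a total function on paths. The value 1 on paths outside all members is never
  -- used, and the choice of a member does not matter by `agree`.
  let φ (x y : Y) (γ : Path x y) : G :=
    if h : ∃ i, ∀ t, γ t ∈ U i then val h.choose γ h.choose_spec else 1
  have hφ (i) {x y : Y} (γ : Path x y) (h : ∀ t, γ t ∈ U i) : φ x y γ = val i γ h :=
    (dif_pos ⟨i, h⟩).trans (agree _ _ _ _ _)
  have hlocal : IsLocalFunctor U φ := by
    refine ⟨cover, fun i x y γ γ' F hF => ?_, fun i x y z γ γ' h h' => ?_⟩
    · have h (t) : γ t ∈ U i := by simpa using hF (0, t)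
      have h' (t) : γ' t ∈ U i := by simpa using hF (1, t)
      rw [hφ i γ h, hφ i γ' h']
      exact homotopy i γ γ' F hF h h'
    · have h'' (t) : γ.trans γ' t ∈ U i := by
        rw [Path.trans_apply]
        split_ifs
        exacts [h _, h' _]
      rw [hφ i _ h, hφ i _ h', hφ i _ h'']
      exact trans i γ γ' h h' h''
  obtain ⟨Ψ, h1, h2⟩ := hlocal.exists_extension
  exact ⟨Ψ, h1, fun i x y γ h => (h2 i γ h).trans (hφ i γ h)⟩

end Glue

/-! ### Paths near infinity in polar coordinates -/

section Angle

variable {d : ℕ} {p : TopologicalPolynomial d} {R : ℝ} (hR : p.NearInfinity R) {ang : ℂ → ℝ}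

theorem IsAngle.exists_sub (hang : IsAngle ang) (x y : ℝ) :
    ∃ n : ℤ, y - x = ang (circlePt 1 y) - ang (circlePt 1 x) + n := by
  have h (x : ℝ) : ∃ m : ℤ, x = ang (circlePt 1 x) + m := by
    have e1 := hang.circlePt_eq (circlePt 1 x) (circlePt_ne_zero one_pos _)
    rw [norm_circlePt one_pos] at e1
    exact circlePt_eq_iff.mp e1.symm
  obtain ⟨m, hm⟩ := h x
  obtain ⟨n, hn⟩ := h y
  exact ⟨n - m, by push_cast; linarith⟩

/-- The retraction of a path given in polar coordinates near infinity. -/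
theorem retract_mk_polar (hang : IsAngle ang) {x y : {z : ℂ // z ∉ p.P}} (γ : Path x y)
    {θ ρ : unitInterval → ℝ} (hθ : Continuous θ) (hρ : Continuous ρ) (hRρ : ∀ t, R ≤ ρ t)
    (hγ : ∀ t, (γ t).1 = circlePt (ρ t) (θ t)) (n : ℤ)
    (hn : θ 1 - θ 0 = ang (circlePt 1 (θ 1)) - ang (circlePt 1 (θ 0)) + n) :
    retract (tree hR hang) (Path.Homotopic.Quotient.mk γ) = loop hR (Multiplicative.ofAdd n) := by
  let f (t : unitInterval) : Annulus R := ⟨(θ t, ρ t), hRρ t⟩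
  have hf : Continuous f := (hθ.prodMk hρ).subtype_mk _
  have h (t) : γ t = annulusMap hR (f t) := Subtype.ext (hγ t)
  have hx : x = annulusMap hR (f 0) := by simpa using h 0
  have hy : y = annulusMap hR (f 1) := by simpa using h 1
  rw [mk_eq_via (annulusMap hR) hx hy γ ⟨⟨f, hf⟩, rfl, rfl⟩ h]
  exact retract_via hR hang (f 0) (f 1) hx hy n hn

end Angle

/-! ### Faithfulness of the realization -/

section Injective

variable {d : ℕ} {p q : TopologicalPolynomial d} {R R' : ℝ} (hR : p.NearInfinity R)
  (hR' : q.NearInfinity R')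

theorem Hom.comp_inv {X : GraphOfGroups} {u v : X.graph.Vert} (a : X.Hom u v) :
    Hom.comp a (Hom.inv a) = Hom.one u := by
  induction a using Quot.ind
  exact Quot.sound (Rel.comp_inv _)

theorem Hom.comp_left_injective {X : GraphOfGroups} {u v w : X.graph.Vert} (a : X.Hom u v) :
    Function.Injective (Hom.comp (w := w) a) := fun b c h => by
  have := congrArg (Hom.comp a.inv) h
  simpa only [← Hom.assoc, Hom.inv_comp, Hom.one_comp] using this

/-- Here `c`, `c'`, `c''` are reference paths from the vertex `s`, and `c a = x c'` says that `a` is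
retracted to `x`. Such equations are stable under composition and, by `Hom.comp_inv_eq`, under
inversion, as needed for an induction on formal paths. -/
theorem Hom.comp_comp_eq {X : GraphOfGroups} {u v w s : X.graph.Vert} {a : X.Hom u v}
    {b : X.Hom v w} {c : X.Hom s u} {c' : X.Hom s v} {c'' : X.Hom s w} {x y : X.Hom s s}
    (ha : Hom.comp c a = Hom.comp x c') (hb : Hom.comp c' b = Hom.comp y c'') :
    Hom.comp c (Hom.comp a b) = Hom.comp (Hom.comp x y) c'' := by
  rw [← Hom.assoc, ha, Hom.assoc, hb, Hom.assoc]

theorem Hom.comp_inv_eq {X : GraphOfGroups} {u v s : X.graph.Vert} {a : X.Hom u v}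
    {c : X.Hom s u} {c' : X.Hom s v} {x : X.Hom s s} (h : Hom.comp c a = Hom.comp x c') :
    Hom.comp c' (Hom.inv a) = Hom.comp (Hom.inv x) c := by
  have h' := congrArg (fun y => Hom.comp (Hom.inv x) (Hom.comp y (Hom.inv a))) h
  simp only [Hom.assoc, Hom.comp_inv, Hom.comp_one] at h'
  rw [← Hom.assoc (Hom.inv x), Hom.inv_comp, Hom.one_comp] at h'
  exact h'.symm

/-- The homomorphisms of the vertex groups to the fundamental group at the southern vertex. -/
noncomputable def southGroupHom : Pi1 (base hR) →* (matingGroups hR hR').FundGroup (southV hR hR') :=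
  MonoidHom.mk' (southElt hR hR') fun g h => (Quot.sound (Rel.elt_mul (X := matingGroups hR hR')
    (v := southV hR hR') g h)).symm

theorem northElt_mul (g h : Pi1 (base hR')) : northElt hR hR' (g * h) =
    (northElt hR hR' g).comp (northElt hR hR' h) :=
  (Quot.sound (Rel.elt_mul (X := matingGroups hR hR') (v := northV hR hR') g h)).symm

noncomputable def northGroupHom :
    Pi1 (base hR') →* (matingGroups hR hR').FundGroup (southV hR hR') :=
  MonoidHom.mk' (fun g => ((edgeHom hR hR').comp (northElt hR hR' g)).comp (edgeHom hR hR').inv)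
    fun g h => by
      change _ = Hom.comp _ _
      rw [northElt_mul]
      simp only [Hom.assoc]
      rw [← Hom.assoc (Hom.inv _), Hom.inv_comp, Hom.one_comp]

theorem northGroupHom_comp (g : Pi1 (base hR')) :
    Hom.comp (northGroupHom hR hR' g) (edgeHom hR hR') =
      (edgeHom hR hR').comp (northElt hR hR' g) := by
  refine (Hom.assoc ((edgeHom hR hR').comp (northElt hR hR' g)) (edgeHom hR hR').inv
    (edgeHom hR hR')).trans ?_
  rw [Hom.inv_comp, Hom.comp_one]

theorem southElt_loop (n : Multiplicative ℤ) :
    (southElt hR hR' (loop hR n)).comp (edgeHom hR hR') =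
      (edgeHom hR hR').comp (northElt hR hR' (loop hR' n⁻¹)) :=
  Quot.sound (Rel.slide (X := matingGroups hR hR') Segment.edge n)

/-- The slide relation, conjugated by the edge into the group at the southern vertex. It reconciles
the values of the two hemispheres on the collar. -/
theorem southGroupHom_loop (n : Multiplicative ℤ) :
    southGroupHom hR hR' (loop hR n) = northGroupHom hR hR' (loop hR' n⁻¹) := by
  have h : southElt hR hR' (loop hR n) = ((edgeHom hR hR').comp
      (northElt hR hR' (loop hR' n⁻¹))).comp (edgeHom hR hR').inv := by
    rw [← southElt_loop, Hom.assoc, Hom.comp_inv, Hom.comp_one]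
  exact h

variable (p q R R') in
/-- The members of the cover of the punctured sphere. -/
def chartSet (i : Chart) : Set {s : Sphere // s ∉ matingP p q} :=
  {y | y.1 ∈ Chart.domain R R' i}

theorem chartSet_cover (y : {s : Sphere // s ∉ matingP p q}) :
    ∃ i, chartSet p q R R' i ∈ 𝓝 y := by
  obtain ⟨i, hi⟩ := Chart.exists_domain_mem_nhds R R' y.1
  exact ⟨i, continuous_subtype_val.continuousAt hi⟩

/-- The projections of the hemispheres to the planes. -/
noncomputable def southChart : C(chartSet p q R R' .south, {z : ℂ // z ∉ p.P}) where
  toFun y := ⟨y.1.1.1.1 / ((-y.1.1.1.2 : ℝ) : ℂ), fun h => y.1.2 (by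
    rw [← south_of_neg y.2]
    exact .inl ⟨_, h, rfl⟩)⟩
  continuous_toFun := by
    refine Continuous.subtype_mk (Continuous.div (by fun_prop) (by fun_prop) fun y => ?_) _
    exact Complex.ofReal_ne_zero.mpr (neg_ne_zero.mpr (ne_of_lt y.2))

noncomputable def northChart : C(chartSet p q R R' .north, {z : ℂ // z ∉ q.P}) where
  toFun y := ⟨(starRingEnd ℂ) y.1.1.1.1 / ((y.1.1.1.2 : ℝ) : ℂ), fun h => y.1.2 (by
    rw [← north_of_pos y.2]
    exact .inr ⟨_, h, rfl⟩)⟩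
  continuous_toFun := by
    refine Continuous.subtype_mk (Continuous.div (Complex.continuous_conj.comp (by fun_prop))
      (by fun_prop) fun y => ?_) _
    exact Complex.ofReal_ne_zero.mpr (ne_of_gt y.2)

theorem south_southChart (y : chartSet p q R R' .south) : south (southChart y).1 = y.1.1 :=
  south_of_neg y.2

theorem north_northChart (y : chartSet p q R R' .north) : north (northChart y).1 = y.1.1 :=
  north_of_pos y.2

include hR hR' in
theorem chartSet_collar_ne_zero (y : chartSet p q R R' .collar) : y.1.1.1.1 ≠ 0 :=
  InCollar.ne_zero hR.pos hR'.pos y.2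

/-- The radial projection of the collar to the circle of radius `R`. -/
noncomputable def collarChart : C(chartSet p q R R' .collar, {z : ℂ // z ∉ p.P}) where
  toFun y := ⟨R * (y.1.1.1.1 / (‖y.1.1.1.1‖ : ℂ)), hR.notMem (by
    have := chartSet_collar_ne_zero hR hR' y
    rw [norm_mul, norm_div, Complex.norm_real, Complex.norm_real, norm_norm,
      div_self (norm_ne_zero_iff.mpr this), mul_one]
    exact Real.le_norm_self R)⟩
  continuous_toFun := by
    refine Continuous.subtype_mk (continuous_const.mul (Continuous.div (by fun_prop)
      (by fun_prop) fun y => ?_)) _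
    exact Complex.ofReal_ne_zero.mpr (norm_ne_zero_iff.mpr (chartSet_collar_ne_zero hR hR' y))

noncomputable def southVal (a b : {z : ℂ // z ∉ p.P}) (c : PathClass a b) :
    (matingGroups hR hR').FundGroup (southV hR hR') :=
  southGroupHom hR hR' (retract (tree hR isAngle_angle) c)

noncomputable def northVal (a b : {z : ℂ // z ∉ q.P}) (c : PathClass a b) :
    (matingGroups hR hR').FundGroup (southV hR hR') :=
  northGroupHom hR hR' (retract (tree hR' isAngle_conjAngle) c)

/-- The value of a path in a member of the cover in the fundamental group of the graph of groups. -/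
noncomputable def chartVal : ∀ (i : Chart) {x y : {s : Sphere // s ∉ matingP p q}} (γ : Path x y),
    (∀ t, γ t ∈ chartSet p q R R' i) → (matingGroups hR hR').FundGroup (southV hR hR')
  | .south, _, _, γ, h => pushVal southChart (southVal hR hR') γ h
  | .north, _, _, γ, h => pushVal northChart (northVal hR hR') γ h
  | .collar, _, _, γ, h => pushVal (collarChart hR hR') (southVal hR hR') γ h

/-- The value of a path in the collar, from its lift to the universal cover. -/
theorem chartVal_collar {x y : {s : Sphere // s ∉ matingP p q}} (γ : Path x y)
    (h : ∀ t, γ t ∈ chartSet p q R R' .collar) {a b : Collar R R'} (δ : Path a b)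
    (hδ : ∀ t, γ t = polarX hR hR' (δ t)) (n : ℤ)
    (hn : b.1.1 - a.1.1 = angle (circlePt 1 b.1.1) - angle (circlePt 1 a.1.1) + n) :
    chartVal hR hR' .collar γ h = southGroupHom hR hR' (loop hR (Multiplicative.ofAdd n)) := by
  refine congrArg (southGroupHom hR hR') (retract_mk_polar hR isAngle_angle _
    (θ := fun t => (δ t).1.1) (ρ := fun _ => R) ?_ continuous_const (fun _ => le_rfl) (fun t => ?_)
    n ?_)
  · exact continuous_fst.comp (continuous_subtype_val.comp δ.continuous)
  · rw [circlePt_eq_mul, (polar_div (a := δ t) (congrArg Subtype.val (hδ t)).symm).1]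
    rfl
  · simpa using hn

/-- A slope `σ < 0` in the strip corresponds to the radius `(-σ)⁻¹ ≥ R` in the plane. The path is
thus near infinity for `p`, and its value depends only on angles, as for the collar. -/
theorem chartVal_south {x y : {s : Sphere // s ∉ matingP p q}} (γ : Path x y)
    (h : ∀ t, γ t ∈ chartSet p q R R' .south) {a b : Collar R R'} (δ : Path a b)
    (hδ : ∀ t, γ t = polarX hR hR' (δ t)) (n : ℤ)
    (hn : b.1.1 - a.1.1 = angle (circlePt 1 b.1.1) - angle (circlePt 1 a.1.1) + n) :
    chartVal hR hR' .south γ h = southGroupHom hR hR' (loop hR (Multiplicative.ofAdd n)) := by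
  have hneg (t) : (δ t).1.2 < 0 := (polar_snd_neg (δ t)).mp (by
    have := h t
    rw [hδ t] at this
    exact this)
  refine congrArg (southGroupHom hR hR') (retract_mk_polar hR isAngle_angle _
    (θ := fun t => (δ t).1.1) (ρ := fun t => (-(δ t).1.2)⁻¹) ?_ ?_ (fun t => ?_) (fun t => ?_)
    n ?_)
  · exact continuous_fst.comp (continuous_subtype_val.comp δ.continuous)
  · exact (continuous_snd.comp (continuous_subtype_val.comp δ.continuous)).neg.inv₀
      fun t => (neg_pos.mpr (hneg t)).ne'
  · rw [le_inv_comm₀ hR.pos (neg_pos.mpr (hneg t)), ← one_div, le_div_iff₀ hR.pos]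
    linarith [(δ t).2.1]
  · refine south_injective ((south_southChart ⟨γ t, h t⟩).trans ?_)
    rw [← polar_south (hneg t)]
    exact congrArg Subtype.val (hδ t)
  · simpa using hn

/-- As in the south, with angles reversed by the conjugation in `north`, and hence with `-n` in
place of `n`. -/
theorem chartVal_north {x y : {s : Sphere // s ∉ matingP p q}} (γ : Path x y)
    (h : ∀ t, γ t ∈ chartSet p q R R' .north) {a b : Collar R R'} (δ : Path a b)
    (hδ : ∀ t, γ t = polarX hR hR' (δ t)) (n : ℤ)
    (hn : b.1.1 - a.1.1 = angle (circlePt 1 b.1.1) - angle (circlePt 1 a.1.1) + n) :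
    chartVal hR hR' .north γ h = northGroupHom hR hR' (loop hR' (Multiplicative.ofAdd (-n))) := by
  have hpos (t) : 0 < (δ t).1.2 := (polar_snd_pos (δ t)).mp (by
    have := h t
    rw [hδ t] at this
    exact this)
  refine congrArg (northGroupHom hR hR') (retract_mk_polar hR' isAngle_conjAngle _
    (θ := fun t => -(δ t).1.1) (ρ := fun t => ((δ t).1.2)⁻¹) ?_ ?_ (fun t => ?_) (fun t => ?_)
    (-n) ?_)
  · exact (continuous_fst.comp (continuous_subtype_val.comp δ.continuous)).neg
  · exact (continuous_snd.comp (continuous_subtype_val.comp δ.continuous)).inv₀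
      fun t => (hpos t).ne'
  · rw [le_inv_comm₀ hR'.pos (hpos t), ← one_div, le_div_iff₀ hR'.pos]
    linarith [(δ t).2.2]
  · refine north_injective ((north_northChart ⟨γ t, h t⟩).trans ?_)
    rw [← polar_north (hpos t)]
    exact congrArg Subtype.val (hδ t)
  · simp only [Path.target, Path.source, conjAngle, circlePt_neg, Complex.conj_conj]
    push_cast
    linarith

theorem exists_collar_lift {x y : {s : Sphere // s ∉ matingP p q}} (γ : Path x y)
    (h : ∀ t, γ t ∈ chartSet p q R R' .collar) :
    ∃ (a b : Collar R R') (δ : Path a b) (n : ℤ), (∀ t, γ t = polarX hR hR' (δ t)) ∧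
      b.1.1 - a.1.1 = angle (circlePt 1 b.1.1) - angle (circlePt 1 a.1.1) + n := by
  obtain ⟨a, ha⟩ := exists_polar_eq hR.pos hR'.pos (h 0)
  obtain ⟨b, δ, hδ⟩ := exists_polar_lift hR.pos hR'.pos (γ.map continuous_subtype_val) h a
    (ha.trans (congrArg Subtype.val γ.source))
  obtain ⟨n, hn⟩ := isAngle_angle.exists_sub a.1.1 b.1.1
  exact ⟨a, b, δ, n, fun t => Subtype.ext (hδ t).symm, hn⟩

theorem chartVal_south_eq_collar {x y : {s : Sphere // s ∉ matingP p q}} (γ : Path x y)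
    (h : ∀ t, γ t ∈ chartSet p q R R' .south) (h' : ∀ t, γ t ∈ chartSet p q R R' .collar) :
    chartVal hR hR' .south γ h = chartVal hR hR' .collar γ h' := by
  obtain ⟨a, b, δ, n, hδ, hn⟩ := exists_collar_lift hR hR' γ h'
  rw [chartVal_south hR hR' γ h δ hδ n hn, chartVal_collar hR hR' γ h' δ hδ n hn]

theorem chartVal_north_eq_collar {x y : {s : Sphere // s ∉ matingP p q}} (γ : Path x y)
    (h : ∀ t, γ t ∈ chartSet p q R R' .north) (h' : ∀ t, γ t ∈ chartSet p q R R' .collar) :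
    chartVal hR hR' .north γ h = chartVal hR hR' .collar γ h' := by
  obtain ⟨a, b, δ, n, hδ, hn⟩ := exists_collar_lift hR hR' γ h'
  rw [chartVal_north hR hR' γ h δ hδ n hn, chartVal_collar hR hR' γ h' δ hδ n hn,
    southGroupHom_loop, ofAdd_neg]

theorem chartVal_agree (i j : Chart) {x y : {s : Sphere // s ∉ matingP p q}} (γ : Path x y)
    (h : ∀ t, γ t ∈ chartSet p q R R' i) (h' : ∀ t, γ t ∈ chartSet p q R R' j) :
    chartVal hR hR' i γ h = chartVal hR hR' j γ h' := by
  -- No path lies in both open hemispheres, since it has an initial point; every other pair of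
  -- distinct charts involves the collar.
  cases i <;> cases j
  · rfl
  · exact (lt_asymm (show (γ 0).1.1.2 < 0 from h 0) (h' 0)).elim
  · exact chartVal_south_eq_collar hR hR' γ h h'
  · exact (lt_asymm (show (γ 0).1.1.2 < 0 from h' 0) (h 0)).elim
  · rfl
  · exact chartVal_north_eq_collar hR hR' γ h h'
  · exact (chartVal_south_eq_collar hR hR' γ h' h).symm
  · exact (chartVal_north_eq_collar hR hR' γ h' h).symm
  · rfl

/-- The functor from the fundamental groupoid of the sphere to the fundamental group of the graph
of groups. -/
theorem exists_sphere_functor :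
    ∃ Ψ : ∀ x y : {s : Sphere // s ∉ matingP p q}, PathClass x y →
        (matingGroups hR hR').FundGroup (southV hR hR'),
      (∀ {x y z} (a : PathClass x y) (b : PathClass y z),
        Ψ _ _ (a.trans b) = Ψ _ _ a * Ψ _ _ b) ∧
      (∀ g : Pi1 (base hR), Ψ _ _ (Path.Homotopic.Quotient.map g (southX p q)) =
        southGroupHom hR hR' g) ∧
      (∀ g : Pi1 (base hR'), Ψ _ _ (Path.Homotopic.Quotient.map g (northX p q)) =
        northGroupHom hR hR' g) ∧
      Ψ _ _ (Path.Homotopic.Quotient.mk (meridian hR hR')) = 1 := by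
  obtain ⟨Ψ, h1, h2⟩ := exists_extension_of_compatible chartSet_cover
    (fun i {x y} γ h => chartVal hR hR' i γ h) (fun i x y γ γ' F hF h h' => by
      cases i
      · exact pushVal_homotopy southChart (southVal hR hR') F hF h h'
      · exact pushVal_homotopy northChart (northVal hR hR') F hF h h'
      · exact pushVal_homotopy (collarChart hR hR') (southVal hR hR') F hF h h')
    (fun i x y z γ γ' h h' h'' => by
      have hS {a b c} (x : PathClass a b) (y : PathClass b c) : southVal hR hR' a c (x.trans y) =
          southVal hR hR' a b x * southVal hR hR' b c y := by
        rw [southVal, retract_trans, map_mul]; rfl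
      have hN {a b c} (x : PathClass a b) (y : PathClass b c) : northVal hR hR' a c (x.trans y) =
          northVal hR hR' a b x * northVal hR hR' b c y := by
        rw [northVal, retract_trans, map_mul]; rfl
      cases i
      · exact pushVal_trans southChart (southVal hR hR') hS γ γ' h h' h''
      · exact pushVal_trans northChart (northVal hR hR') hN γ γ' h h' h''
      · exact pushVal_trans (collarChart hR hR') (southVal hR hR') hS γ γ' h h' h'')
    (fun i j x y γ h h' => chartVal_agree hR hR' i j γ h h')
  refine ⟨Ψ, h1, fun g => ?_, fun g => ?_, ?_⟩
  · induction g using Path.Homotopic.Quotient.ind with | mk γ =>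
    refine (h2 .south (γ.map (southX p q).continuous) fun t => south_snd_neg _).trans ?_
    refine (pushVal_eq southChart (southVal hR hR') (γ.map (southX p q).continuous)
      (fun t => south_snd_neg _) γ fun t => Subtype.ext (south_injective ?_)).trans ?_
    · exact south_southChart _
    · exact congrArg (southGroupHom hR hR') (retract_self (tree_base hR isAngle_angle) _)
  · induction g using Path.Homotopic.Quotient.ind with | mk γ =>
    refine (h2 .north (γ.map (northX p q).continuous) fun t => north_snd_pos _).trans ?_
    refine (pushVal_eq northChart (northVal hR hR') (γ.map (northX p q).continuous)
      (fun t => north_snd_pos _) γ fun t => Subtype.ext (north_injective ?_)).trans ?_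
    · exact north_northChart _
    · exact congrArg (northGroupHom hR hR') (retract_self (tree_base hR' isAngle_conjAngle) _)
  -- The meridian has a lift of constant angle, so its integer is 0 and its value trivial.
  · obtain ⟨δ, h0, hδ⟩ := exists_meridian_lift hR hR'
    have hmem (t) : meridian hR hR' t ∈ chartSet p q R R' .collar := by
      rw [hδ t]
      exact polar_inCollar _
    rw [h2 .collar _ hmem, chartVal_collar hR hR' _ hmem δ hδ 0 (by
      simp [southPt, northPt, Collar.southEnd, Collar.northEnd])]
    exact (congrArg _ (map_one _)).trans (map_one _)

/-- The path from the southern vertex to a vertex. -/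
noncomputable def fromSouth : ∀ v, (matingGroups hR hR').Hom (southV hR hR') v
  | ⟨.south, _⟩ => Hom.one _
  | ⟨.north, _⟩ => edgeHom hR hR'
  | ⟨.edge, h⟩ => nomatch h
  | ⟨.edgeRev, h⟩ => nomatch h

theorem edgeHom_comp_rev : Hom.comp (edgeHom hR hR') (Hom.mk (GPath.edge (X := matingGroups hR hR')
    Segment.edgeRev (u := northV hR hR') (v := southV hR hR') rfl rfl)) = Hom.one _ :=
  Quot.sound (Rel.edge_rev (X := matingGroups hR hR') Segment.edge rfl rfl rfl rfl)

/-- The map from the fundamental groupoid of the graph of groups to that of the sphere is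
faithful. -/
theorem realizeHom_injective (u v : (matingGroups hR hR').graph.Vert) :
    Function.Injective (realizeHom hR hR' (u := u) (v := v)) := by
  obtain ⟨Ψ, hmul, hS, hN, hmer⟩ := exists_sphere_functor hR hR'
  have hrefl (x) : Ψ x x (Path.Homotopic.Quotient.refl x) = 1 := by
    have := hmul (Path.Homotopic.Quotient.refl x) (Path.Homotopic.Quotient.refl x)
    rw [Path.Homotopic.Quotient.refl_trans] at this
    exact mul_eq_left.mp this.symm
  have hsymm {x y} (a : PathClass x y) : Ψ _ _ a.symm = (Ψ _ _ a)⁻¹ := by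
    refine eq_inv_of_mul_eq_one_left ?_
    rw [← hmul, Path.Homotopic.Quotient.symm_trans, hrefl]
  -- The functor `Ψ` applied to the realization of `a` is the retraction of `a` along the reference
  -- paths `fromSouth`. Cancelling these recovers the class of `a` from its realization.
  have key {u v : (matingGroups hR hR').graph.Vert} (a : GPath (matingGroups hR hR') u v) :
      Hom.comp (fromSouth hR hR' u) (Hom.mk a) =
        Hom.comp (Ψ _ _ (realize hR hR' a)) (fromSouth hR hR' v) := by
    induction a with
    | @elt v g =>
      obtain ⟨v, hv⟩ := v
      change Segment at v
      cases v with
      | south =>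
        refine (Hom.one_comp _).trans (Eq.trans ?_ (Hom.comp_one _).symm)
        exact (hS g).symm
      | north =>
        refine (northGroupHom_comp hR hR' g).symm.trans ?_
        exact congrArg (fun x => Hom.comp x (edgeHom hR hR')) (hN g).symm
      | edge => nomatch hv
      | edgeRev => nomatch hv
    | @edge x u v hu hv =>
      obtain rfl : (matingGroups hR hR').graph.srcV x = u := Subtype.ext hu
      obtain rfl : (matingGroups hR hR').graph.tgtV x = v := Subtype.ext hv
      change Segment at x
      cases x with
      | south =>
        refine (congrArg _ (Quot.sound (Rel.vert rfl rfl))).trans ((Hom.comp_one _).trans ?_)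
        exact (Hom.one_comp _).symm.trans
          (congrArg (fun x => Hom.comp x (fromSouth hR hR' (southV hR hR'))) (hrefl _).symm)
      | north =>
        refine (congrArg _ (Quot.sound (Rel.vert rfl rfl))).trans ((Hom.comp_one _).trans ?_)
        exact (Hom.one_comp _).symm.trans
          (congrArg (fun x => Hom.comp x (fromSouth hR hR' (northV hR hR'))) (hrefl _).symm)
      | edge =>
        exact (Hom.one_comp _).trans ((Hom.one_comp _).symm.trans
          (congrArg (fun x => Hom.comp x (edgeHom hR hR')) hmer.symm))
      | edgeRev =>
        refine (edgeHom_comp_rev hR hR').trans (Eq.trans ?_ (Hom.comp_one _).symm)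
        exact ((hsymm (Path.Homotopic.Quotient.mk (meridian hR hR'))).trans
          ((congrArg _ hmer).trans inv_one)).symm
    | comp a b iha ihb =>
      exact (Hom.comp_comp_eq iha ihb).trans
        (congrArg (fun x => Hom.comp x (fromSouth hR hR' _)) (hmul _ _).symm)
    | inv a ih =>
      exact (Hom.comp_inv_eq ih).trans
        (congrArg (fun x => Hom.comp x (fromSouth hR hR' _)) (hsymm _).symm)
  intro a b h
  induction a using Quot.ind with | mk a =>
  induction b using Quot.ind with | mk b =>
  refine Hom.comp_left_injective (fromSouth hR hR' u) ?_
  exact (key a).trans ((congrArg (fun x => Hom.comp (Ψ _ _ x) (fromSouth hR hR' v)) h).trans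
    (key b).symm)

/-- The isomorphism of the fundamental group of the graph of groups with that of the sphere. -/
noncomputable def realizeEquiv (v : (matingGroups hR hR').graph.Vert) :
    (matingGroups hR hR').FundGroup v ≃* Pi1 (matingPt hR hR' v.1) :=
  MulEquiv.mk (Equiv.ofBijective (realizeHom hR hR')
    ⟨realizeHom_injective hR hR' v v, realizeHom_surjective hR hR' v v⟩)
    fun a b => realizeHom_comp hR hR' a b

end Injective

/-! ### Bisets of correspondences -/

section CorrLemmas

open Path.Homotopic.Quotient

variable {Z Y X : Type} [TopologicalSpace Z] [TopologicalSpace Y] [TopologicalSpace X]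
  {i : C(Z, Y)} {f : C(Z, X)}

/-- Two triples are equivalent if they differ by a single move. -/
theorem Corr.mk_eq_iff {a : Y} {b : X} {z z' : Z} {δ : PathClass a (i z)} {γ : PathClass (f z) b}
    {δ' : PathClass a (i z')} {γ' : PathClass (f z') b} :
    (Corr.mk z δ γ : Corr i f a b) = Corr.mk z' δ' γ' ↔
      ∃ ε : PathClass z z', γ = (ε.map f).trans γ' ∧ δ' = δ.trans (ε.map i) := by
  constructor
  · intro h
    -- Being related by one path is already an equivalence relation, because paths in `Z` can be
    -- reversed and concatenated; it therefore contains the generated one.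
    let r (s t : CorrTriple i f a b) : Prop :=
      ∃ ε : PathClass s.z t.z, s.γ = (ε.map f).trans t.γ ∧ t.δ = s.δ.trans (ε.map i)
    have hr : ∀ s t, Relation.EqvGen (CorrRel i f a b) s t → r s t := by
      intro s t h
      induction h with
      | rel s t h =>
        obtain ⟨z, z', ε, δ, γ⟩ := h
        exact ⟨ε, rfl, rfl⟩
      | refl s =>
        refine ⟨.refl _, ?_, ?_⟩
        · exact (refl_trans _).symm
        · exact (trans_refl _).symm
      | symm s t _ ih =>
        obtain ⟨ε, h1, h2⟩ := ih
        have e (g : C(Z, X)) : (ε.symm.map g) = (ε.map g).symm := by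
          induction ε using Path.Homotopic.Quotient.ind; rfl
        have e' (g : C(Z, Y)) : (ε.symm.map g) = (ε.map g).symm := by
          induction ε using Path.Homotopic.Quotient.ind; rfl
        refine ⟨ε.symm, ?_, ?_⟩
        · rw [h1, e, ← trans_assoc, symm_trans, refl_trans]
        · rw [h2, e', trans_assoc, trans_symm, trans_refl]
      | trans s t w _ _ ih ih' =>
        obtain ⟨ε, h1, h2⟩ := ih
        obtain ⟨ε', h3, h4⟩ := ih'
        refine ⟨ε.trans ε', ?_, ?_⟩
        · rw [h1, h3, Corr.map_trans', trans_assoc]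
        · rw [h4, h2, Corr.map_trans', trans_assoc]
    exact hr _ _ (Quot.eqvGen_exact h)
  · rintro ⟨ε, rfl, rfl⟩
    exact Corr.mk_move ε δ γ'

theorem Corr.translate_translate {a a' a'' : Y} {b b' b'' : X} (α : PathClass a' a)
    (α' : PathClass a'' a') (t : Corr i f a b) (ε : PathClass b b') (ε' : PathClass b' b'') :
    Corr.translate α' (Corr.translate α t ε) ε' =
      Corr.translate (α'.trans α) t (ε.trans ε') := by
  induction t using Quot.ind with
  | mk t => exact congrArg₂ (Corr.mk t.z) (trans_assoc α' α t.δ).symm (trans_assoc t.γ ε ε')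

theorem Corr.translate_refl {a : Y} {b : X} (t : Corr i f a b) :
    Corr.translate (.refl a) t (.refl b) = t := by
  induction t using Quot.ind with
  | mk t => exact congrArg₂ (Corr.mk t.z) (refl_trans t.δ) (trans_refl t.γ)

/-- Moves a right translation from outside to inside a translation by `m` and `m'`. With meridians
for these, it spreads the edge relation from one element to its orbit. -/
theorem Corr.translate_slide {a b : Y} {a' a'' b' b'' : X} (m : PathClass a b) (t : Corr i f b b')
    {m' : PathClass b' a'} {c : PathClass a' a''} {c' : PathClass b' b''} {m'' : PathClass b'' a''}
    (h : c'.trans m'' = m'.trans c) : Corr.translate (.refl a) (Corr.translate m t m') c =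
      Corr.translate m (Corr.translate (.refl b) t c') m'' := by
  rw [Corr.translate_translate, Corr.translate_translate, h, refl_trans, trans_refl]

variable {Z' Y' X' : Type} [TopologicalSpace Z'] [TopologicalSpace Y'] [TopologicalSpace X']
  {i' : C(Z', Y')} {f' : C(Z', X')}

theorem cast_trans {x x' y z : X} (h : x' = x) (c : PathClass x y) (e : PathClass y z) :
    (c.cast h rfl).trans e = (c.trans e).cast h rfl := by
  subst h; simp

theorem trans_cast {x y z z' : X} (h : z' = z) (c : PathClass x y) (e : PathClass y z) :
    c.trans (e.cast rfl h) = (c.trans e).cast rfl h := by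
  subst h; simp

theorem Corr.push_translate (jZ : C(Z, Z')) (jY : C(Y, Y')) (jX : C(X, X'))
    (hi : ∀ z, i' (jZ z) = jY (i z)) (hf : ∀ z, f' (jZ z) = jX (f z)) {a a' : Y} {b b' : X}
    (α : PathClass a' a) (t : Corr i f a b) (ε : PathClass b b') :
    Corr.push jZ jY jX hi hf (Corr.translate α t ε) =
      Corr.translate (α.map jY) (Corr.push jZ jY jX hi hf t) (ε.map jX) := by
  induction t using Quot.ind with
  | mk t =>
    refine congrArg₂ (Corr.mk (jZ t.z)) ?_ ?_
    · rw [trans_cast, ← Corr.map_trans']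
    · rw [cast_trans, ← Corr.map_trans']

theorem Corr.map_trans_cast (jZ : C(Z, Z')) (jX : C(X, X')) (hf : ∀ z, f' (jZ z) = jX (f z))
    {b : X} {z z' : Z} (η : PathClass z z') (γ : PathClass (f z') b) :
    ((η.map jZ).map f').trans ((γ.map jX).cast (hf z') rfl) =
      (((η.map f).trans γ).map jX).cast (hf z) rfl := by
  rw [Corr.map_trans']
  obtain ⟨η, rfl⟩ := mk_surjective η
  obtain ⟨γ, rfl⟩ := mk_surjective γ
  refine congrArg Path.Homotopic.Quotient.mk (Path.ext (funext fun s => ?_))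
  simp only [Path.trans_apply, Path.cast_coe, Path.map_coe, Function.comp]
  split_ifs
  · exact hf _
  · rfl

theorem trans_left_cancel {x y z : X} {c : PathClass x y} {e e' : PathClass y z}
    (h : c.trans e = c.trans e') : e = e' := by
  have := congrArg (Path.Homotopic.Quotient.trans c.symm) h
  rwa [← trans_assoc, ← trans_assoc, symm_trans, refl_trans, refl_trans] at this

theorem trans_right_cancel {x y z : X} {c c' : PathClass x y} {e : PathClass y z}
    (h : c.trans e = c'.trans e) : c = c' := by
  have := congrArg (fun c => Path.Homotopic.Quotient.trans c e.symm) h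
  rwa [trans_assoc, trans_assoc, trans_symm, trans_refl, trans_refl] at this

end CorrLemmas

/-! ### The sector around the positive real direction -/

section Sector

/-- The points of the sphere in a convex cone around the positive real direction. -/
def sector (r r' : ℝ) : Set Sphere := {s | r * -s.1.2 < s.1.1.re ∧ r' * s.1.2 < s.1.1.re}

/-- The inequalities of the sector are homogeneous. Without the restriction to the unit sphere they
define a convex set, which contains the sector and is carried onto it by central projection. -/
def Cone (r r' : ℝ) : Type := {a : ℂ × ℝ // r * -a.2 < a.1.re ∧ r' * a.2 < a.1.re}

variable {r r' : ℝ}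

instance : TopologicalSpace (Cone r r') := inferInstanceAs (TopologicalSpace (Subtype _))

theorem convex_cone : Convex ℝ {a : ℂ × ℝ | r * -a.2 < a.1.re ∧ r' * a.2 < a.1.re} := by
  rintro a ⟨ha, ha'⟩ b ⟨hb, hb'⟩ s t hs ht hst
  simp only [mem_ofPred_eq, Prod.snd_add, Prod.smul_snd, smul_eq_mul, Prod.fst_add, Prod.smul_fst,
    Complex.add_re, Complex.real_smul, Complex.re_ofReal_mul]
  rcases hs.eq_or_lt with rfl | hs
  · obtain rfl : t = 1 := by linarith
    constructor <;> linarith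
  · constructor
    · have h1 := mul_lt_mul_of_pos_left ha hs
      have h2 := mul_le_mul_of_nonneg_left hb.le ht
      linarith
    · have h1 := mul_lt_mul_of_pos_left ha' hs
      have h2 := mul_le_mul_of_nonneg_left hb'.le ht
      linarith

instance : SimplyConnectedSpace (Cone r r') :=
  haveI := (convex_cone (r := r) (r' := r')).contractibleSpace ⟨(1, 0), by simp⟩
  inferInstanceAs (SimplyConnectedSpace {a : ℂ × ℝ | r * -a.2 < a.1.re ∧ r' * a.2 < a.1.re})

theorem Cone.ne_zero (a : Cone r r') : a.1 ≠ 0 := fun h => by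
  have := a.2.1
  rw [h] at this
  simp at this

theorem normalize_mem_sector (a : Cone r r') : normalize ⟨a.1, a.ne_zero⟩ ∈ sector r r' := by
  have h := sqrt_norm_sq_pos ⟨a.1, a.ne_zero⟩
  obtain ⟨h1, h2⟩ := a.2
  change r * -(a.1.2 / √(‖a.1.1‖ ^ 2 + a.1.2 ^ 2)) <
    (a.1.1 / ((√(‖a.1.1‖ ^ 2 + a.1.2 ^ 2) : ℝ) : ℂ)).re ∧
    r' * (a.1.2 / √(‖a.1.1‖ ^ 2 + a.1.2 ^ 2)) <
    (a.1.1 / ((√(‖a.1.1‖ ^ 2 + a.1.2 ^ 2) : ℝ) : ℂ)).re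
  rw [Complex.div_ofReal_re, ← neg_div, ← mul_div_assoc, ← mul_div_assoc]
  exact ⟨div_lt_div_of_pos_right h1 h, div_lt_div_of_pos_right h2 h⟩

variable {B : Sphere → Prop}

/-- Path classes with a representative in the sector. -/
def InSector (r r' : ℝ) {x y : {s // B s}} (c : PathClass x y) : Prop :=
  ∃ γ : Path x y, (∀ t, (γ t).1 ∈ sector r r') ∧ c = .mk γ

theorem InSector.symm {x y : {s // B s}} {c : PathClass x y} (h : InSector r r' c) :
    InSector r r' c.symm := by
  obtain ⟨γ, h, rfl⟩ := h
  exact ⟨γ.symm, fun t => h _, rfl⟩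

theorem InSector.trans {x y z : {s // B s}} {c : PathClass x y} {c' : PathClass y z}
    (h : InSector r r' c) (h' : InSector r r' c') : InSector r r' (c.trans c') := by
  obtain ⟨γ, h, rfl⟩ := h
  obtain ⟨γ', h', rfl⟩ := h'
  refine ⟨γ.trans γ', fun t => ?_, (Path.Homotopic.Quotient.mk_trans _ _).symm⟩
  rw [Path.trans_apply]
  split_ifs
  exacts [h _, h' _]

/-- The sector is simply connected. -/
theorem InSector.eq (hB : ∀ s ∈ sector r r', B s) {x y : {s // B s}} {c c' : PathClass x y}
    (h : InSector r r' c) (h' : InSector r r' c') : c = c' := by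
  obtain ⟨γ, h, rfl⟩ := h
  obtain ⟨γ', h', rfl⟩ := h'
  let k : C(Cone r r', {s // B s}) :=
    ⟨fun a => ⟨normalize ⟨a.1, a.ne_zero⟩, hB _ (normalize_mem_sector a)⟩,
      Continuous.subtype_mk (normalize.continuous.comp (continuous_subtype_val.subtype_mk _)) _⟩
  have hk (s : {s // B s}) (hs : s.1 ∈ sector r r') : s = k (⟨s.1.1, hs⟩ : Cone r r') :=
    Subtype.ext (normalize_self s.1).symm
  have hx : x.1 ∈ sector r r' := by simpa using h 0
  have hy : y.1 ∈ sector r r' := by simpa using h 1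
  have key (γ : Path x y) (h : ∀ t, (γ t).1 ∈ sector r r') :
      Path.Homotopic.Quotient.mk γ = via k (⟨x.1.1, hx⟩ : Cone r r') (⟨y.1.1, hy⟩ : Cone r r')
        (hk x hx) (hk y hy) := by
    let g (t : unitInterval) : Cone r r' := ⟨(γ t).1.1, h t⟩
    have hg : Continuous g := Continuous.subtype_mk
      (continuous_subtype_val.comp (continuous_subtype_val.comp γ.continuous)) _
    exact mk_eq_via k _ _ γ ⟨⟨g, hg⟩, Subtype.ext (congrArg (fun s => s.1.1) γ.source),
      Subtype.ext (congrArg (fun s => s.1.1) γ.target)⟩ fun t => hk _ (h t)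
  rw [key γ h, key γ' h']

theorem south_mem_sector (hr : 0 ≤ r) (hr' : 0 ≤ r') {z : ℂ} (hz : r < z.re) :
    south z ∈ sector r r' := by
  have h : 0 < √(1 + ‖z‖ ^ 2) := by positivity
  change r * -(-1 / √(1 + ‖z‖ ^ 2)) < (z / ((√(1 + ‖z‖ ^ 2) : ℝ) : ℂ)).re ∧
    r' * (-1 / √(1 + ‖z‖ ^ 2)) < (z / ((√(1 + ‖z‖ ^ 2) : ℝ) : ℂ)).re
  rw [Complex.div_ofReal_re, ← neg_div, ← mul_div_assoc, ← mul_div_assoc]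
  exact ⟨div_lt_div_of_pos_right (by linarith) h, div_lt_div_of_pos_right (by linarith) h⟩

theorem north_mem_sector (hr : 0 ≤ r) (hr' : 0 ≤ r') {z : ℂ} (hz : r' < z.re) :
    north z ∈ sector r r' := by
  obtain ⟨h1, h2⟩ := south_mem_sector hr' hr hz
  refine ⟨?_, ?_⟩
  · change r * -(-(south z).1.2) < ((starRingEnd ℂ) (south z).1.1).re
    rw [neg_neg, Complex.conj_re]
    exact h2
  · change r' * -(south z).1.2 < ((starRingEnd ℂ) (south z).1.1).re
    rw [Complex.conj_re]
    exact h1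

theorem re_gt_of_south_mem_sector {z : ℂ} (h : south z ∈ sector r r') : r < z.re := by
  have h0 : 0 < √(1 + ‖z‖ ^ 2) := by positivity
  have h1 : r * -(-1 / √(1 + ‖z‖ ^ 2)) < (z / ((√(1 + ‖z‖ ^ 2) : ℝ) : ℂ)).re := h.1
  rw [Complex.div_ofReal_re, ← neg_div, ← mul_div_assoc, div_lt_div_iff_of_pos_right h0] at h1
  linarith

theorem re_gt_of_north_mem_sector {z : ℂ} (h : north z ∈ sector r r') : r' < z.re := by
  refine re_gt_of_south_mem_sector (r' := r) ⟨?_, ?_⟩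
  · exact h.2
  · have := h.1
    change r * -(-(south z).1.2) < (south z).1.1.re at this
    rwa [neg_neg] at this

end Sector

/-! ### The edge relation in the sphere -/

section EdgeRelation

variable {d : ℕ} {p q : TopologicalPolynomial d} {R R' : ℝ} (hR : p.NearInfinity R)
  (hR' : q.NearInfinity R')

/-- `r` bounds the post-critical set and the real parts of the images of the large positive
numbers. -/
structure IsBarrier (p : TopologicalPolynomial d) (R r : ℝ) : Prop where
  nonneg : 0 ≤ r
  lt : r < R
  norm_le : ∀ z ∈ p.P, ‖z‖ ≤ r
  lt_re : ∀ x : ℝ, R ≤ x → r < (p.toFun x).re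

include hR in
-- For real `x ≥ R` the direction of `p x` is at distance at most 1 from 1, so its real part is at
-- least `1 / 2`. Together with `|p x| > 2r` this gives real part more than `r`.
theorem exists_isBarrier : ∃ r, IsBarrier p R r := by
  have hpos := hR.pos
  obtain ⟨r, h0, h1, h2, h3⟩ := hR
  refine ⟨r, h0, h1, h2, fun x hx => ?_⟩
  have hx0 : 0 < x := hpos.trans_le hx
  obtain ⟨h4, h5⟩ := h3 x (by rwa [Complex.norm_real, Real.norm_of_nonneg hx0.le])
  set w := p.toFun x
  have hw : 0 < ‖w‖ := by linarith
  have hx1 : (x : ℂ) ≠ 0 := Complex.ofReal_ne_zero.mpr hx0.ne'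
  rw [Complex.norm_real, Real.norm_of_nonneg hx0.le, div_self hx1, one_pow] at h5
  have h6 : ‖w / (‖w‖ : ℂ)‖ = 1 := by
    rw [norm_div, Complex.norm_real, norm_norm, div_self hw.ne']
  have h7 : ‖w / (‖w‖ : ℂ) - 1‖ ^ 2 = ‖w / (‖w‖ : ℂ)‖ ^ 2 + ‖(1 : ℂ)‖ ^ 2 -
      2 * (w / (‖w‖ : ℂ) * (starRingEnd ℂ) 1).re := by
    simp only [← Complex.normSq_eq_norm_sq]
    exact Complex.normSq_sub _ _
  rw [h6, norm_one, map_one, mul_one, Complex.div_ofReal_re] at h7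
  have h8 : ‖w / (‖w‖ : ℂ) - 1‖ ^ 2 ≤ 1 := pow_le_one₀ (norm_nonneg _) h5
  have h9 : 1 / 2 ≤ w.re / ‖w‖ := by linarith
  rw [le_div_iff₀ hw] at h9
  linarith

variable {r r' : ℝ}

theorem notMem_of_mem_sector (hr : IsBarrier p R r) (hr' : IsBarrier q R' r') (s : Sphere)
    (hs : s ∈ sector r r') : s ∉ matingP p q := by
  rintro (⟨z, hz, rfl⟩ | ⟨z, hz, rfl⟩)
  · exact ((re_gt_of_south_mem_sector hs).trans_le (z.re_le_norm)).not_ge (hr.norm_le z hz)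
  · exact ((re_gt_of_north_mem_sector hs).trans_le (z.re_le_norm)).not_ge (hr'.norm_le z hz)

theorem circlePt_zero (ρ : ℝ) : circlePt ρ 0 = ρ := by simpa using circlePt_int ρ 0

include hR hR' in
/-- The meridian of angle zero, near the equator, and its image are in the sector. -/
theorem polar_mem_sector (hr : IsBarrier p R r) (hr' : IsBarrier q R' r') {a : Collar R R'}
    (ha : a.1.1 = 0) : polar R R' a ∈ sector r r' ∧
      formalMating p q (polar R R' a) ∈ sector r r' := by
  rcases lt_trichotomy a.1.2 0 with h | h | h
  · have h1 : R ≤ (-a.1.2)⁻¹ := by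
      rw [le_inv_comm₀ hR.pos (neg_pos.mpr h), ← one_div, le_div_iff₀ hR.pos]
      linarith [a.2.1]
    rw [polar_south h, ha, circlePt_zero, formalMating_south]
    exact ⟨south_mem_sector hr.nonneg hr'.nonneg (hr.lt.trans_le h1),
      south_mem_sector hr.nonneg hr'.nonneg (hr.lt_re _ h1)⟩
  · obtain ⟨h1, h2⟩ := polar_div (a := a) rfl
    set s := polar R R' a
    have hne : 0 < ‖s.1.1‖ :=
      norm_pos_iff.mpr (InCollar.ne_zero hR.pos hR'.pos (polar_inCollar a))
    have hs : s.1.2 = 0 := by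
      have := h2.symm.trans h
      exact (div_eq_zero_iff.mp this).resolve_right hne.ne'
    have hs1 : s.1.1 = (‖s.1.1‖ : ℂ) := by
      rw [ha, circlePt_zero, Complex.ofReal_one, eq_div_iff (by exact_mod_cast hne.ne'),
        one_mul] at h1
      exact h1.symm
    have e := formalMating_equator p q hs
    refine ⟨?_, ?_⟩
    · change r * -s.1.2 < s.1.1.re ∧ r' * s.1.2 < s.1.1.re
      rw [hs, hs1, Complex.ofReal_re]
      simpa using hne
    · change r * -(formalMating p q s).1.2 < (formalMating p q s).1.1.re ∧
        r' * (formalMating p q s).1.2 < (formalMating p q s).1.1.re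
      rw [e, hs1, ← Complex.ofReal_pow, Complex.ofReal_re]
      simpa using pow_pos hne d
  · have h1 : R' ≤ (a.1.2)⁻¹ := by
      rw [le_inv_comm₀ hR'.pos h, ← one_div, le_div_iff₀ hR'.pos]
      linarith [a.2.2]
    rw [polar_north h, ha, neg_zero, circlePt_zero, formalMating_north]
    exact ⟨north_mem_sector hr.nonneg hr'.nonneg (hr'.lt.trans_le h1),
      north_mem_sector hr.nonneg hr'.nonneg (hr'.lt_re _ h1)⟩

theorem southZ_base : southZ p q (circleDom hR 0) = polarZ hR hR' (southPt hR hR' 0) :=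
  Subtype.ext (polar_southEnd hR.pos hR'.pos 0).symm

theorem northZ_base : northZ p q (circleDom hR' 0) = polarZ hR hR' (northPt hR hR' 0) := by
  refine Subtype.ext ((polar_northEnd hR.pos hR'.pos 0).trans ?_).symm
  rw [neg_zero]
  rfl

/-- The meridian, in the domain of the correspondence. -/
noncomputable def meridianZ :
    PathClass (southZ p q (circleDom hR 0)) (northZ p q (circleDom hR' 0)) :=
  via (polarZ hR hR') (southPt hR hR' 0) (northPt hR hR' 0) (southZ_base hR hR')
    (northZ_base hR hR')

theorem circle_mul_zero : circle hR (d * 0) = base hR := by rw [mul_zero, circle_zero]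

/-- The trivial path from the basepoint, with the other description of its end. -/
noncomputable abbrev startPath : PathClass (base hR) (inclusion p.map p.mapsTo_P (circleDom hR 0)) :=
  arc hR 0 0 (circle_zero hR).symm rfl

theorem atInfinity_zero : atInfinity hR 0 =
    Corr.mk (circleDom hR 0) (startPath hR) (straightTo hR 0 (circle_mul_zero hR)) := by
  -- The point of `atInfinity hR 0` has angle `0 / d`, which equals 0 but not by definition;
  -- generalizing the angle allows substitution in the dependent paths.
  have key (x : ℝ) (hx : x = 0) (h : circle hR (d * x) = base hR) :
      (Corr.mk (circleDom hR x) (arc hR 0 x (circle_zero hR).symm rfl) (straightTo hR x h) :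
        (TopologicalPolynomial.biset hR).carrier) =
      Corr.mk (circleDom hR 0) (startPath hR) (straightTo hR 0 (circle_mul_zero hR)) := by
    subst hx
    rfl
  exact key _ (by simp) _

open Path.Homotopic.Quotient

theorem meridianZ_map_inclusion : ((startPath hR).map (southX p q)).trans
    ((meridianZ hR hR').map (inclusion (formalMating p q) (mapsTo_matingP p q))) =
      Path.Homotopic.Quotient.trans (.mk (meridian hR hR')) ((startPath hR').map (northX p q)) := by
  have h1 := arc_map_southX hR hR' 0 0 (circle_zero hR).symm rfl
  have h2 := arc_map_northX hR hR' 0 0 0 0 (circle_zero hR').symm rfl neg_zero.symm neg_zero.symm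
  have h3 := via_map (polarZ hR hR') (inclusion (formalMating p q) (mapsTo_matingP p q))
    (southPt hR hR' 0) (northPt hR hR' 0) (southZ_base hR hR') (northZ_base hR hR')
  refine (congrArg₂ Path.Homotopic.Quotient.trans h1 h3).trans (Eq.trans ?_
    (congrArg₂ Path.Homotopic.Quotient.trans (mk_meridian hR hR') h2).symm)
  exact (via_trans (polarX hR hR') _ _ _ _ _ _).trans (via_trans (polarX hR hR') _ _ _ _ _ _).symm

theorem straightTo_mem_sector (hr : IsBarrier p R r) (t : unitInterval) :
    r < ((1 - t : ℝ) * p.toFun (circlePt R 0) + (t : ℝ) * circlePt R (d * 0)).re := by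
  have h1 := hr.lt_re R le_rfl
  have h2 := hr.lt
  rw [mul_zero, circlePt_zero, Complex.add_re, Complex.re_ofReal_mul, Complex.re_ofReal_mul,
    Complex.ofReal_re]
  have h3 := t.2.1
  have h4 := t.2.2
  rcases h3.eq_or_lt with h | h
  · rw [← h]; linarith
  · nlinarith

theorem restriction_southZ (z : {z : ℂ // p.map z ∉ p.P}) :
    restriction (formalMating p q) (matingP p q) (southZ p q z) =
      southX p q (restriction p.map p.P z) := Subtype.ext (formalMating_south p q z.1)

theorem restriction_northZ (z : {z : ℂ // q.map z ∉ q.P}) :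
    restriction (formalMating p q) (matingP p q) (northZ p q z) =
      northX p q (restriction q.map q.P z) := Subtype.ext (formalMating_north p q z.1)

/-- Both sides stay in the sector: the straight segments because their ends have real part more than
`r`, respectively `r'`, and the meridian and its image by `polar_mem_sector`. No finer knowledge of
the image of the meridian is needed, because `InSector.eq` identifies any two such classes. -/
theorem meridianZ_map_restriction :
    (((straightTo hR 0 (circle_mul_zero hR)).map (southX p q)).cast
      (restriction_southZ (circleDom hR 0)) rfl) =
    ((meridianZ hR hR').map (restriction (formalMating p q) (matingP p q))).trans
      ((((straightTo hR' 0 (circle_mul_zero hR')).map (northX p q)).cast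
        (restriction_northZ (circleDom hR' 0)) rfl).trans
        (Path.Homotopic.Quotient.symm (.mk (meridian hR hR')))) := by
  obtain ⟨r, hr⟩ := exists_isBarrier hR
  obtain ⟨r', hr'⟩ := exists_isBarrier hR'
  obtain ⟨δ, h0, hδ⟩ := exists_meridian_lift hR hR'
  refine InSector.eq (notMem_of_mem_sector hr hr') ?_ (.trans ?_ (.trans ?_ (.symm ?_)))
  · exact ⟨_, fun t => south_mem_sector hr.nonneg hr'.nonneg (straightTo_mem_sector hr t), rfl⟩
  · have e : meridianZ hR hR' = .mk ((δ.map (polarZ hR hR').continuous).cast (southZ_base hR hR')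
        (northZ_base hR hR')) := (mk_eq_via (polarZ hR hR') _ _ _ δ fun _ => rfl).symm
    exact ⟨_, fun t => (polar_mem_sector hR hR' hr hr' (h0 t)).2, congrArg
      (fun c => Path.Homotopic.Quotient.map c (restriction (formalMating p q) (matingP p q))) e⟩
  · exact ⟨_, fun t => north_mem_sector hr.nonneg hr'.nonneg (straightTo_mem_sector hr' t), rfl⟩
  · refine ⟨_, fun t => ?_, rfl⟩
    rw [hδ t]
    exact (polar_mem_sector hR hR' hr hr' (h0 t)).1

/-- The point of the triple is moved along the meridian in the domain of the correspondence. The two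
components of the move are compared by `meridianZ_map_inclusion` and `meridianZ_map_restriction`. -/
theorem southPush_atInfinity_zero : southPush p q (atInfinity hR 0) =
    Corr.translate (.mk (meridian hR hR')) (northPush p q (atInfinity hR' 0))
      (Path.Homotopic.Quotient.symm (.mk (meridian hR hR'))) := by
  rw [atInfinity_zero, atInfinity_zero]
  exact Corr.mk_eq_iff.mpr ⟨meridianZ hR hR', meridianZ_map_restriction hR hR',
    (meridianZ_map_inclusion hR hR').symm⟩

theorem southPush_translate {a a' b b' : {z : ℂ // z ∉ p.P}} (α : PathClass a' a)
    (t : (partialBiset p.map p.mapsTo_P a b).carrier) (ε : PathClass b b') :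
    southPush p q (Corr.translate α t ε) =
      Corr.translate (α.map (southX p q)) (southPush p q t) (ε.map (southX p q)) :=
  Corr.push_translate _ _ _ _ _ _ _ _

theorem northPush_translate {a a' b b' : {z : ℂ // z ∉ q.P}} (α : PathClass a' a)
    (t : (partialBiset q.map q.mapsTo_P a b).carrier) (ε : PathClass b b') :
    northPush p q (Corr.translate α t ε) =
      Corr.translate (α.map (northX p q)) (northPush p q t) (ε.map (northX p q)) :=
  Corr.push_translate _ _ _ _ _ _ _ _

/-- The right action of `ℤ` on the regular cyclic biset is transitive, so the edge relation only has
to be checked at 0. -/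
theorem atInfinity_eq (j : ℤ) : atInfinity hR j =
    Corr.translate (.refl _) (atInfinity hR 0) (loop hR (Multiplicative.ofAdd j)) := by
  have := atInfinity_congr hR 1 (0 : ℤ) (Multiplicative.ofAdd j)
  rw [map_one] at this
  refine Eq.trans (congrArg (atInfinity hR) ?_) this
  change j = (d : ℤ) * 0 + 0 + j
  ring

/-- The edge relation of the graph of bisets holds in the sphere. -/
theorem southPush_atInfinity (j : ℤ) : southPush p q (atInfinity hR j) =
    Corr.translate (.mk (meridian hR hR')) (northPush p q (atInfinity hR' (-j)))
      (Path.Homotopic.Quotient.symm (.mk (meridian hR hR'))) := by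
  have h := loop_trans_meridian_symm hR hR' (Multiplicative.ofAdd (-j))
  rw [← ofAdd_neg, neg_neg] at h
  have e1 := (congrArg (southPush p q) (atInfinity_eq hR j)).trans
    (southPush_translate (q := q) (.refl _) (atInfinity hR 0) (loop hR (Multiplicative.ofAdd j)))
  have e2 := (congrArg (northPush p q) (atInfinity_eq hR' (-j))).trans
    (northPush_translate (p := p) (.refl _) (atInfinity hR' 0) (loop hR' (Multiplicative.ofAdd (-j))))
  refine e1.trans ((congrArg (fun t => Corr.translate (.refl _) t _)
    (southPush_atInfinity_zero hR hR')).trans ((Corr.translate_slide _ _ h).trans ?_))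
  exact congrArg (fun t => Corr.translate _ t _) e2.symm

theorem northPush_atInfinity (j : ℤ) : northPush p q (atInfinity hR' j) =
    Corr.translate (Path.Homotopic.Quotient.symm (.mk (meridian hR hR')))
      (southPush p q (atInfinity hR (-j))) (.mk (meridian hR hR')) := by
  have h := southPush_atInfinity hR hR' (-j)
  rw [neg_neg] at h
  refine Eq.trans ?_ (congrArg (fun t => Corr.translate _ t _) h.symm)
  refine Eq.trans ?_ (Corr.translate_translate _ _ _ _ _).symm
  rw [symm_trans]
  exact (Corr.translate_refl _).symm

end EdgeRelation

/-! ### Inverses and cancellation of path classes -/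

section PathClass

variable {A B : Type} [TopologicalSpace A] [TopologicalSpace B] {x y z : A}

theorem pathClass_symm_symm (c : PathClass x y) : c.symm.symm = c := by
  induction c using Path.Homotopic.Quotient.ind with | mk γ =>
  exact congrArg Path.Homotopic.Quotient.mk γ.symm_symm

theorem pathClass_trans_symm (c : PathClass x y) (e : PathClass y z) :
    (c.trans e).symm = e.symm.trans c.symm := by
  induction c using Path.Homotopic.Quotient.ind with | mk γ =>
  induction e using Path.Homotopic.Quotient.ind with | mk δ =>
  exact congrArg Path.Homotopic.Quotient.mk (Path.trans_symm γ δ)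

theorem pathClass_map_symm (c : PathClass x y) (f : C(A, B)) : c.symm.map f = (c.map f).symm := by
  induction c using Path.Homotopic.Quotient.ind; rfl

theorem eq_cast_of_cast_eq {x' : A} (h : x' = x) {c : PathClass x' y} {e : PathClass x y}
    (he : c.cast h.symm rfl = e) : c = e.cast h rfl := by
  subst h; simpa using he

theorem eq_trans_map_of_trans_eq {o : B} (f : C(A, B)) {c c' : PathClass o (f x)}
    {e e' : PathClass x y} (h : c'.trans (e'.map f) = c.trans (e.map f)) :
    c' = c.trans ((e.trans e'.symm).map f) := by
  refine trans_right_cancel (e := e'.map f) ?_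
  rw [h, Path.Homotopic.Quotient.trans_assoc, ← Corr.map_trans',
    Path.Homotopic.Quotient.trans_assoc, Path.Homotopic.Quotient.symm_trans,
    Path.Homotopic.Quotient.trans_refl]

theorem eq_map_trans_of_trans_eq {o : B} (f : C(A, B)) {c c' : PathClass (f y) o}
    {e e' : PathClass x y} (h : (e.map f).trans c = (e'.map f).trans c') :
    c = ((e.symm.trans e').map f).trans c' := by
  refine trans_left_cancel (c := e.map f) ?_
  rw [h, ← Path.Homotopic.Quotient.trans_assoc, ← Corr.map_trans',
    ← Path.Homotopic.Quotient.trans_assoc, Path.Homotopic.Quotient.trans_symm,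
    Path.Homotopic.Quotient.refl_trans]

theorem cast_injective {x' : A} (h : x' = x) {c e : PathClass x y}
    (he : c.cast h rfl = e.cast h rfl) : c = e := by
  subst h; simpa using he

end PathClass

/-! ### The map from the fundamental biset to the biset of the mating -/

section BisetMap

variable {d : ℕ} {p q : TopologicalPolynomial d} {R R' : ℝ} (hR : p.NearInfinity R)
  (hR' : q.NearInfinity R')

open Path.Homotopic.Quotient

theorem realizeBiset_act (v : (matingGroups hR hR').graph.Vert)
    (h : (matingGroups hR hR').G v.1) (b : ((matingBisets hR hR').B v.1).carrier)
    (g : (matingGroups hR hR').G v.1) :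
    realizeBiset hR hR' v.1 (((matingBisets hR hR').B v.1).act h b g) =
      Corr.translate (realize hR hR' (GPath.elt (v := v) h)) (realizeBiset hR hR' v.1 b)
        (realize hR hR' (GPath.elt (v := v) g)) := by
  obtain ⟨v, hv⟩ := v
  change Segment at v
  cases v with
  | south => exact southPush_translate _ _ _
  | north => exact northPush_translate _ _ _
  | edge => nomatch hv
  | edgeRev => nomatch hv

variable {u v : (matingGroups hR hR').graph.Vert}

/-- The element of the biset of the mating given by a triple. -/
noncomputable def tripleVal (t : (matingBisets hR hR').Triple u v) :
    (matingBiset p q (matingPt hR hR' u.1) (matingPt hR hR' v.1)).carrier :=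
  Corr.translate (realizeHom hR hR' t.q) (realizeBiset hR hR' t.z.1 t.b) (realizeHom hR hR' t.p)

/-- The tensor relations hold because the inclusions of the hemispheres induce congruences. The edge
relation is trivial at a vertex, and at the edge it is `southPush_atInfinity` or
`northPush_atInfinity`. -/
theorem tripleVal_rel {t t' : (matingBisets hR hR').Triple u v}
    (h : (matingBisets hR hR').TripleRel t t') : tripleVal hR hR' t = tripleVal hR hR' t' := by
  cases h with
  | left z k h b g =>
    have e := realizeBiset_act hR hR' z h b 1
    have e1 := realizeHom_comp hR hR' k (Hom.mk (GPath.elt (X := matingGroups hR hR')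
      (v := (matingBisets hR hR').lam.vert z) h))
    have e2 := realize_one hR hR' z
    refine (congrArg (fun x => Corr.translate x (realizeBiset hR hR' z.1 b)
      (realizeHom hR hR' g)) e1).trans (Eq.trans ?_ (congrArg (fun x => Corr.translate
        (realizeHom hR hR' k) x (realizeHom hR hR' g)) e).symm)
    refine Eq.trans ?_ (Corr.translate_translate _ _ _ _ _).symm
    refine congrArg (fun x => Corr.translate _ _ x) ?_
    exact (refl_trans _).symm.trans
      (congrArg (fun x => Path.Homotopic.Quotient.trans x (realizeHom hR hR' g)) e2.symm)
  | right z k h b g =>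
    have e := realizeBiset_act hR hR' z 1 b h
    have e1 := realizeHom_comp hR hR' (Hom.mk (GPath.elt (X := matingGroups hR hR')
      (v := (matingBisets hR hR').lam.vert z) h)) g
    have e2 := realize_one hR hR' z
    refine (congrArg (fun x => Corr.translate
        (realizeHom hR hR' k) x (realizeHom hR hR' g)) e).trans (Eq.trans ?_ (congrArg
        (fun x => Corr.translate (realizeHom hR hR' k) (realizeBiset hR hR' z.1 b) x) e1).symm)
    refine (Corr.translate_translate _ _ _ _ _).trans ?_
    refine congrArg (fun x => Corr.translate x _ _) ?_
    exact (congrArg (fun x => Path.Homotopic.Quotient.trans (realizeHom hR hR' k) x) e2).trans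
      (trans_refl _)
  | edge z k b g =>
    change Segment at z
    have key {a a' : (matingGroups hR hR').graph.Vert}
        (t : (matingBiset p q (matingPt hR hR' a.1) (matingPt hR hR' a.1)).carrier)
        (t' : (matingBiset p q (matingPt hR hR' a'.1) (matingPt hR hR' a'.1)).carrier)
        (m : (matingGroups hR hR').Hom a a') (m' : (matingGroups hR hR').Hom a' a)
        (k : (matingGroups hR hR').Hom u a) (g : (matingGroups hR hR').Hom a v)
        (h : t = Corr.translate (realizeHom hR hR' m) t' (realizeHom hR hR' m')) :
        Corr.translate (realizeHom hR hR' k) t (realizeHom hR hR' g) =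
          Corr.translate (realizeHom hR hR' (k.comp m)) t' (realizeHom hR hR' (m'.comp g)) := by
      rw [h, realizeHom_comp, realizeHom_comp]
      exact Corr.translate_translate _ _ _ _ _
    cases z with
    | south =>
      refine key (a := southV hR hR') (a' := southV hR hR') (southPush p q b)
        (southPush p q b)
        (Hom.mk (GPath.edge (X := matingGroups hR hR') Segment.south (u := southV hR hR')
        (v := southV hR hR') rfl rfl))
        (Hom.mk (GPath.edge (X := matingGroups hR hR') Segment.south (u := southV hR hR')
        (v := southV hR hR') rfl rfl)) k g ?_
      exact (Corr.translate_refl _).symm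
    | north =>
      refine key (a := northV hR hR') (a' := northV hR hR') (northPush p q b)
        (northPush p q b)
        (Hom.mk (GPath.edge (X := matingGroups hR hR') Segment.north (u := northV hR hR')
        (v := northV hR hR') rfl rfl))
        (Hom.mk (GPath.edge (X := matingGroups hR hR') Segment.north (u := northV hR hR')
        (v := northV hR hR') rfl rfl)) k g ?_
      exact (Corr.translate_refl _).symm
    | edge =>
      refine key (a := southV hR hR') (a' := northV hR hR') (southPush p q (atInfinity hR b))
        (northPush p q (atInfinity hR' (Neg.neg (α := ℤ) b)))
        (Hom.mk (GPath.edge (X := matingGroups hR hR') Segment.edge (u := southV hR hR')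
        (v := northV hR hR') rfl rfl))
        (Hom.mk (GPath.edge (X := matingGroups hR hR') Segment.edgeRev (u := northV hR hR')
        (v := southV hR hR') rfl rfl)) k g ?_
      exact (southPush_atInfinity hR hR' b)
    | edgeRev =>
      refine key (a := northV hR hR') (a' := southV hR hR') (northPush p q (atInfinity hR' b))
        (southPush p q (atInfinity hR (Neg.neg (α := ℤ) b)))
        (Hom.mk (GPath.edge (X := matingGroups hR hR') Segment.edgeRev (u := northV hR hR')
        (v := southV hR hR') rfl rfl))
        (Hom.mk (GPath.edge (X := matingGroups hR hR') Segment.edge (u := southV hR hR')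
        (v := northV hR hR') rfl rfl)) k g ?_
      exact (northPush_atInfinity hR hR' b)

/-- The map from the fundamental biset to the biset of the mating. -/
noncomputable def bisetMap : ((matingBisets hR hR').fundBiset u v).carrier →
    (matingBiset p q (matingPt hR hR' u.1) (matingPt hR hR' v.1)).carrier :=
  Quot.lift (tripleVal hR hR') fun _ _ h => tripleVal_rel hR hR' h

theorem bisetMap_act (h : (matingGroups hR hR').FundGroup u)
    (b : ((matingBisets hR hR').fundBiset u v).carrier) (g : (matingGroups hR hR').FundGroup v) :
    bisetMap hR hR' (((matingBisets hR hR').fundBiset u v).act h b g) =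
      Corr.translate (realizeHom hR hR' h) (bisetMap hR hR' b) (realizeHom hR hR' g) := by
  induction b using Quot.ind with
  | mk t =>
    refine Eq.trans ?_ (Corr.translate_translate _ _ _ _ _).symm
    exact congrArg₂ (fun x y => Corr.translate x (realizeBiset hR hR' t.z.1 t.b) y)
      (realizeHom_comp hR hR' h t.q) (realizeHom_comp hR hR' t.p g)

/-! ### Representatives off the equator -/

variable (p q) in
/-- The points of the domain of the correspondence off the equator. -/
abbrev OffEquatorDom : Type := {z : ℂ // p.map z ∉ p.P} ⊕ {z : ℂ // q.map z ∉ q.P}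

variable (u v) in
/-- Decompositions of the paths of a triple at a point off the equator. -/
def Rep : OffEquatorDom p q → Type
  | .inl z => (matingGroups hR hR').Hom u (southV hR hR') ×
      PathClass (base hR) (inclusion p.map p.mapsTo_P z) ×
      PathClass (restriction p.map p.P z) (base hR) × (matingGroups hR hR').Hom (southV hR hR') v
  | .inr z => (matingGroups hR hR').Hom u (northV hR hR') ×
      PathClass (base hR') (inclusion q.map q.mapsTo_P z) ×
      PathClass (restriction q.map q.P z) (base hR') × (matingGroups hR hR').Hom (northV hR hR') v

/-- The first path of the triple. -/
noncomputable def repFst : ∀ a : OffEquatorDom p q, Rep hR hR' u v a →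
    PathClass (matingPt hR hR' u.1) (inclusion (formalMating p q) (mapsTo_matingP p q)
      (Sum.elim (southZ p q) (northZ p q) a))
  | .inl _ => fun x => (realizeHom hR hR' x.1).trans (Path.Homotopic.Quotient.map x.2.1 (southX p q))
  | .inr _ => fun x => (realizeHom hR hR' x.1).trans (Path.Homotopic.Quotient.map x.2.1 (northX p q))

/-- The second path of the triple. -/
noncomputable def repSnd : ∀ a : OffEquatorDom p q, Rep hR hR' u v a →
    PathClass (restriction (formalMating p q) (matingP p q)
      (Sum.elim (southZ p q) (northZ p q) a)) (matingPt hR hR' v.1)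
  | .inl z => fun x => ((Path.Homotopic.Quotient.map x.2.2.1 (southX p q)).cast
      (restriction_southZ z) rfl).trans (realizeHom hR hR' x.2.2.2)
  | .inr z => fun x => ((Path.Homotopic.Quotient.map x.2.2.1 (northX p q)).cast
      (restriction_northZ z) rfl).trans (realizeHom hR hR' x.2.2.2)

/-- The class in the fundamental biset. -/
noncomputable def repClass : ∀ a : OffEquatorDom p q, Rep hR hR' u v a →
    ((matingBisets hR hR').fundBiset u v).carrier
  | .inl z => fun x => GraphOfBisets.fundBiset.mk (𝔅 := matingBisets hR hR') (southV hR hR') x.1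
      (Corr.mk z x.2.1 x.2.2.1) x.2.2.2
  | .inr z => fun x => GraphOfBisets.fundBiset.mk (𝔅 := matingBisets hR hR') (northV hR hR') x.1
      (Corr.mk z x.2.1 x.2.2.1) x.2.2.2

theorem bisetMap_repClass (a : OffEquatorDom p q) (x : Rep hR hR' u v a) :
    bisetMap hR hR' (repClass hR hR' a x) = Corr.mk _ (repFst hR hR' a x) (repSnd hR hR' a x) := by
  rcases a with z | z
  · exact congrArg₂ (Corr.mk _) (congrArg _ (cast_rfl_rfl _)) rfl
  · exact congrArg₂ (Corr.mk _) (congrArg _ (cast_rfl_rfl _)) rfl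

/-- The first path starts at a basepoint, so it factors directly; the second ends at one, so its
inverse is factored. -/
theorem exists_rep (a : OffEquatorDom p q)
    (δ : PathClass (matingPt hR hR' u.1) (inclusion (formalMating p q) (mapsTo_matingP p q)
      (Sum.elim (southZ p q) (northZ p q) a)))
    (γ : PathClass (restriction (formalMating p q) (matingP p q)
      (Sum.elim (southZ p q) (northZ p q) a)) (matingPt hR hR' v.1)) :
    ∃ x : Rep hR hR' u v a, repFst hR hR' a x = δ ∧ repSnd hR hR' a x = γ := by
  rcases a with z | z
  · obtain ⟨h, α, e⟩ := exists_factor_south hR hR' (z := inclusion p.map p.mapsTo_P z) δ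
    obtain ⟨g, α', e'⟩ := exists_factor_south hR hR' (z := restriction p.map p.P z)
      (Path.Homotopic.Quotient.symm (γ.cast (restriction_southZ z).symm rfl))
    refine ⟨(h, α, α'.symm, g.inv), e.symm, ?_⟩
    refine (cast_trans _ _ _).trans (eq_cast_of_cast_eq _ ?_).symm
    rw [pathClass_map_symm, realizeHom_inv]
    have := congrArg Path.Homotopic.Quotient.symm e'
    rw [pathClass_symm_symm] at this
    exact this.trans (pathClass_trans_symm _ _)
  · obtain ⟨h, α, e⟩ := exists_factor_north hR hR' (z := inclusion q.map q.mapsTo_P z) δ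
    obtain ⟨g, α', e'⟩ := exists_factor_north hR hR' (z := restriction q.map q.P z)
      (Path.Homotopic.Quotient.symm (γ.cast (restriction_northZ z).symm rfl))
    refine ⟨(h, α, α'.symm, g.inv), e.symm, ?_⟩
    refine (cast_trans _ _ _).trans (eq_cast_of_cast_eq _ ?_).symm
    rw [pathClass_map_symm, realizeHom_inv]
    have := congrArg Path.Homotopic.Quotient.symm e'
    rw [pathClass_symm_symm] at this
    exact this.trans (pathClass_trans_symm _ _)

/-- If the point of a triple lies on the equator it is first moved off along a connector in the
domain of the correspondence; its two paths can then be decomposed. -/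
theorem bisetMap_surjective : Function.Surjective (bisetMap hR hR' (u := u) (v := v)) := by
  intro t
  induction t using Quot.ind with | mk t =>
  obtain ⟨z, δ, γ⟩ := t
  obtain ⟨a, c, -⟩ := exists_isConnector (iS := southZ p q) (iN := northZ p q) hR.pos hR'.pos
    (fun _ => collar_map_notMem hR hR') (fun _ => rfl)
    (fun z hz hz' => hz (by rw [formalMating_south]; exact (south_mem_iff p q _).mpr hz'))
    (fun _ => rfl)
    (fun z hz hz' => hz (by rw [formalMating_north]; exact (north_mem_iff p q _).mpr hz')) z
  obtain ⟨x, h1, h2⟩ := exists_rep hR hR' a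
    (δ.trans (c.map (inclusion (formalMating p q) (mapsTo_matingP p q))).symm)
    ((c.map (restriction (formalMating p q) (matingP p q))).trans γ)
  refine ⟨repClass hR hR' a x, (bisetMap_repClass hR hR' a x).trans ?_⟩
  refine Corr.mk_eq_iff.mpr ⟨c, h2, ?_⟩
  rw [h1, trans_assoc, symm_trans, trans_refl]

/-! ### Injectivity -/

theorem mk_southElt_left (h : (matingGroups hR hR').Hom u (southV hR hR')) (k : Pi1 (base hR))
    (b : (TopologicalPolynomial.biset hR).carrier)
    (g : (matingGroups hR hR').Hom (southV hR hR') v) :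
    GraphOfBisets.fundBiset.mk (𝔅 := matingBisets hR hR') (southV hR hR')
      (h.comp (southElt hR hR' k)) b g =
    GraphOfBisets.fundBiset.mk (𝔅 := matingBisets hR hR') (southV hR hR') h
      ((TopologicalPolynomial.biset hR).act k b 1) g :=
  Quot.sound (GraphOfBisets.TripleRel.left (𝔅 := matingBisets hR hR') (southV hR hR') h k b g)

theorem mk_northElt_left (h : (matingGroups hR hR').Hom u (northV hR hR')) (k : Pi1 (base hR'))
    (b : (TopologicalPolynomial.biset hR').carrier)
    (g : (matingGroups hR hR').Hom (northV hR hR') v) :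
    GraphOfBisets.fundBiset.mk (𝔅 := matingBisets hR hR') (northV hR hR')
      (h.comp (northElt hR hR' k)) b g =
    GraphOfBisets.fundBiset.mk (𝔅 := matingBisets hR hR') (northV hR hR') h
      ((TopologicalPolynomial.biset hR').act k b 1) g :=
  Quot.sound (GraphOfBisets.TripleRel.left (𝔅 := matingBisets hR hR') (northV hR hR') h k b g)

theorem mk_southElt_right (h : (matingGroups hR hR').Hom u (southV hR hR')) (k : Pi1 (base hR))
    (b : (TopologicalPolynomial.biset hR).carrier)
    (g : (matingGroups hR hR').Hom (southV hR hR') v) :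
    GraphOfBisets.fundBiset.mk (𝔅 := matingBisets hR hR') (southV hR hR') h b
      ((southElt hR hR' k).comp g) =
    GraphOfBisets.fundBiset.mk (𝔅 := matingBisets hR hR') (southV hR hR') h
      ((TopologicalPolynomial.biset hR).act 1 b k) g :=
  (Quot.sound
    (GraphOfBisets.TripleRel.right (𝔅 := matingBisets hR hR') (southV hR hR') h k b g)).symm

theorem mk_northElt_right (h : (matingGroups hR hR').Hom u (northV hR hR')) (k : Pi1 (base hR'))
    (b : (TopologicalPolynomial.biset hR').carrier)
    (g : (matingGroups hR hR').Hom (northV hR hR') v) :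
    GraphOfBisets.fundBiset.mk (𝔅 := matingBisets hR hR') (northV hR hR') h b
      ((northElt hR hR' k).comp g) =
    GraphOfBisets.fundBiset.mk (𝔅 := matingBisets hR hR') (northV hR hR') h
      ((TopologicalPolynomial.biset hR').act 1 b k) g :=
  (Quot.sound
    (GraphOfBisets.TripleRel.right (𝔅 := matingBisets hR hR') (northV hR hR') h k b g)).symm

/-- The triples related by a path `ε` have the same class in the fundamental biset. -/
def Compatible (u v : (matingGroups hR hR').graph.Vert) (a b : OffEquatorDom p q)
    (ε : PathClass (Sum.elim (southZ p q) (northZ p q) a)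
      (Sum.elim (southZ p q) (northZ p q) b)) : Prop :=
  ∀ (x : Rep hR hR' u v a) (y : Rep hR hR' u v b),
    repSnd hR hR' a x = (ε.map (restriction (formalMating p q) (matingP p q))).trans
      (repSnd hR hR' b y) →
    repFst hR hR' b y = (repFst hR hR' a x).trans
      (ε.map (inclusion (formalMating p q) (mapsTo_matingP p q))) →
    repClass hR hR' a x = repClass hR hR' b y

/-- A decomposition at the intermediate point is needed. It is obtained from `exists_rep`, for the
first path carried forward along `ε` and the second carried back along `ε'`. -/
theorem Compatible.trans {a b c : OffEquatorDom p q}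
    {ε : PathClass (Sum.elim (southZ p q) (northZ p q) a) (Sum.elim (southZ p q) (northZ p q) b)}
    {ε' : PathClass (Sum.elim (southZ p q) (northZ p q) b) (Sum.elim (southZ p q) (northZ p q) c)}
    (h : Compatible hR hR' u v a b ε) (h' : Compatible hR hR' u v b c ε') :
    Compatible hR hR' u v a c (ε.trans ε') := by
  intro x y h1 h2
  obtain ⟨w, hw1, hw2⟩ := exists_rep hR hR' b ((repFst hR hR' a x).trans
    (ε.map (inclusion (formalMating p q) (mapsTo_matingP p q))))
    ((ε'.map (restriction (formalMating p q) (matingP p q))).trans (repSnd hR hR' c y))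
  refine (h x w ?_ hw1).trans (h' w y hw2 ?_)
  · rw [h1, hw2, Corr.map_trans', trans_assoc]
  · rw [h2, hw1, Corr.map_trans', trans_assoc]

theorem Compatible.symm {a b : OffEquatorDom p q}
    {ε : PathClass (Sum.elim (southZ p q) (northZ p q) a) (Sum.elim (southZ p q) (northZ p q) b)}
    (h : Compatible hR hR' u v a b ε) : Compatible hR hR' u v b a ε.symm := by
  intro x y h1 h2
  refine (h y x ?_ ?_).symm
  · rw [h1, pathClass_map_symm, ← trans_assoc, trans_symm, refl_trans]
  · rw [h2, pathClass_map_symm, trans_assoc, symm_trans, trans_refl]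

/-- The two decompositions differ by loops `k` and `m` in the plane. Faithfulness of the realization
turns the equalities in the sphere into `h' = h k` and `g = m g'`; the loops then pass through the
tensor product, and what remains is the move along `ε` in `B(p)`. -/
theorem compatible_south {z z' : {z : ℂ // p.map z ∉ p.P}} (ε : PathClass z z') :
    Compatible hR hR' u v (.inl z) (.inl z') (ε.map (southZ p q)) := by
  rintro ⟨h, α, γ, g⟩ ⟨h', α', γ', g'⟩ h1 h2
  let ι := inclusion p.map p.mapsTo_P
  let φ := restriction p.map p.P
  let k : Pi1 (base hR) := (α.trans (ε.map ι)).trans α'.symm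
  let m : Pi1 (base hR) := γ.symm.trans ((ε.map φ).trans γ')
  have hk : Path.Homotopic.Quotient.trans k α' = α.trans (ε.map ι) := by
    change ((α.trans (ε.map ι)).trans α'.symm).trans α' = _
    rw [trans_assoc, symm_trans, trans_refl]
  have hm : Path.Homotopic.Quotient.trans γ m = (ε.map φ).trans γ' := by
    change γ.trans (γ.symm.trans ((ε.map φ).trans γ')) = _
    rw [← trans_assoc, trans_symm, refl_trans]
  have e1 : h' = h.comp (southElt hR hR' k) := by
    refine realizeHom_injective hR hR' _ _ ?_
    refine Eq.trans ?_ (realizeHom_comp hR hR' h (southElt hR hR' k)).symm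
    refine eq_trans_map_of_trans_eq (southX p q) (e := α.trans (ε.map ι)) (e' := α') ?_
    refine h2.trans ((trans_assoc _ _ _).trans ?_)
    rw [Corr.map_trans']
    induction ε using Path.Homotopic.Quotient.ind
    rfl
  have e2 : g = (southElt hR hR' m).comp g' := by
    refine realizeHom_injective hR hR' _ _ ?_
    refine Eq.trans ?_ (realizeHom_comp hR hR' (southElt hR hR' m) g').symm
    refine eq_map_trans_of_trans_eq (southX p q) (e := γ) (e' := (ε.map φ).trans γ') ?_
    refine cast_injective (restriction_southZ z) ?_
    refine (cast_trans _ _ _).symm.trans (h1.trans ((trans_assoc _ _ _).symm.trans ?_))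
    refine Eq.trans ?_ (cast_trans _ _ _)
    exact congrArg (fun c => Path.Homotopic.Quotient.trans c (realizeHom hR hR' g'))
      (Corr.map_trans_cast (southZ p q) (southX p q) restriction_southZ ε γ')
  subst e1 e2
  refine (mk_southElt_right hR hR' h m (Corr.mk z α γ) g').trans (Eq.trans ?_
    (mk_southElt_left hR hR' h k (Corr.mk z' α' γ') g').symm)
  refine congrArg (fun b => GraphOfBisets.fundBiset.mk (𝔅 := matingBisets hR hR')
    (southV hR hR') h b g') ?_
  refine Eq.trans (b := Corr.mk z α ((ε.map φ).trans γ')) ?_ ((Corr.mk_move ε α γ').trans ?_)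
  · exact congrArg₂ (Corr.mk z) (refl_trans α) hm
  · exact (congrArg₂ (Corr.mk z') hk (trans_refl γ')).symm

theorem compatible_north {z z' : {z : ℂ // q.map z ∉ q.P}} (ε : PathClass z z') :
    Compatible hR hR' u v (.inr z) (.inr z') (ε.map (northZ p q)) := by
  rintro ⟨h, α, γ, g⟩ ⟨h', α', γ', g'⟩ h1 h2
  let ι := inclusion q.map q.mapsTo_P
  let φ := restriction q.map q.P
  let k : Pi1 (base hR') := (α.trans (ε.map ι)).trans α'.symm
  let m : Pi1 (base hR') := γ.symm.trans ((ε.map φ).trans γ')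
  have hk : Path.Homotopic.Quotient.trans k α' = α.trans (ε.map ι) := by
    change ((α.trans (ε.map ι)).trans α'.symm).trans α' = _
    rw [trans_assoc, symm_trans, trans_refl]
  have hm : Path.Homotopic.Quotient.trans γ m = (ε.map φ).trans γ' := by
    change γ.trans (γ.symm.trans ((ε.map φ).trans γ')) = _
    rw [← trans_assoc, trans_symm, refl_trans]
  have e1 : h' = h.comp (northElt hR hR' k) := by
    refine realizeHom_injective hR hR' _ _ ?_
    refine Eq.trans ?_ (realizeHom_comp hR hR' h (northElt hR hR' k)).symm
    refine eq_trans_map_of_trans_eq (northX p q) (e := α.trans (ε.map ι)) (e' := α') ?_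
    refine h2.trans ((trans_assoc _ _ _).trans ?_)
    rw [Corr.map_trans']
    induction ε using Path.Homotopic.Quotient.ind
    rfl
  have e2 : g = (northElt hR hR' m).comp g' := by
    refine realizeHom_injective hR hR' _ _ ?_
    refine Eq.trans ?_ (realizeHom_comp hR hR' (northElt hR hR' m) g').symm
    refine eq_map_trans_of_trans_eq (northX p q) (e := γ) (e' := (ε.map φ).trans γ') ?_
    refine cast_injective (restriction_northZ z) ?_
    refine (cast_trans _ _ _).symm.trans (h1.trans ((trans_assoc _ _ _).symm.trans ?_))
    refine Eq.trans ?_ (cast_trans _ _ _)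
    exact congrArg (fun c => Path.Homotopic.Quotient.trans c (realizeHom hR hR' g'))
      (Corr.map_trans_cast (northZ p q) (northX p q) restriction_northZ ε γ')
  subst e1 e2
  refine (mk_northElt_right hR hR' h m (Corr.mk z α γ) g').trans (Eq.trans ?_
    (mk_northElt_left hR hR' h k (Corr.mk z' α' γ') g').symm)
  refine congrArg (fun b => GraphOfBisets.fundBiset.mk (𝔅 := matingBisets hR hR')
    (northV hR hR') h b g') ?_
  refine Eq.trans (b := Corr.mk z α ((ε.map φ).trans γ')) ?_ ((Corr.mk_move ε α γ').trans ?_)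
  · exact congrArg₂ (Corr.mk z) (refl_trans α) hm
  · exact (congrArg₂ (Corr.mk z') hk (trans_refl γ')).symm

/-- The decomposition `x` is replaced by `x₁`, with the same realizations but with the element 0 at
infinity in the middle. The edge relation carries `x₁` to `y₁`. The comparisons of `x` with `x₁` and
of `y₁` with `y` take place at one point, and are the hemisphere case for a constant path. -/
theorem compatible_meridian :
    Compatible hR hR' u v (.inl (circleDom hR 0)) (.inr (circleDom hR' 0)) (meridianZ hR hR') := by
  intro x y h1 h2
  obtain ⟨h, α, γ, g⟩ := x
  let x₁ : Rep hR hR' u v (.inl (circleDom hR 0)) :=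
    (h.comp (southElt hR hR' (α.trans (startPath hR).symm)), startPath hR,
      straightTo hR 0 (circle_mul_zero hR),
      (southElt hR hR' ((straightTo hR 0 (circle_mul_zero hR)).symm.trans γ)).comp g)
  let y₁ : Rep hR hR' u v (.inr (circleDom hR' 0)) :=
    (x₁.1.comp (edgeHom hR hR'), startPath hR', straightTo hR' 0 (circle_mul_zero hR'),
      (Hom.mk (GPath.edge (X := matingGroups hR hR') Segment.edgeRev (u := northV hR hR')
        (v := southV hR hR') rfl rfl)).comp x₁.2.2.2)
  have hx1 : repFst hR hR' (.inl (circleDom hR 0)) x₁ =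
      repFst hR hR' (.inl (circleDom hR 0)) (h, α, γ, g) := by
    refine (congrArg (fun c => Path.Homotopic.Quotient.trans c _) (realizeHom_comp hR hR' h
      (southElt hR hR' (α.trans (startPath hR).symm)))).trans ((trans_assoc _ _ _).trans ?_)
    refine congrArg (Path.Homotopic.Quotient.trans (realizeHom hR hR' h)) ?_
    refine (Corr.map_trans' (α.trans (startPath hR).symm) (startPath hR) (southX p q)).symm.trans ?_
    rw [trans_assoc, symm_trans, trans_refl]
  have hx2 : repSnd hR hR' (.inl (circleDom hR 0)) x₁ =
      repSnd hR hR' (.inl (circleDom hR 0)) (h, α, γ, g) := by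
    refine (cast_trans _ _ _).trans (Eq.trans ?_ (cast_trans _ _ _).symm)
    refine congrArg (fun c => Path.Homotopic.Quotient.cast c _ rfl) ?_
    refine (congrArg (Path.Homotopic.Quotient.trans _) (realizeHom_comp hR hR' (southElt hR hR'
      ((straightTo hR 0 (circle_mul_zero hR)).symm.trans γ)) g)).trans
      ((trans_assoc _ _ _).symm.trans ?_)
    refine congrArg (fun c => Path.Homotopic.Quotient.trans c (realizeHom hR hR' g)) ?_
    refine (Corr.map_trans' (straightTo hR 0 (circle_mul_zero hR))
      ((straightTo hR 0 (circle_mul_zero hR)).symm.trans γ) (southX p q)).symm.trans ?_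
    rw [← trans_assoc, trans_symm, refl_trans]
  have hxy : repClass hR hR' (.inl (circleDom hR 0)) x₁ =
      repClass hR hR' (.inr (circleDom hR' 0)) y₁ := by
    have h0 : atInfinity hR' (-(0 : ℤ)) = _ :=
      (congrArg (atInfinity hR') (neg_zero (G := ℤ))).trans (atInfinity_zero hR')
    refine (congrArg (fun b => GraphOfBisets.fundBiset.mk (𝔅 := matingBisets hR hR')
      (southV hR hR') x₁.1 b x₁.2.2.2) (atInfinity_zero hR)).symm.trans (Eq.trans ?_
      (congrArg (fun b => GraphOfBisets.fundBiset.mk (𝔅 := matingBisets hR hR')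
      (northV hR hR') y₁.1 b y₁.2.2.2) h0))
    exact Quot.sound (GraphOfBisets.TripleRel.edge (𝔅 := matingBisets hR hR') Segment.edge x₁.1
      (0 : ℤ) x₁.2.2.2)
  have hy1 : repFst hR hR' (.inr (circleDom hR' 0)) y₁ =
      (repFst hR hR' (.inl (circleDom hR 0)) x₁).trans
      ((meridianZ hR hR').map (inclusion (formalMating p q) (mapsTo_matingP p q))) := by
    refine (congrArg (fun c => Path.Homotopic.Quotient.trans c _) (realizeHom_comp hR hR' x₁.1
      (edgeHom hR hR'))).trans ((trans_assoc _ _ _).trans (Eq.trans ?_ (trans_assoc _ _ _).symm))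
    exact congrArg (Path.Homotopic.Quotient.trans (realizeHom hR hR' x₁.1))
      (meridianZ_map_inclusion hR hR').symm
  have hy2 : repSnd hR hR' (.inl (circleDom hR 0)) x₁ =
      ((meridianZ hR hR').map (restriction (formalMating p q) (matingP p q))).trans
        (repSnd hR hR' (.inr (circleDom hR' 0)) y₁) := by
    refine (congrArg (fun c => Path.Homotopic.Quotient.trans c (realizeHom hR hR' x₁.2.2.2))
      (meridianZ_map_restriction hR hR')).trans ((trans_assoc _ _ _).trans ?_)
    refine congrArg (Path.Homotopic.Quotient.trans _) ((trans_assoc _ _ _).trans ?_)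
    exact congrArg (Path.Homotopic.Quotient.trans _) (realizeHom_comp hR hR' (Hom.mk (GPath.edge
      (X := matingGroups hR hR') Segment.edgeRev (u := northV hR hR') (v := southV hR hR') rfl rfl))
      x₁.2.2.2).symm
  refine Eq.trans ?_ (hxy.trans ?_)
  · refine compatible_south hR hR' (.refl _) _ _ ?_ ?_
    · exact hx2.symm.trans (refl_trans _).symm
    · exact hx1.trans (trans_refl _).symm
  · refine compatible_north hR hR' (.refl _) _ _ ?_ ?_
    · exact (trans_left_cancel (hy2.symm.trans (hx2.trans h1))).trans (refl_trans _).symm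
    · exact h2.trans ((congrArg (fun c => Path.Homotopic.Quotient.trans c _) hx1.symm).trans
        (hy1.symm.trans (trans_refl _).symm))

/-- Compatibility is stable under composition and inversion, and holds for the generating paths of
the domain. -/
theorem compatible_all (a b : OffEquatorDom p q)
    (ε : PathClass (Sum.elim (southZ p q) (northZ p q) a)
      (Sum.elim (southZ p q) (northZ p q) b)) : Compatible hR hR' u v a b ε := by
  refine offEquator_induction (iS := southZ p q) (iN := northZ p q) hR.pos hR'.pos
    (fun _ => collar_map_notMem hR hR') (fun _ => rfl)
    (fun z hz hz' => hz (by rw [formalMating_south]; exact (south_mem_iff p q _).mpr hz'))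
    (fun _ => rfl)
    (fun z hz hz' => hz (by rw [formalMating_north]; exact (north_mem_iff p q _).mpr hz'))
    (Compatible hR hR' u v) (fun ε ε' h h' => Compatible.trans hR hR' h h')
    (fun ε => compatible_south hR hR' ε) (fun ε => compatible_north hR hR' ε)
    (circleDom hR 0) (circleDom hR' 0) (southZ_base hR hR') (northZ_base hR hR')
    (compatible_meridian hR hR') ?_ ε
  refine (congrArg (Compatible hR hR' u v _ _) ?_).mp
    (Compatible.symm hR hR' (compatible_meridian hR hR'))
  exact via_symm _ _ _ _ _

theorem exists_eq_repClass (t : ((matingBisets hR hR').fundBiset u v).carrier) :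
    ∃ a x, repClass hR hR' a x = t := by
  induction t using Quot.ind with | mk t =>
  obtain ⟨⟨z, hz⟩, h, b, g⟩ := t
  change Segment at z
  cases z with
  | south =>
    induction b using Quot.ind with | mk b =>
    exact ⟨.inl b.z, (h, b.δ, b.γ, g), rfl⟩
  | north =>
    induction b using Quot.ind with | mk b =>
    exact ⟨.inr b.z, (h, b.δ, b.γ, g), rfl⟩
  | edge => nomatch hz
  | edgeRev => nomatch hz

theorem bisetMap_injective : Function.Injective (bisetMap hR hR' (u := u) (v := v)) := by
  intro t t' h
  obtain ⟨a, x, rfl⟩ := exists_eq_repClass hR hR' t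
  obtain ⟨b, y, rfl⟩ := exists_eq_repClass hR hR' t'
  rw [bisetMap_repClass, bisetMap_repClass] at h
  obtain ⟨ε, h1, h2⟩ := Corr.mk_eq_iff.mp h
  exact compatible_all hR hR' a b ε x y h1 h2

end BisetMap

/-! ### The post-critical set of the formal mating -/

section Postcritical

variable {S S' : Type} [TopologicalSpace S] [TopologicalSpace S']

/-- Charts are transported in both directions along the open embedding `e`; near the image of `e`,
the map `F` is determined by `f`. -/
theorem isLocallyPower_of_conj (e : OpenPartialHomeomorph S S') (he : e.source = univ)
    {f : S → S} {F : S' → S'} (h : ∀ z, F (e z) = e (f z)) {x : S} {n : ℕ} :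
    IsLocallyPower F (e x) n ↔ IsLocallyPower f x n := by
  have hmem (z : S) : z ∈ e.source := he ▸ mem_univ z
  constructor
  · rintro ⟨φ, ψ, h1, h2, h3, h4, h5⟩
    rw [h] at h2 h4
    refine ⟨e.trans φ, e.trans ψ, ⟨hmem x, h1⟩, ⟨hmem _, h2⟩, h3, h4, ?_⟩
    filter_upwards [(e.continuousAt (hmem x)).eventually h5] with y hy
    rw [h] at hy
    exact ⟨⟨hmem _, hy.1⟩, hy.2⟩
  · rintro ⟨φ, ψ, h1, h2, h3, h4, h5⟩
    have hx := e.left_inv (hmem x)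
    have hfx := e.left_inv (hmem (f x))
    refine ⟨e.symm.trans φ, e.symm.trans ψ, ⟨e.map_source (hmem x), ?_⟩, ?_, ?_, ?_, ?_⟩
    · change e.symm (e x) ∈ φ.source
      rwa [hx]
    · rw [h]
      refine ⟨e.map_source (hmem _), ?_⟩
      change e.symm (e (f x)) ∈ ψ.source
      rwa [hfx]
    · change φ (e.symm (e x)) = 0
      rw [hx, h3]
    · change ψ (e.symm (F (e x))) = 0
      rw [h, hfx, h4]
    · have ht := e.map_source (hmem x)
      have hc : Tendsto e.symm (𝓝 (e x)) (𝓝 x) := by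
        have := e.symm.continuousAt (x := e x) ht
        rwa [ContinuousAt, hx] at this
      filter_upwards [hc.eventually h5, e.open_target.mem_nhds ht] with y hy hyt
      obtain ⟨z, rfl⟩ : ∃ z, e z = y := ⟨e.symm y, e.right_inv hyt⟩
      rw [e.left_inv (hmem z)] at hy
      refine ⟨?_, ?_⟩
      · rw [h]
        refine ⟨e.map_source (hmem _), ?_⟩
        change e.symm (e (f z)) ∈ ψ.source
        rw [e.left_inv (hmem _)]
        exact hy.1
      · change ψ (e.symm (F (e z))) = φ (e.symm (e z)) ^ n
        rw [h, e.left_inv (hmem _), e.left_inv (hmem _), hy.2]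

/-- The open embedding of the plane as the southern hemisphere. -/
noncomputable def southEmbedding : OpenPartialHomeomorph ℂ Sphere where
  toFun := south
  invFun s := s.1.1 / ((-s.1.2 : ℝ) : ℂ)
  source := univ
  target := {s | s.1.2 < 0}
  map_source' z _ := south_snd_neg z
  map_target' _ _ := mem_univ _
  left_inv' z _ := south_injective (south_of_neg (south_snd_neg z))
  right_inv' _ hs := south_of_neg hs
  open_source := isOpen_univ
  open_target := isOpen_lt (by fun_prop) continuous_const
  continuousOn_toFun := south.continuous.continuousOn
  continuousOn_invFun := by
    refine ContinuousOn.div (by fun_prop) (by fun_prop) fun s hs => ?_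
    exact Complex.ofReal_ne_zero.mpr (neg_ne_zero.mpr (ne_of_lt hs))

/-- The open embedding of the plane as the northern hemisphere. -/
noncomputable def northEmbedding : OpenPartialHomeomorph ℂ Sphere :=
  southEmbedding.trans (Homeomorph.mk ⟨reflect, reflect, reflect_reflect, reflect_reflect⟩
    reflect.continuous reflect.continuous).toOpenPartialHomeomorph

/-- The power map of the plane is injective near nonzero points. -/
theorem eventually_pow_injective {d : ℕ} (hd : 0 < d) {w : ℂ} (hw : w ≠ 0) :
    ∀ᶠ a : ℂ × ℂ in 𝓝 w ×ˢ 𝓝 w, a.1 ^ d = a.2 ^ d → a.1 = a.2 := by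
  -- The quotient of two points with equal `d`-th powers is a root of unity. There are finitely
  -- many, so 1 is isolated among them, and the quotient is close to 1 for points near `w`.
  have hfin : {ζ : ℂ | ζ ^ d = 1}.Finite := by
    refine (Polynomial.nthRootsFinset d (1 : ℂ)).finite_toSet.subset fun ζ hζ => ?_
    exact (Polynomial.mem_nthRootsFinset hd (1 : ℂ)).mpr hζ
  have h1 : ∀ᶠ ζ in 𝓝 (1 : ℂ), ζ ^ d = 1 → ζ = 1 := by
    have : ({ζ : ℂ | ζ ^ d = 1} \ {1})ᶜ ∈ 𝓝 (1 : ℂ) :=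
      (hfin.subset sdiff_subset).isClosed.isOpen_compl.mem_nhds (by simp)
    filter_upwards [this] with ζ hζ h
    by_contra h'
    exact hζ ⟨h, h'⟩
  have h2 : Tendsto (fun a : ℂ × ℂ => a.1 / a.2) (𝓝 w ×ˢ 𝓝 w) (𝓝 1) := by
    have := (tendsto_fst (f := 𝓝 w) (g := 𝓝 w)).div (tendsto_snd (f := 𝓝 w) (g := 𝓝 w)) hw
    rwa [div_self hw] at this
  have h3 : ∀ᶠ a : ℂ × ℂ in 𝓝 w ×ˢ 𝓝 w, a.2 ≠ 0 :=
    tendsto_snd.eventually (isOpen_ne.mem_nhds hw)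
  filter_upwards [h2.eventually h1, h3] with a ha ha0 h
  refine (div_eq_one_iff_eq ha0).mp (ha ?_)
  rw [div_pow, h, div_self (pow_ne_zero _ ha0)]

variable {d : ℕ} (p q : TopologicalPolynomial d)

theorem formalMating_snd_eq_zero {s : Sphere} (h : (formalMating p q s).1.2 = 0) : s.1.2 = 0 := by
  rcases lt_trichotomy s.1.2 0 with hs | hs | hs
  · rw [← south_of_neg hs, formalMating_south] at h
    exact absurd h (south_snd_neg _).ne
  · exact hs
  · rw [← north_of_pos hs, formalMating_north] at h
    exact absurd h (north_snd_pos _).ne'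

/-- The formal mating has no critical points on the equator. -/
theorem notMem_criticalSet_of_equator {s : Sphere} (hs : s.1.2 = 0) :
    s ∉ criticalSet (formalMating p q) := by
  rintro ⟨n, hn, φ, ψ, h1, h2, h3, h4, h5⟩
  have hw : s.1.1 ≠ 0 := fun h => s.ne_zero (Prod.ext h hs)
  have hnorm : ‖s.1.1‖ ^ 2 = 1 := by
    have := s.2
    rwa [hs, zero_pow two_ne_zero, add_zero] at this
  obtain ⟨ζ, hζ⟩ : ∃ ζ : ℂ, IsPrimitiveRoot ζ n := ⟨_, Complex.isPrimitiveRoot_exp n (by omega)⟩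
  -- Points of the equator near `s`, used as test points: a local model of degree at least 2 would
  -- force other points with the same image.
  let c (x : ℝ) : Sphere := ⟨(s.1.1 * circlePt 1 x, 0), by
    rw [norm_mul, norm_circlePt one_pos, mul_one, hnorm, zero_pow two_ne_zero, add_zero]⟩
  have hc0 : c 0 = s := Subtype.ext (Prod.ext (by simp [c, circlePt_zero]) hs.symm)
  have hc : Tendsto c (𝓝 0) (𝓝 s) := by
    have : Continuous c := Continuous.subtype_mk
      ((continuous_const.mul (continuous_circlePt 1)).prodMk continuous_const) _
    simpa only [hc0] using this.tendsto 0
  have hφ : Tendsto φ (𝓝 s) (𝓝 0) := h3 ▸ φ.continuousAt h1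
  have ht : (0 : ℂ) ∈ φ.target := h3 ▸ φ.map_source h1
  have hφs : Tendsto φ.symm (𝓝 0) (𝓝 s) := by
    have := φ.symm.continuousAt (x := 0) ht
    rwa [ContinuousAt, ← h3, φ.left_inv h1, h3] at this
  have hmul : Tendsto (fun x => ζ * φ (c x)) (𝓝 0) (𝓝 0) := by
    simpa using (hφ.comp hc).const_mul ζ
  have hy := hφs.comp hmul
  have hfst : Tendsto (fun t : Sphere => t.1.1) (𝓝 s) (𝓝 s.1.1) :=
    Continuous.tendsto (by fun_prop) s
  have hinj := ((hfst.comp hc).prodMk (hfst.comp hy)).eventually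
    (eventually_pow_injective p.degree_pos hw)
  -- Multiplying the local coordinate of `c x` by `ζ` gives a point `y` with the same image. The
  -- preimage of the equator is the equator, where `w ↦ w ^ d` is locally injective, so `y = c x`.
  -- As `ζ ≠ 1`, the coordinate vanishes and `c x = s`, which contradicts the existence of
  -- arbitrarily small non-integral `x`.
  have key : ∀ᶠ x : ℝ in 𝓝 0, ∃ m : ℤ, x = (m : ℝ) := by
    filter_upwards [hinj, hc.eventually h5, hy.eventually h5, hmul.eventually
      (φ.open_target.mem_nhds ht), hc.eventually (φ.open_source.mem_nhds h1)] with x hx h6 h7 h8 h9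
    simp only [Function.comp] at hx h7
    set y := φ.symm (ζ * φ (c x))
    have e1 : φ y = ζ * φ (c x) := φ.right_inv h8
    have e2 : formalMating p q y = formalMating p q (c x) := by
      refine ψ.injOn h7.1 h6.1 ?_
      rw [h7.2, h6.2, e1, mul_pow, hζ.pow_eq_one, one_mul]
    have hcx := formalMating_equator p q (s := c x) rfl
    have hy0 : y.1.2 = 0 := formalMating_snd_eq_zero p q (by rw [e2, hcx])
    have e3 := formalMating_equator p q hy0
    rw [e2, hcx] at e3
    have e4 : c x = y := Subtype.ext (Prod.ext (hx (congrArg Prod.fst e3)) hy0.symm)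
    rw [← e4] at e1
    have e5 : φ (c x) = φ s := by
      rw [h3]
      by_contra h0
      exact hζ.ne_one hn (mul_right_cancel₀ h0 (e1.symm.trans (one_mul _).symm))
    have e6 := congrArg (fun t : Sphere => t.1.1) (φ.injOn h9 h1 e5)
    have e7 : circlePt 1 x = circlePt 1 0 := by
      rw [circlePt_zero, Complex.ofReal_one]
      exact mul_left_cancel₀ hw (e6.trans (mul_one _).symm)
    obtain ⟨m, hm⟩ := circlePt_eq_iff.mp e7
    exact ⟨m, by rw [hm, zero_add]⟩
  obtain ⟨x, ⟨m, rfl⟩, hx0, hx1⟩ := ((key.filter_mono nhdsWithin_le_nhds).and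
    (Ioo_mem_nhdsGT (zero_lt_one' ℝ))).exists
  have h6 : (0 : ℤ) < m := by exact_mod_cast hx0
  have h7 : m < (1 : ℤ) := by exact_mod_cast hx1
  omega

theorem south_mem_criticalSet (z : ℂ) :
    south z ∈ criticalSet (formalMating p q) ↔ z ∈ criticalSet p.toFun :=
  exists_congr fun _ => and_congr_right fun _ =>
    isLocallyPower_of_conj southEmbedding rfl (formalMating_south p q)

theorem north_mem_criticalSet (z : ℂ) :
    north z ∈ criticalSet (formalMating p q) ↔ z ∈ criticalSet q.toFun :=
  exists_congr fun _ => and_congr_right fun _ =>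
    isLocallyPower_of_conj northEmbedding (by simp [northEmbedding, southEmbedding])
      (formalMating_north p q)

theorem iterate_formalMating_south (n : ℕ) (z : ℂ) :
    (formalMating p q)^[n] (south z) = south (p.toFun^[n] z) :=
  ((Function.Semiconj.iterate_right (f := south) (fun z => (formalMating_south p q z).symm) n).eq
    z).symm

theorem iterate_formalMating_north (n : ℕ) (z : ℂ) :
    (formalMating p q)^[n] (north z) = north (q.toFun^[n] z) :=
  ((Function.Semiconj.iterate_right (f := north) (fun z => (formalMating_north p q z).symm) n).eq
    z).symm

/-- No critical point lies on the equator, and both open hemispheres are invariant, so critical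
orbits can be computed in the two planes. -/
theorem postcriticalSet_formalMating : postcriticalSet (formalMating p q) = matingP p q := by
  refine Subset.antisymm ?_ (union_subset ?_ ?_)
  · rintro _ ⟨n, hn, c, hc, rfl⟩
    rcases lt_trichotomy c.1.2 0 with hs | hs | hs
    · rw [← south_of_neg hs] at hc ⊢
      rw [iterate_formalMating_south]
      exact .inl ⟨_, ⟨n, hn, _, (south_mem_criticalSet p q _).mp hc, rfl⟩, rfl⟩
    · exact absurd hc (notMem_criticalSet_of_equator p q hs)
    · rw [← north_of_pos hs] at hc ⊢
      rw [iterate_formalMating_north]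
      exact .inr ⟨_, ⟨n, hn, _, (north_mem_criticalSet p q _).mp hc, rfl⟩, rfl⟩
  · rintro _ ⟨_, ⟨n, hn, c, hc, rfl⟩, rfl⟩
    exact ⟨n, hn, south c, (south_mem_criticalSet p q c).mpr hc, iterate_formalMating_south p q n c⟩
  · rintro _ ⟨_, ⟨n, hn, c, hc, rfl⟩, rfl⟩
    exact ⟨n, hn, north c, (north_mem_criticalSet p q c).mpr hc, iterate_formalMating_north p q n c⟩

end Postcritical

end Mating

theorem theorem5p6 {d : ℕ} (p q : TopologicalPolynomial d) (R R' : ℝ)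
    (hR : p.NearInfinity R) (hR' : q.NearInfinity R') :
    postcriticalSet (formalMating p q) = matingP p q ∧
    ∃ θ : ∀ v : (matingGroups hR hR').graph.Vert,
        (matingGroups hR hR').FundGroup v ≃* Pi1 (matingPt hR hR' v.1),
      (∀ (v : (matingGroups hR hR').graph.Vert) (g : GraphOfGroups.GPath (matingGroups hR hR') v v),
        θ v (GraphOfGroups.Hom.mk g) = realize hR hR' g) ∧
      ∀ u v : (matingGroups hR hR').graph.Vert,
        ∃ β : ((matingBisets hR hR').fundBiset u v).carrier ≃
            (matingBiset p q (matingPt hR hR' u.1) (matingPt hR hR' v.1)).carrier,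
          ((matingBisets hR hR').fundBiset u v).IsCongruence
            (matingBiset p q (matingPt hR hR' u.1) (matingPt hR hR' v.1))
            (θ u).toMonoidHom (θ v).toMonoidHom β ∧
          ∀ (z : (matingBisets hR hR').graph.Vert) (h : GraphOfGroups.GPath (matingGroups hR hR') u z)
            (b : ((matingBisets hR hR').B z.1).carrier)
            (g : GraphOfGroups.GPath (matingGroups hR hR') z v),
            β (GraphOfBisets.fundBiset.mk (𝔅 := matingBisets hR hR') z
                (GraphOfGroups.Hom.mk h) b (GraphOfGroups.Hom.mk g)) =
              Corr.translate (realize hR hR' h) (realizeBiset hR hR' z.1 b)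
                (realize hR hR' g) := by
  refine ⟨postcriticalSet_formalMating p q, realizeEquiv hR hR', fun v g => rfl, fun u v => ?_⟩
  refine ⟨Equiv.ofBijective (bisetMap hR hR')
    ⟨bisetMap_injective hR hR', bisetMap_surjective hR hR'⟩, fun h b g => ?_, fun z h b g => rfl⟩
  exact bisetMap_act hR hR' h b g
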